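/- Let $V_n$ be the space of bilinear products $\mu:\mathbb C^n\times\mathbb C^n\to\mathbb C^n$, with the Hermitian inner product induced by the standard one of $\mathbb C^n$ and the action $g.\mu(X,Y)=g\mu(g^{-1}X,g^{-1}Y)$ of $\mathrm{GL}(n,\mathbb C)$. For $0\neq\mu\in V_n$ let $m([\mu])$ be the moment map of the $\mathrm U(n)$-action on $\mathbb PV_n$: the Hermitian matrix with $(m([\mu]),A)=\frac{1}{\|\mu\|^2}\,\frac{d}{dt}\big|_{t=0}\|(I+tA).\mu\|^2$ for all Hermitian $A$, where $(A,B)=\operatorname{tr}AB^*$. Put $M_\mu=\|\mu\|^2m([\mu])=2\sum_i L_{e_i}L_{e_i}^*-2\sum_i L_{e_i}^*L_{e_i}-2\sum_i R_{e_i}^*R_{e_i}$ (with $L_X$, $R_X$ the left and right multiplications of $\mu$ and $(e_i)$ the standard basis) and $F_n([\mu])=(m([\mu]),m([\mu]))$. A critical point of $F_n$ on the variety $\mathcal A_n\subset\mathbb PV_n$ of associative products is a critical point of $F_n:\mathbb PV_n\to\mathbb R$ that lies in $\mathcal A_n$. A critical point satisfies $M_\mu=cI+D$ with $c\in\mathbb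 R$ and $D$ a derivation of $\mu$; its type is $(k_1<\dots<k_r;d_1,\dots,d_r)$ if for some $t>0$ the eigenvalues of $tD$ are the integers $k_1<\dots<k_r$ without common factor, with multiplicities $d_1,\dots,d_r$ (type $(0;n)$ if $D=0$). Let $\psi_k^{i,j}$ be the product with $e_ie_j=e_k$ and all other products of basis vectors zero. **Dimension 2.** Every two-dimensional complex associative (not necessarily unital) algebra with nonzero multiplication is isomorphic to a critical point of $F_2:\mathcal A_2\to\mathbb R$, and it is isomorphic to an algebra in exactly one row of the following table. Every algebra in the table is associative and isomorphic to a critical point, and each critical point isomorphic to it has the type and the critical value listed. | algebra | type | value | |---|---|---| | $d_1=\psi_1^{1,1}$ | $(0<1;1,1)$ | $4$ | | $d_2=\psi_1^{1,1}+\psi_2^{1,2}$ | $(0<1;1,1)$ | $4$ | | $d_3=\psi_1^{1,1}+\psi_2^{2,1}$ | $(0<1;1,1)$ | $4$ | | $d_4=\psi_1^{1,1}+\psi_2^{2,2}$ | $(0;2)$ | $2$ | | $d_5=\psi_2^{1,1}$ | $(1<2;1,1)$ | $20$ | | $d_6=\psi_1^{1,1}+\psi_2^{1,2}+\psi_2^{2,1}$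 | $(0<1;1,1)$ | $4$ | **Dimension 3.** Let $d_{21}=\psi_3^{1,1}+\psi_3^{1,2}-\psi_3^{2,1}$. A three-dimensional complex associative algebra with nonzero multiplication is isomorphic to a critical point of $F_3:\mathcal A_3\to\mathbb R$ if and only if it is not isomorphic to the (associative) algebra $d_{21}$, and in that case it is isomorphic to an algebra in exactly one row of the following table. Every algebra in the table is associative and isomorphic to a critical point, and each critical point isomorphic to it has the type and the critical value listed. | algebra | type | value | |---|---|---| | $d_1=\psi_1^{1,1}$ | $(0<1;1,2)$ | $4$ | | $d_2=\psi_1^{1,1}+\psi_3^{2,2}$ | $(0<1<2;1,1,1)$ | $\frac{10}{3}$ | | $d_3=\psi_1^{1,1}+\psi_3^{1,3}$ | $(0<1;1,2)$ | $4$ | | $d_4=\psi_1^{1,1}+\psi_3^{3,1}$ | $(0<1;1,2)$ | $4$ | | $d_5=\psi_1^{1,1}+\psi_3^{1,3}+\psi_3^{3,1}$ | $(0<1;1,2)$ | $4$ | | $d_6=\psi_1^{1,1}+\psi_3^{3,3}$ | $(0<1;2,1)$ | $2$ | | $d_7=\psi_1^{1,1}+\psi_2^{2,1}+\psi_3^{1,3}$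 | $(0<1;1,2)$ | $4$ | | $d_8=\psi_1^{1,1}+\psi_2^{2,1}+\psi_3^{3,1}$ | $(0<1;1,2)$ | $4$ | | $d_9=\psi_1^{1,1}+\psi_2^{2,1}+\psi_3^{1,3}+\psi_3^{3,1}$ | $(0<1;1,2)$ | $4$ | | $d_{10}=\psi_1^{1,1}+\psi_2^{2,1}+\psi_3^{3,3}$ | $(0<1;2,1)$ | $2$ | | $d_{11}=\psi_1^{1,1}+\psi_2^{2,2}+\psi_3^{2,3}$ | $(0<1;2,1)$ | $2$ | | $d_{12}=\psi_1^{1,1}+\psi_2^{2,2}+\psi_3^{2,3}+\psi_3^{3,2}$ | $(0<1;2,1)$ | $2$ | | $d_{13}=\psi_1^{1,1}+\psi_2^{2,2}+\psi_3^{2,3}+\psi_3^{3,1}$ | $(0<1;2,1)$ | $2$ | | $d_{14}=\psi_1^{1,1}+\psi_2^{2,2}+\psi_3^{3,3}$ | $(0;3)$ | $\frac43$ | | $d_{15}=\psi_2^{1,1}$ | $(3<5<6;1,1,1)$ | $20$ | | $d_{16}=\psi_2^{1,1}+\psi_3^{1,2}+\psi_3^{2,1}$ | $(1<2<3;1,1,1)$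 | $\frac{28}{3}$ | | $d_{17}=\psi_1^{1,1}+\psi_2^{1,1}+\psi_2^{1,2}+\psi_2^{2,1}+\psi_3^{1,3}$ | $(0<1;1,2)$ | $4$ | | $d_{18}=\psi_1^{1,1}+\psi_2^{1,1}+\psi_2^{1,2}+\psi_2^{2,1}+\psi_3^{1,3}+\psi_3^{3,1}$ | $(0<1;1,2)$ | $4$ | | $d_{19}=\psi_3^{3,3}+\psi_2^{1,1}+\psi_1^{1,3}+\psi_1^{3,1}+\psi_2^{2,3}+\psi_2^{3,2}$ | $(0<1<2;1,1,1)$ | $\frac{10}{3}$ | | $d_{20}=\psi_1^{1,1}+\psi_2^{1,2}+\psi_3^{1,3}$ | $(0<1;1,2)$ | $4$ | | $d_{22}=x\psi_3^{1,2}+y\psi_3^{2,1}$, any $(x,y)\in\mathbb C^2\setminus\{(0,0)\}$ | $(1<2;2,1)$ | $12$ | -/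

import Mathlib

open Matrix Polynomial

/-- The space `V_n` of complex `n`-dimensional algebras, i.e. of bilinear products on `ℂⁿ`:
`μ` is given by its structure constants, `e_i e_j = ∑ k, μ (i, j, k) e_k`. Its Euclidean norm is the
one that the standard Hermitian inner product of `ℂⁿ` induces on `V_n`. -/
abbrev AlgSpace (n : ℕ) : Type := EuclideanSpace ℂ (Fin n × Fin n × Fin n)

namespace AlgSpace

variable {n : ℕ}

/-- The product `μ(X, Y)`. -/
def mul (μ : AlgSpace n) (X Y : Fin n → ℂ) : Fin n → ℂ :=
  fun k => ∑ i, ∑ j, X i * Y j * μ (i, j, k)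

/-- The product of `μ` is associative. -/
def IsAssoc (μ : AlgSpace n) : Prop :=
  ∀ X Y Z, μ.mul (μ.mul X Y) Z = μ.mul X (μ.mul Y Z)

/-- The matrix `D` is a derivation of `μ`. -/
def IsDer (μ : AlgSpace n) (D : Matrix (Fin n) (Fin n) ℂ) : Prop :=
  ∀ X Y, D *ᵥ μ.mul X Y = μ.mul (D *ᵥ X) Y + μ.mul X (D *ᵥ Y)

/-- Isomorphism of algebras. -/
def Iso (μ ν : AlgSpace n) : Prop :=
  ∃ φ : (Fin n → ℂ) ≃ₗ[ℂ] (Fin n → ℂ), ∀ X Y, φ (μ.mul X Y) = ν.mul (φ X) (φ Y)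

/-- The complex algebra `A` is isomorphic to `ℂⁿ` with the product `μ`. -/
def IsModelOf (μ : AlgSpace n) (A : Type*) [NonUnitalRing A] [Module ℂ A] : Prop :=
  ∃ φ : A ≃ₗ[ℂ] (Fin n → ℂ), ∀ x y, φ (x * y) = μ.mul (φ x) (φ y)

/-- The action `g.μ (X, Y) = g μ(g⁻¹ X, g⁻¹ Y)` (meaningful for invertible `g`). -/
noncomputable def act (g : Matrix (Fin n) (Fin n) ℂ) (μ : AlgSpace n) : AlgSpace n :=
  WithLp.toLp 2 fun p =>
    (g *ᵥ μ.mul (g⁻¹ *ᵥ Pi.single p.1 1) (g⁻¹ *ᵥ Pi.single p.2.1 1)) p.2.2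

/-- The function `ρ_μ (g) = ⟨g.μ, g.μ⟩`. -/
noncomputable def rho (μ : AlgSpace n) (g : Matrix (Fin n) (Fin n) ℂ) : ℝ := ‖act g μ‖ ^ 2

/-- Matrix of the left multiplication by the basis vector `e_i`. -/
def leftMul (μ : AlgSpace n) (i : Fin n) : Matrix (Fin n) (Fin n) ℂ :=
  Matrix.of fun k j => μ (i, j, k)

/-- Matrix of the right multiplication by the basis vector `e_i`. -/
def rightMul (μ : AlgSpace n) (i : Fin n) : Matrix (Fin n) (Fin n) ℂ :=
  Matrix.of fun k j => μ (j, i, k)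

/-- `M_μ = 2 ∑ L L* - 2 ∑ L* L - 2 ∑ R* R`, sums over the left and right multiplications by the
vectors of the standard orthonormal basis. -/
noncomputable def momentMatrix (μ : AlgSpace n) : Matrix (Fin n) (Fin n) ℂ :=
  (2 : ℂ) • ∑ i, μ.leftMul i * (μ.leftMul i)ᴴ - (2 : ℂ) • ∑ i, (μ.leftMul i)ᴴ * μ.leftMul i
    - (2 : ℂ) • ∑ i, (μ.rightMul i)ᴴ * μ.rightMul i

/-- The moment map `m([μ]) = M_μ / ‖μ‖²` (for `μ ≠ 0`). The theorems `momentMap_isHermitian`,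
`momentMap_spec` and `momentMap_unique` below say that this is the moment map of the action of
`U(n)`: the unique Hermitian matrix with `(m([μ]), A) = (dρ_μ)_1 A / ‖μ‖²` for all Hermitian `A`,
where `(A, B) = tr (A B*)`. -/
noncomputable def momentMap (μ : AlgSpace n) : Matrix (Fin n) (Fin n) ℂ :=
  (((‖μ‖ ^ 2)⁻¹ : ℝ) : ℂ) • μ.momentMatrix

/-- `F_n([μ]) = ‖m([μ])‖² = tr (m m*)` (for `μ ≠ 0`), as a function on `V_n ∖ {0}` that is constant
on complex lines. -/
noncomputable def F (μ : AlgSpace n) : ℝ := (μ.momentMap * μ.momentMapᴴ).trace.re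

/-- `[μ]` is a critical point of `F_n : ℙ V_n → ℝ`. Since `V_n ∖ {0} → ℙ V_n` is a surjective
submersion, this says that `μ ≠ 0` and that the real derivative of `F_n` at `μ` vanishes. -/
def IsCritical (μ : AlgSpace n) : Prop :=
  μ ≠ 0 ∧ HasFDerivAt (F (n := n)) (0 : AlgSpace n →L[ℝ] ℝ) μ

/-- `[μ]` is of critical type `(k₁ < ⋯ < k_r; d₁, …, d_r)`, given as the list of the pairs
`(k_i, d_i)`: we have `M_μ = c I + D` with `c` real and `D` a derivation of `μ`, and for some `t > 0`
the eigenvalues of `t D` are `k_i` with multiplicity `d_i`, where the `k_i` are integers without a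
common factor (or where `D = 0`, of type `(0; n)`). -/
def HasType (μ : AlgSpace n) (τ : List (ℤ × ℕ)) : Prop :=
  (τ.map Prod.fst).Pairwise (· < ·) ∧ (∀ p ∈ τ, 0 < p.2) ∧
    ((∀ m : ℤ, (∀ p ∈ τ, m ∣ p.1) → IsUnit m) ∨ τ = [(0, n)]) ∧
    ∃ (c t : ℝ) (D : Matrix (Fin n) (Fin n) ℂ), 0 < t ∧ μ.IsDer D ∧
      μ.momentMatrix = (c : ℂ) • (1 : Matrix (Fin n) (Fin n) ℂ) + D ∧
      ((t : ℂ) • D).charpoly = (τ.map fun p => (X - C (p.1 : ℂ)) ^ p.2).prod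

theorem act_apply (g : Matrix (Fin n) (Fin n) ℂ) (μ : AlgSpace n) (i j k : Fin n) :
    act g μ (i, j, k) = ∑ r, g k r * ∑ p, ∑ q, g⁻¹ p i * g⁻¹ q j * μ (p, q, r) := by
  simp [act, mul, Matrix.mulVec, dotProduct, Pi.single_apply]

theorem momentMatrix_isHermitian (μ : AlgSpace n) : μ.momentMatrix.IsHermitian := by
  simp [momentMatrix, Matrix.IsHermitian, Matrix.conjTranspose_sub, Matrix.conjTranspose_smul,
    Matrix.conjTranspose_sum, Matrix.conjTranspose_mul]

theorem momentMap_isHermitian (μ : AlgSpace n) : μ.momentMap.IsHermitian := by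
  have h := μ.momentMatrix_isHermitian
  simp only [Matrix.IsHermitian] at h ⊢
  simp [momentMap, Matrix.conjTranspose_smul, h]

open scoped Matrix.Norms.Operator in
theorem hasDerivAt_inv_line (A : Matrix (Fin n) (Fin n) ℂ) (i j : Fin n) :
    HasDerivAt (fun t : ℝ => (1 + t • A)⁻¹ i j) (-A i j) 0 := by
  have h0 : HasDerivAt (fun t : ℝ => (1 + t • A)) A 0 := by
    have h := ((hasDerivAt_id (0 : ℝ)).smul_const A).const_add 1
    rw [one_smul] at h
    exact h
  have h1 := hasFDerivAt_ringInverse (𝕜 := ℝ) (1 : (Matrix (Fin n) (Fin n) ℂ)ˣ)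
  have h2 : HasDerivAt (fun t : ℝ => (1 + t • A)⁻¹) (-A) 0 := by
    have h3 : HasFDerivAt (Ring.inverse (M₀ := Matrix (Fin n) (Fin n) ℂ))
        (-ContinuousLinearMap.mulLeftRight ℝ (Matrix (Fin n) (Fin n) ℂ) 1 1)
        (1 + (0 : ℝ) • A) := by
      simpa using h1
    have := h3.comp_hasDerivAt (0 : ℝ) h0
    simp only [_root_.neg_apply, ContinuousLinearMap.mulLeftRight_apply, one_mul,
      mul_one, Function.comp_def] at this
    simp only [Matrix.nonsing_inv_eq_ringInverse]
    exact this
  have h4 := hasDerivAt_pi.1 h2 i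
  exact hasDerivAt_pi.1 h4 j

/-- The structure constants of `A.μ (X, Y) = A μ(X, Y) - μ(A X, Y) - μ(X, A Y)`. -/
theorem hasDerivAt_act (μ : AlgSpace n) (A : Matrix (Fin n) (Fin n) ℂ) (i j k : Fin n) :
    HasDerivAt (fun t : ℝ => act (1 + t • A) μ (i, j, k))
      (∑ r, A k r * μ (i, j, r) - ∑ p, A p i * μ (p, j, k) - ∑ q, A q j * μ (i, q, k)) 0 := by
  have hg : ∀ a b, HasDerivAt (fun t : ℝ => (1 + t • A) a b) (A a b) 0 := by
    intro a b
    have h := ((hasDerivAt_id (0 : ℝ)).smul_const (A a b)).const_add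
      ((1 : Matrix (Fin n) (Fin n) ℂ) a b)
    rw [one_smul] at h
    exact h
  have hi := hasDerivAt_inv_line A
  simp only [act_apply]
  have h := HasDerivAt.fun_sum (u := Finset.univ) fun r _ => (hg k r).mul
    (HasDerivAt.fun_sum (u := Finset.univ) fun p _ =>
      HasDerivAt.fun_sum (u := Finset.univ) fun q _ =>
        ((hi p i).mul (hi q j)).mul_const (μ (p, q, r)))
  refine h.congr_deriv ?_
  simp [Matrix.one_apply, add_mul, Finset.sum_add_distrib]
  ring

theorem trace_momentMatrix_mul (μ : AlgSpace n) (A : Matrix (Fin n) (Fin n) ℂ) :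
    (μ.momentMatrix * A).trace = 2 * ∑ i, ∑ j, ∑ k,
      (∑ r, A k r * μ (i, j, r) - ∑ p, A p i * μ (p, j, k) - ∑ q, A q j * μ (i, q, k)) *
        star (μ (i, j, k)) := by
  have h1 : ∀ i, (μ.leftMul i * (μ.leftMul i)ᴴ * A).trace =
      ∑ j, ∑ k, (∑ r, A k r * μ (i, j, r)) * star (μ (i, j, k)) := by
    intro i
    simp only [Matrix.trace, Matrix.diag, Matrix.mul_apply, Matrix.conjTranspose_apply, leftMul,
      Matrix.of_apply, Finset.sum_mul]
    rw [Finset.sum_comm]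
    conv_lhs => enter [2, b]; rw [Finset.sum_comm]
    rw [Finset.sum_comm]
    refine Finset.sum_congr rfl fun j _ => Finset.sum_congr rfl fun k _ =>
      Finset.sum_congr rfl fun r _ => by ring
  have h2 : ∀ i, ((μ.leftMul i)ᴴ * μ.leftMul i * A).trace =
      ∑ j, ∑ k, (∑ q, A q j * μ (i, q, k)) * star (μ (i, j, k)) := by
    intro i
    simp only [Matrix.trace, Matrix.diag, Matrix.mul_apply, Matrix.conjTranspose_apply, leftMul,
      Matrix.of_apply, Finset.sum_mul]
    refine Finset.sum_congr rfl fun j _ => ?_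
    rw [Finset.sum_comm]
    refine Finset.sum_congr rfl fun k _ => Finset.sum_congr rfl fun r _ => by ring
  have h3 : ∀ j, ((μ.rightMul j)ᴴ * μ.rightMul j * A).trace =
      ∑ i, ∑ k, (∑ p, A p i * μ (p, j, k)) * star (μ (i, j, k)) := by
    intro j
    simp only [Matrix.trace, Matrix.diag, Matrix.mul_apply, Matrix.conjTranspose_apply, rightMul,
      Matrix.of_apply, Finset.sum_mul]
    refine Finset.sum_congr rfl fun i _ => ?_
    rw [Finset.sum_comm]
    refine Finset.sum_congr rfl fun k _ => Finset.sum_congr rfl fun r _ => by ring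
  simp only [momentMatrix, Matrix.smul_mul, Matrix.trace_sub, Matrix.trace_smul,
    Matrix.sum_mul, Matrix.trace_sum, h1, h2, h3, sub_mul, Finset.sum_sub_distrib, smul_eq_mul]
  rw [Finset.sum_comm (f := fun j i => ∑ k, (∑ p, A p i * μ (p, j, k)) * star (μ (i, j, k)))]
  ring

theorem momentMap_spec (μ : AlgSpace n) {A : Matrix (Fin n) (Fin n) ℂ} (hA : A.IsHermitian) :
    (μ.momentMap * Aᴴ).trace = ((lineDeriv ℝ μ.rho 1 A / ‖μ‖ ^ 2 : ℝ) : ℂ) := by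
  have hd : HasDerivAt (fun t : ℝ => μ.rho (1 + t • A)) (μ.momentMatrix * A).trace.re 0 := by
    have hc : ∀ p : Fin n × Fin n × Fin n, HasDerivAt (fun t : ℝ => ‖act (1 + t • A) μ p‖ ^ 2)
        (2 * ((∑ r, A p.2.2 r * μ (p.1, p.2.1, r) - ∑ q, A q p.1 * μ (q, p.2.1, p.2.2)
          - ∑ q, A q p.2.1 * μ (p.1, q, p.2.2)) * star (μ p)).re) 0 := by
      rintro ⟨i, j, k⟩
      have h := (hasDerivAt_act μ A i j k).norm_sq
      refine h.congr_deriv ?_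
      have h0 : act (1 + (0 : ℝ) • A) μ (i, j, k) = μ (i, j, k) := by
        simp [act_apply, Matrix.one_apply]
      rw [h0, Complex.inner]
      simp
    have h := HasDerivAt.fun_sum (u := Finset.univ) fun p _ => hc p
    have e : (fun t : ℝ => μ.rho (1 + t • A)) = fun t => ∑ p, ‖act (1 + t • A) μ p‖ ^ 2 := by
      funext t
      rw [rho, EuclideanSpace.norm_sq_eq]
    rw [e]
    refine h.congr_deriv ?_
    rw [trace_momentMatrix_mul, ← Finset.mul_sum]
    simp only [Fintype.sum_prod_type]
    simp [Complex.re_sum]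
  have hl : lineDeriv ℝ μ.rho 1 A = (μ.momentMatrix * A).trace.re := hd.deriv
  have hr : (((μ.momentMatrix * A).trace.re : ℝ) : ℂ) = (μ.momentMatrix * A).trace := by
    refine Complex.conj_eq_iff_re.1 ?_
    have h := Matrix.trace_conjTranspose (μ.momentMatrix * A)
    rw [Matrix.conjTranspose_mul, hA.eq, μ.momentMatrix_isHermitian.eq, Matrix.trace_mul_comm] at h
    exact h.symm
  rw [hl, hA.eq, momentMap, Matrix.smul_mul, Matrix.trace_smul, ← hr, smul_eq_mul,
    ← Complex.ofReal_mul, div_eq_inv_mul]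
  simp only [Complex.ofReal_re]

open scoped ComplexOrder in
theorem momentMap_unique (μ : AlgSpace n) {m : Matrix (Fin n) (Fin n) ℂ} (hm : m.IsHermitian)
    (h : ∀ A : Matrix (Fin n) (Fin n) ℂ, A.IsHermitian →
      (m * Aᴴ).trace = ((lineDeriv ℝ μ.rho 1 A / ‖μ‖ ^ 2 : ℝ) : ℂ)) :
    m = μ.momentMap := by
  have hB : (m - μ.momentMap).IsHermitian := hm.sub μ.momentMap_isHermitian
  have h1 : ((m - μ.momentMap) * (m - μ.momentMap)ᴴ).trace = 0 := by
    rw [Matrix.sub_mul, Matrix.trace_sub, h _ hB, momentMap_spec μ hB, sub_self]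
  exact sub_eq_zero.1 (Matrix.trace_mul_conjTranspose_self_eq_zero_iff.1 h1)

/-- The product `ψ_k^{i,j}` with `e_i e_j = e_k` and all other products of basis vectors zero; the
basis vectors are numbered `e_1, …, e_n`. -/
noncomputable def psi (k i j : ℕ) : AlgSpace n :=
  WithLp.toLp 2 fun p =>
    if (p.1 : ℕ) + 1 = i ∧ (p.2.1 : ℕ) + 1 = j ∧ (p.2.2 : ℕ) + 1 = k then 1 else 0

/-- A row of a table of critical points: an algebra (or a family of algebras), the critical type, as
in `HasType`, and the critical value. -/
structure Row (n : ℕ) where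
  algebras : Set (AlgSpace n)
  type : List (ℤ × ℕ)
  value : ℝ

/-- The rows `d_1, …, d_6` for `n = 2`. -/
noncomputable def tableI : Fin 6 → Row 2 := ![
  ⟨{psi 1 1 1}, [(0, 1), (1, 1)], 4⟩,
  ⟨{psi 1 1 1 + psi 2 1 2}, [(0, 1), (1, 1)], 4⟩,
  ⟨{psi 1 1 1 + psi 2 2 1}, [(0, 1), (1, 1)], 4⟩,
  ⟨{psi 1 1 1 + psi 2 2 2}, [(0, 2)], 2⟩,
  ⟨{psi 2 1 1}, [(1, 1), (2, 1)], 20⟩,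
  ⟨{psi 1 1 1 + psi 2 1 2 + psi 2 2 1}, [(0, 1), (1, 1)], 4⟩]

/-- The algebra `d_21` for `n = 3`. -/
noncomputable def d21 : AlgSpace 3 := psi 3 1 1 + psi 3 1 2 - psi 3 2 1

/-- The rows `d_1, …, d_20, d_22` for `n = 3`. -/
noncomputable def tableII : Fin 21 → Row 3 := ![
  ⟨{psi 1 1 1}, [(0, 1), (1, 2)], 4⟩,
  ⟨{psi 1 1 1 + psi 3 2 2}, [(0, 1), (1, 1), (2, 1)], 10 / 3⟩,
  ⟨{psi 1 1 1 + psi 3 1 3}, [(0, 1), (1, 2)], 4⟩,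
  ⟨{psi 1 1 1 + psi 3 3 1}, [(0, 1), (1, 2)], 4⟩,
  ⟨{psi 1 1 1 + psi 3 1 3 + psi 3 3 1}, [(0, 1), (1, 2)], 4⟩,
  ⟨{psi 1 1 1 + psi 3 3 3}, [(0, 2), (1, 1)], 2⟩,
  ⟨{psi 1 1 1 + psi 2 2 1 + psi 3 1 3}, [(0, 1), (1, 2)], 4⟩,
  ⟨{psi 1 1 1 + psi 2 2 1 + psi 3 3 1}, [(0, 1), (1, 2)], 4⟩,
  ⟨{psi 1 1 1 + psi 2 2 1 + psi 3 1 3 + psi 3 3 1}, [(0, 1), (1, 2)], 4⟩,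
  ⟨{psi 1 1 1 + psi 2 2 1 + psi 3 3 3}, [(0, 2), (1, 1)], 2⟩,
  ⟨{psi 1 1 1 + psi 2 2 2 + psi 3 2 3}, [(0, 2), (1, 1)], 2⟩,
  ⟨{psi 1 1 1 + psi 2 2 2 + psi 3 2 3 + psi 3 3 2}, [(0, 2), (1, 1)], 2⟩,
  ⟨{psi 1 1 1 + psi 2 2 2 + psi 3 2 3 + psi 3 3 1}, [(0, 2), (1, 1)], 2⟩,
  ⟨{psi 1 1 1 + psi 2 2 2 + psi 3 3 3}, [(0, 3)], 4 / 3⟩,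
  ⟨{psi 2 1 1}, [(3, 1), (5, 1), (6, 1)], 20⟩,
  ⟨{psi 2 1 1 + psi 3 1 2 + psi 3 2 1}, [(1, 1), (2, 1), (3, 1)], 28 / 3⟩,
  ⟨{psi 1 1 1 + psi 2 1 1 + psi 2 1 2 + psi 2 2 1 + psi 3 1 3}, [(0, 1), (1, 2)], 4⟩,
  ⟨{psi 1 1 1 + psi 2 1 1 + psi 2 1 2 + psi 2 2 1 + psi 3 1 3 + psi 3 3 1}, [(0, 1), (1, 2)], 4⟩,
  ⟨{psi 3 3 3 + psi 2 1 1 + psi 1 1 3 + psi 1 3 1 + psi 2 2 3 + psi 2 3 2},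
    [(0, 1), (1, 1), (2, 1)], 10 / 3⟩,
  ⟨{psi 1 1 1 + psi 2 1 2 + psi 3 1 3}, [(0, 1), (1, 2)], 4⟩,
  ⟨{d | ∃ x y : ℂ, (x, y) ≠ (0, 0) ∧ d = x • psi 3 1 2 + y • psi 3 2 1}, [(1, 2), (2, 1)], 12⟩]

end AlgSpace

/-! The moment matrix satisfies tr(M_μ A) = 2⟨μ, A.μ⟩ for the infinitesimal action, and Hermitian
matrices act self-adjointly. Hence the gradient of F at μ is, up to a positive factor, the component
of M_μ.μ orthogonal to μ. As I.μ = -μ, criticality means that M_μ = cI + D with D a derivation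
(`isCritical_iff`).

A critical point minimizes F on its GL(n)-orbit. Diagonalize D with decreasing eigenvalues and write
a given g, up to unitary factors, as a triangular matrix. A triangular matrix only produces
structure constants of weight d_k - d_i - d_j ≥ 0, so M_{g.μ} pairs nonnegatively with a unitary
conjugate of D (`exists_unitary_trace_ge`). Expanding the squared distance between m([g.μ]) and the
corresponding conjugate of m([μ]) gives minimality (`IsCritical.F_le`). If both points are critical
the distance is zero, so the critical value and type are isomorphism invariants
(`IsCritical.hasType_of_iso`), and one critical representative per algebra determines both.

The representatives have structure constants √m arranged so that M_μ is diagonal with integer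
entries. Criticality, type, value and associativity are then identities between integers
(`certI_ok`, `certII_ok`); the family d_22 is monomial too and is treated by the same lemmas. For
d_21, a unitary change of basis reduces a hypothetical critical point to the triangular orbit of a
fixed normal form, where M_μ cannot differ from a derivation by a scalar
(`not_isCritical_of_apply`).

Completeness of the tables is a structural classification. A nil algebra has a nonzero annihilator,
and in dimension three either a cube or a square outside the chosen annihilator line determines it,
or it is a bilinear form on a plane. Otherwise there is a primitive idempotent e, and the Peirce
types of the remaining basis vectors leave few cases (`exists_row_two`,
`classified_of_finrank_eq_three`). Different rows are separated by critical value, the dimensions of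
the one-sided annihilators, and commutativity. -/

namespace AlgSpace

/-! ### Infinitesimal action and the critical point equation. -/

variable {n : ℕ}

/-- The infinitesimal action `(A.μ)(X, Y) = A μ(X, Y) - μ(A X, Y) - μ(X, A Y)`. -/
noncomputable def infAct (A : Matrix (Fin n) (Fin n) ℂ) (μ : AlgSpace n) : AlgSpace n :=
  WithLp.toLp 2 fun p => ∑ r, A p.2.2 r * μ (p.1, p.2.1, r) - ∑ q, A q p.1 * μ (q, p.2.1, p.2.2)
    - ∑ q, A q p.2.1 * μ (p.1, q, p.2.2)

theorem infAct_apply (A : Matrix (Fin n) (Fin n) ℂ) (μ : AlgSpace n) (i j k : Fin n) :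
    infAct A μ (i, j, k) = ∑ r, A k r * μ (i, j, r) - ∑ q, A q i * μ (q, j, k)
      - ∑ q, A q j * μ (i, q, k) := rfl

theorem infAct_add_right (A : Matrix (Fin n) (Fin n) ℂ) (μ ν : AlgSpace n) :
    infAct A (μ + ν) = infAct A μ + infAct A ν := by
  ext ⟨i, j, k⟩
  simp only [infAct_apply, PiLp.add_apply, mul_add, Finset.sum_add_distrib]
  ring

theorem infAct_smul_right (A : Matrix (Fin n) (Fin n) ℂ) (t : ℝ) (μ : AlgSpace n) :
    infAct A (t • μ) = t • infAct A μ := by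
  ext ⟨i, j, k⟩
  simp only [infAct_apply, PiLp.smul_apply, mul_smul_comm, ← Finset.smul_sum, smul_sub]

theorem infAct_add_left (A B : Matrix (Fin n) (Fin n) ℂ) (μ : AlgSpace n) :
    infAct (A + B) μ = infAct A μ + infAct B μ := by
  ext ⟨i, j, k⟩
  simp only [infAct_apply, PiLp.add_apply, Matrix.add_apply, add_mul, Finset.sum_add_distrib]
  ring

theorem infAct_smul_left (A : Matrix (Fin n) (Fin n) ℂ) (c : ℂ) (μ : AlgSpace n) :
    infAct (c • A) μ = c • infAct A μ := by
  ext ⟨i, j, k⟩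
  simp only [infAct_apply, PiLp.smul_apply, Matrix.smul_apply, smul_mul_assoc, ← Finset.smul_sum,
    smul_sub]

theorem infAct_one (μ : AlgSpace n) : infAct 1 μ = -μ := by
  ext ⟨i, j, k⟩
  simp [infAct_apply, Matrix.one_apply]

theorem isDer_iff (μ : AlgSpace n) (D : Matrix (Fin n) (Fin n) ℂ) :
    μ.IsDer D ↔ infAct D μ = 0 := by
  constructor
  · intro h
    ext ⟨i, j, k⟩
    have := congrFun (h (Pi.single i 1) (Pi.single j 1)) k
    simp [mul, Matrix.mulVec, dotProduct, Pi.single_apply] at this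
    simp [infAct_apply, this]
  · intro h X Y
    have h' : ∀ i j k, ∑ r, D k r * μ (i, j, r) = ∑ q, D q i * μ (q, j, k)
        + ∑ q, D q j * μ (i, q, k) := by
      intro i j k
      have := congrArg (fun ν : AlgSpace n => ν (i, j, k)) h
      simp only [infAct_apply, PiLp.zero_apply] at this
      linear_combination this
    ext k
    have e1 : (D *ᵥ μ.mul X Y) k = ∑ i, ∑ j, X i * Y j * ∑ r, D k r * μ (i, j, r) := by
      simp only [mul, Matrix.mulVec, dotProduct, Finset.mul_sum]
      rw [Finset.sum_comm]
      refine Finset.sum_congr rfl fun i _ => ?_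
      rw [Finset.sum_comm]
      exact Finset.sum_congr rfl fun j _ => Finset.sum_congr rfl fun r _ => by ring
    have e2 : μ.mul (D *ᵥ X) Y k = ∑ i, ∑ j, X i * Y j * ∑ q, D q i * μ (q, j, k) := by
      simp only [mul, Matrix.mulVec, dotProduct, Finset.mul_sum, Finset.sum_mul]
      have : ∀ q, ∑ j, ∑ i, D q i * X i * Y j * μ (q, j, k) =
          ∑ i, ∑ j, D q i * X i * Y j * μ (q, j, k) := fun q => Finset.sum_comm
      simp only [this]
      rw [Finset.sum_comm]
      refine Finset.sum_congr rfl fun i _ => ?_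
      rw [Finset.sum_comm]
      exact Finset.sum_congr rfl fun j _ => Finset.sum_congr rfl fun r _ => by ring
    have e3 : μ.mul X (D *ᵥ Y) k = ∑ i, ∑ j, X i * Y j * ∑ q, D q j * μ (i, q, k) := by
      simp only [mul, Matrix.mulVec, dotProduct, Finset.mul_sum, Finset.sum_mul]
      refine Finset.sum_congr rfl fun i _ => ?_
      rw [Finset.sum_comm]
      exact Finset.sum_congr rfl fun j _ => Finset.sum_congr rfl fun r _ => by ring
    rw [Pi.add_apply, e1, e2, e3]
    simp only [h', mul_add, Finset.sum_add_distrib]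

theorem inner_eq_sum (μ ν : AlgSpace n) :
    inner ℂ μ ν = ∑ i, ∑ j, ∑ k, ν (i, j, k) * star (μ (i, j, k)) := by
  simp only [PiLp.inner_apply, Fintype.sum_prod_type]
  rfl

/-- This pairing is the defining property of a moment map. Traces against M_μ are evaluated through
it, without expanding matrix entries. -/
theorem trace_momentMatrix_mul_eq_inner (μ : AlgSpace n) (A : Matrix (Fin n) (Fin n) ℂ) :
    (μ.momentMatrix * A).trace = 2 * inner ℂ μ (infAct A μ) := by
  rw [trace_momentMatrix_mul, inner_eq_sum]
  rfl

theorem trace_momentMatrix (μ : AlgSpace n) : μ.momentMatrix.trace = ((-2 * ‖μ‖ ^ 2 : ℝ) : ℂ) := by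
  have := trace_momentMatrix_mul_eq_inner μ 1
  rw [mul_one, infAct_one, inner_neg_right, inner_self_eq_norm_sq_to_K] at this
  rw [this]
  push_cast
  simp

/-- The adjoint of the action of A is the action of A*, since the inner product on V_n is induced
from ℂⁿ; relabelling the summation indices in each of the three terms shows it. -/
theorem inner_infAct (μ ν : AlgSpace n) {A : Matrix (Fin n) (Fin n) ℂ} (hA : A.IsHermitian) :
    inner ℂ (infAct A μ) ν = inner ℂ μ (infAct A ν) := by
  have hs : ∀ a b, star (A a b) = A b a := fun a b => hA.apply b a
  simp only [inner_eq_sum, infAct_apply, star_sub, star_sum, star_mul', hs, mul_sub, sub_mul,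
    Finset.mul_sum, Finset.sum_mul, Finset.sum_sub_distrib]
  congr 1
  · congr 1
    · refine Finset.sum_congr rfl fun i _ => Finset.sum_congr rfl fun j _ => ?_
      rw [Finset.sum_comm]
      exact Finset.sum_congr rfl fun j _ => Finset.sum_congr rfl fun r _ => by ring
    · have h1 : ∀ i : Fin n, ∑ j, ∑ k, ∑ q, ν (i, j, k) * (A i q * star (μ (q, j, k))) =
          ∑ q, ∑ j, ∑ k, ν (i, j, k) * (A i q * star (μ (q, j, k))) := by
        intro i
        simp only [fun j => Finset.sum_comm (s := Finset.univ) (t := Finset.univ)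
          (f := fun k q => ν (i, j, k) * (A i q * star (μ (q, j, k))))]
        rw [Finset.sum_comm]
      have h2 : ∀ i : Fin n, ∑ j, ∑ k, ∑ q, A q i * ν (q, j, k) * star (μ (i, j, k)) =
          ∑ q, ∑ j, ∑ k, A q i * ν (q, j, k) * star (μ (i, j, k)) := by
        intro i
        simp only [fun j => Finset.sum_comm (s := Finset.univ) (t := Finset.univ)
          (f := fun k q => A q i * ν (q, j, k) * star (μ (i, j, k)))]
        rw [Finset.sum_comm]
      simp only [h1, h2]
      rw [Finset.sum_comm]
      exact Finset.sum_congr rfl fun i _ => Finset.sum_congr rfl fun q _ =>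
        Finset.sum_congr rfl fun j _ => Finset.sum_congr rfl fun r _ => by ring
  · refine Finset.sum_congr rfl fun i _ => ?_
    have h1 : ∀ j : Fin n, ∑ k, ∑ q, ν (i, j, k) * (A j q * star (μ (i, q, k))) =
          ∑ q, ∑ k, ν (i, j, k) * (A j q * star (μ (i, q, k))) := fun j => Finset.sum_comm
    have h2 : ∀ j : Fin n, ∑ k, ∑ q, A q j * ν (i, q, k) * star (μ (i, j, k)) =
          ∑ q, ∑ k, A q j * ν (i, q, k) * star (μ (i, j, k)) := fun j => Finset.sum_comm
    simp only [h1, h2]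
    rw [Finset.sum_comm]
    exact Finset.sum_congr rfl fun i _ => Finset.sum_congr rfl fun q _ =>
        Finset.sum_congr rfl fun j _ => by ring

theorem F_eq (μ : AlgSpace n) :
    μ.F = ((‖μ‖ ^ 2)⁻¹) ^ 2 * (μ.momentMatrix * μ.momentMatrix).trace.re := by
  rw [F, μ.momentMap_isHermitian.eq, momentMap, Matrix.smul_mul, Matrix.mul_smul,
    Matrix.trace_smul, Matrix.trace_smul, smul_eq_mul, smul_eq_mul, Complex.re_ofReal_mul,
    Complex.re_ofReal_mul]
  ring

theorem differentiable_apply (p : Fin n × Fin n × Fin n) :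
    Differentiable ℝ (fun μ : AlgSpace n => μ p) := by
  fun_prop

theorem differentiable_momentMatrix (a b : Fin n) :
    Differentiable ℝ (fun μ : AlgSpace n => μ.momentMatrix a b) := by
  simp only [momentMatrix, Matrix.sub_apply, Matrix.smul_apply, Matrix.sum_apply, Matrix.mul_apply,
    Matrix.conjTranspose_apply, leftMul, rightMul, Matrix.of_apply]
  fun_prop

/-- Needed to pass from vanishing derivatives along lines to a vanishing Fréchet derivative. -/
theorem differentiableAt_F {μ : AlgSpace n} (hμ : μ ≠ 0) : DifferentiableAt ℝ (F (n := n)) μ := by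
  have e : F (n := n) = fun μ =>
      ((‖μ‖ ^ 2)⁻¹) ^ 2 * (∑ a, ∑ b, (μ.momentMatrix a b * μ.momentMatrix b a).re) := by
    funext μ
    rw [F_eq]
    simp [Matrix.trace, Matrix.mul_apply]
  rw [e]
  have h1 : DifferentiableAt ℝ (fun μ : AlgSpace n => ‖μ‖ ^ 2) μ := by
    have : Differentiable ℝ (fun μ : AlgSpace n => ‖μ‖ ^ 2) := by
      simp only [EuclideanSpace.norm_sq_eq]
      refine Differentiable.fun_sum fun p _ => ?_
      exact ((differentiable_apply p).norm_sq ℂ)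
    exact this μ
  have h2 := differentiable_momentMatrix (n := n)
  have h3 : ‖μ‖ ^ 2 ≠ 0 := by simpa using hμ
  refine ((h1.inv h3).pow 2).mul ?_
  refine DifferentiableAt.fun_sum fun a _ => DifferentiableAt.fun_sum fun b _ => ?_
  exact Complex.reCLM.differentiable.differentiableAt.comp μ ((h2 a b).mul (h2 b a)).differentiableAt

theorem hasDerivAt_norm_sq_line (μ v : AlgSpace n) :
    HasDerivAt (fun t : ℝ => ‖μ + t • v‖ ^ 2) (2 * (inner ℂ v μ).re) 0 := by
  have e : ∀ t : ℝ, ‖μ + t • v‖ ^ 2 =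
      ‖μ‖ ^ 2 + t * (2 * (inner ℂ v μ).re) + t ^ 2 * ‖v‖ ^ 2 := by
    intro t
    rw [@norm_add_sq ℂ, norm_smul, mul_pow, Real.norm_eq_abs, sq_abs,
      RCLike.real_smul_eq_coe_smul (K := ℂ) t v, inner_smul_right]
    have h : (inner ℂ μ v).re = (inner ℂ v μ).re := inner_re_symm (𝕜 := ℂ) μ v
    simp [h]
    ring
  simp only [e]
  have h := (((hasDerivAt_id (0 : ℝ)).mul_const (2 * (inner ℂ v μ).re)).const_add (‖μ‖ ^ 2)).add
    (((hasDerivAt_id (0 : ℝ)).pow 2).mul_const (‖v‖ ^ 2))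
  refine h.congr_deriv ?_
  simp

theorem hasDerivAt_trace_line (μ v : AlgSpace n) {A : Matrix (Fin n) (Fin n) ℂ}
    (hA : A.IsHermitian) :
    HasDerivAt (fun t : ℝ => ((μ + t • v).momentMatrix * A).trace)
      ((4 * (inner ℂ v (infAct A μ)).re : ℝ) : ℂ) 0 := by
  have e : ∀ t : ℝ, ((μ + t • v).momentMatrix * A).trace =
      2 * inner ℂ μ (infAct A μ) + (t : ℂ) * ((4 * (inner ℂ v (infAct A μ)).re : ℝ) : ℂ)
        + (t : ℂ) ^ 2 * (2 * inner ℂ v (infAct A v)) := by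
    intro t
    have h1 : inner ℂ μ (infAct A v) = (starRingEnd ℂ) (inner ℂ v (infAct A μ)) := by
      rw [inner_conj_symm, inner_infAct _ _ hA]
    have h2 : inner ℂ v (infAct A μ) + (starRingEnd ℂ) (inner ℂ v (infAct A μ)) =
        2 * ((inner ℂ v (infAct A μ)).re : ℂ) := by
      rw [Complex.add_conj]
      push_cast
      ring
    rw [trace_momentMatrix_mul_eq_inner, infAct_add_right, infAct_smul_right,
      RCLike.real_smul_eq_coe_smul (K := ℂ) t v,
      RCLike.real_smul_eq_coe_smul (K := ℂ) t (infAct A v)]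
    simp only [inner_add_left, inner_add_right, inner_smul_left, inner_smul_right, h1]
    push_cast
    simp only [Complex.coe_algebraMap, Complex.conj_ofReal]
    linear_combination 2 * (t : ℂ) * h2
  simp only [e]
  have h0 : HasDerivAt (fun t : ℝ => (t : ℂ)) 1 0 := Complex.ofRealCLM.hasDerivAt
  have h := ((h0.mul_const ((4 * (inner ℂ v (infAct A μ)).re : ℝ) : ℂ)).const_add
    (2 * inner ℂ μ (infAct A μ))).add
    ((h0.pow 2).mul_const (2 * inner ℂ v (infAct A v)))
  refine h.congr_deriv ?_
  simp

theorem hasDerivAt_trace_sq_line (μ v : AlgSpace n) :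
    HasDerivAt (fun t : ℝ =>
        ((μ + t • v).momentMatrix * (μ + t • v).momentMatrix).trace.re)
      (8 * (inner ℂ v (infAct μ.momentMatrix μ)).re) 0 := by
  have hl : HasDerivAt (fun t : ℝ => μ + t • v) v 0 := by
    simpa using ((hasDerivAt_id (0 : ℝ)).smul_const v).const_add μ
  have hd : ∀ a b, ∃ d, HasDerivAt (fun t : ℝ => (μ + t • v).momentMatrix a b) d 0 := by
    intro a b
    refine ⟨_, HasFDerivAt.comp_hasDerivAt (0 : ℝ) (f := fun t : ℝ => μ + t • v)
      (l := fun ν : AlgSpace n => ν.momentMatrix a b)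
      (differentiable_momentMatrix a b _).hasFDerivAt hl⟩
  choose B hB using hd
  -- The derivative B of the moment matrix is never computed. Only its pairing with M_μ enters, and
  -- that is known from the case where the second factor is frozen; symmetry of the trace then
  -- doubles it.
  have h1 : HasDerivAt (fun t : ℝ => ((μ + t • v).momentMatrix * μ.momentMatrix).trace)
      (∑ a, ∑ b, B a b * μ.momentMatrix b a) 0 := by
    simp only [Matrix.trace, Matrix.diag, Matrix.mul_apply]
    exact HasDerivAt.fun_sum fun a _ => HasDerivAt.fun_sum fun b _ => (hB a b).mul_const _
  have h2 := h1.unique (hasDerivAt_trace_line μ v μ.momentMatrix_isHermitian)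
  have h3 : HasDerivAt (fun t : ℝ =>
        ((μ + t • v).momentMatrix * (μ + t • v).momentMatrix).trace)
      ((8 * (inner ℂ v (infAct μ.momentMatrix μ)).re : ℝ) : ℂ) 0 := by
    have h4 : HasDerivAt (fun t : ℝ =>
        ((μ + t • v).momentMatrix * (μ + t • v).momentMatrix).trace)
        (∑ a, ∑ b, (B a b * μ.momentMatrix b a + μ.momentMatrix a b * B b a)) 0 := by
      simp only [Matrix.trace, Matrix.diag, Matrix.mul_apply]
      refine HasDerivAt.fun_sum fun a _ => HasDerivAt.fun_sum fun b _ => ?_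
      refine ((hB a b).mul (hB b a)).congr_deriv ?_
      simp
    refine h4.congr_deriv ?_
    have h5 : ∑ a, ∑ b, μ.momentMatrix a b * B b a = ∑ a, ∑ b, B a b * μ.momentMatrix b a := by
      rw [Finset.sum_comm]
      exact Finset.sum_congr rfl fun a _ => Finset.sum_congr rfl fun b _ => mul_comm _ _
    simp only [Finset.sum_add_distrib]
    rw [h5, h2]
    push_cast
    ring
  exact Complex.reCLM.hasFDerivAt.comp_hasDerivAt 0 h3

/-- The vector paired with v is the gradient up to a positive factor. It is M_μ.μ minus its
projection to μ, because ⟨μ, M_μ.μ⟩ = tr(M_μ²)/2. -/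
theorem hasDerivAt_F_line {μ : AlgSpace n} (hμ : μ ≠ 0) (v : AlgSpace n) :
    HasDerivAt (fun t : ℝ => F (μ + t • v))
      (8 * ((‖μ‖ ^ 2)⁻¹) ^ 2 * (inner ℂ v (infAct μ.momentMatrix μ - (((‖μ‖ ^ 2)⁻¹ / 2 *
        (μ.momentMatrix * μ.momentMatrix).trace.re : ℝ) : ℂ) • μ)).re) 0 := by
  simp only [F_eq]
  have h3 : ‖μ + (0 : ℝ) • v‖ ^ 2 ≠ 0 := by simpa using hμ
  have h := (((hasDerivAt_norm_sq_line μ v).inv h3).pow 2).mul (hasDerivAt_trace_sq_line μ v)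
  refine h.congr_deriv ?_
  rw [inner_sub_right, inner_smul_right, Complex.sub_re, Complex.re_ofReal_mul]
  have h4 : ‖μ‖ ≠ 0 := by simpa using hμ
  simp
  field_simp
  ring

theorem isCritical_iff_infAct {μ : AlgSpace n} (hμ : μ ≠ 0) :
    μ.IsCritical ↔ infAct μ.momentMatrix μ = (((‖μ‖ ^ 2)⁻¹ / 2 *
        (μ.momentMatrix * μ.momentMatrix).trace.re : ℝ) : ℂ) • μ := by
  have h4 : ‖μ‖ ≠ 0 := by simpa using hμ
  have hl : ∀ v : AlgSpace n, HasDerivAt (fun t : ℝ => μ + t • v) v 0 := by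
    intro v
    simpa using ((hasDerivAt_id (0 : ℝ)).smul_const v).const_add μ
  constructor
  · rintro ⟨-, h⟩
    rw [← sub_eq_zero, ← norm_eq_zero, ← sq_eq_zero_iff, ← inner_self_eq_norm_sq (𝕜 := ℂ)]
    -- Differentiating in the direction of the gradient itself produces its squared norm.
    set v := infAct μ.momentMatrix μ - (((‖μ‖ ^ 2)⁻¹ / 2 *
        (μ.momentMatrix * μ.momentMatrix).trace.re : ℝ) : ℂ) • μ with hv
    have h1 : HasDerivAt (fun t : ℝ => F (μ + t • v)) 0 0 := by
      have h2 : HasFDerivAt (F (n := n)) (0 : AlgSpace n →L[ℝ] ℝ) (μ + (0 : ℝ) • v) := by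
        simpa using h
      exact h2.comp_hasDerivAt (0 : ℝ) (hl v)
    have h5 := h1.unique (hasDerivAt_F_line hμ v)
    rw [← hv] at h5
    have h6 : 8 * ((‖μ‖ ^ 2)⁻¹) ^ 2 ≠ 0 := by positivity
    exact (mul_eq_zero.1 h5.symm).resolve_left h6
  · intro h
    refine ⟨hμ, ?_⟩
    have hd := (differentiableAt_F hμ).hasFDerivAt
    convert hd
    symm
    ext v
    have h2 : HasFDerivAt (F (n := n)) (fderiv ℝ (F (n := n)) μ) (μ + (0 : ℝ) • v) := by
      simpa using hd
    have h3 := h2.comp_hasDerivAt (0 : ℝ) (hl v)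
    have h5 := h3.unique (hasDerivAt_F_line hμ v)
    rw [h, sub_self] at h5
    simpa using h5

/-- A derivation D has tr(M_μ D) = 2⟨μ, D.μ⟩ = 0, so tr(M_μ²) = c tr(M_μ). In particular c is
determined by μ when μ ≠ 0. -/
theorem trace_momentMatrix_sq {μ : AlgSpace n} {c : ℝ}
    (h : μ.IsDer (μ.momentMatrix - (c : ℂ) • 1)) :
    (μ.momentMatrix * μ.momentMatrix).trace = ((-2 * c * ‖μ‖ ^ 2 : ℝ) : ℂ) := by
  rw [isDer_iff] at h
  have e : μ.momentMatrix * μ.momentMatrix =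
      μ.momentMatrix * (μ.momentMatrix - (c : ℂ) • 1) + (c : ℂ) • μ.momentMatrix := by
    simp [Matrix.mul_sub]
  rw [e, Matrix.trace_add, trace_momentMatrix_mul_eq_inner, h, Matrix.trace_smul,
    trace_momentMatrix]
  simp
  ring

/-- `[μ]` is a critical point if and only if `M_μ = c I + D` with `c` real and `D` a derivation. -/
theorem isCritical_iff (μ : AlgSpace n) :
    μ.IsCritical ↔ μ ≠ 0 ∧ ∃ c : ℝ, μ.IsDer (μ.momentMatrix - (c : ℂ) • 1) := by
  constructor
  · intro h
    -- If M_μ.μ = λμ, then I.μ = -μ makes c = -λ the scalar for which M_μ - cI annihilates μ.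
    refine ⟨h.1, -((‖μ‖ ^ 2)⁻¹ / 2 * (μ.momentMatrix * μ.momentMatrix).trace.re), ?_⟩
    have h1 := (isCritical_iff_infAct h.1).1 h
    rw [isDer_iff, sub_eq_add_neg, infAct_add_left, h1, ← neg_smul, infAct_smul_left, infAct_one]
    push_cast
    simp
  · rintro ⟨hμ, c, h⟩
    rw [isCritical_iff_infAct hμ, trace_momentMatrix_sq h, Complex.ofReal_re]
    rw [isDer_iff, sub_eq_add_neg, infAct_add_left, ← neg_smul, infAct_smul_left, infAct_one] at h
    have h4 : ‖μ‖ ≠ 0 := by simpa using hμ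
    rw [eq_neg_of_add_eq_zero_left h, ← smul_neg, neg_neg]
    congr 1
    push_cast
    have h5 : (‖μ‖ : ℂ) ≠ 0 := by exact_mod_cast h4
    field_simp

end AlgSpace

/-! ### Change of basis and isomorphism. -/

namespace AlgSpace

variable {n : ℕ}

theorem mul_single_single (μ : AlgSpace n) (i j : Fin n) :
    μ.mul (Pi.single i 1) (Pi.single j 1) = fun k => μ (i, j, k) := by
  ext k
  simp [mul, Pi.single_apply]

/-- The product of `μ` as a bilinear map. -/
def mulLin (μ : AlgSpace n) : (Fin n → ℂ) →ₗ[ℂ] (Fin n → ℂ) →ₗ[ℂ] (Fin n → ℂ) :=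
  LinearMap.mk₂ ℂ μ.mul
    (fun X X' Y => by ext k; simp [mul, add_mul, Finset.sum_add_distrib])
    (fun c X Y => by ext k; simp [mul, Finset.mul_sum, mul_assoc])
    (fun X Y Y' => by ext k; simp [mul, add_mul, mul_add, Finset.sum_add_distrib])
    (fun c X Y => by ext k; simp [mul, Finset.mul_sum, mul_assoc, mul_left_comm])

theorem mulLin_apply (μ : AlgSpace n) (X Y : Fin n → ℂ) : μ.mulLin X Y = μ.mul X Y := rfl

/-- Two bilinear products agree as soon as they agree on the basis vectors. -/
theorem bilin_ext {M : Type*} [AddCommMonoid M] [Module ℂ M]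
    {f g : (Fin n → ℂ) →ₗ[ℂ] (Fin n → ℂ) →ₗ[ℂ] M}
    (h : ∀ i j, f (Pi.single i 1) (Pi.single j 1) = g (Pi.single i 1) (Pi.single j 1)) : f = g := by
  refine LinearMap.ext_basis (Pi.basisFun ℂ (Fin n)) (Pi.basisFun ℂ (Fin n)) fun i j => ?_
  simpa using h i j

theorem mul_act (g : Matrix (Fin n) (Fin n) ℂ) (μ : AlgSpace n) (X Y : Fin n → ℂ) :
    (act g μ).mul X Y = g *ᵥ μ.mul (g⁻¹ *ᵥ X) (g⁻¹ *ᵥ Y) := by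
  have : (act g μ).mulLin = (μ.mulLin.compl₁₂ g⁻¹.mulVecLin g⁻¹.mulVecLin).compr₂ g.mulVecLin := by
    refine bilin_ext fun i j => ?_
    simp only [mulLin_apply, mul_single_single, LinearMap.compr₂_apply, LinearMap.compl₁₂_apply,
      Matrix.mulVecLin_apply]
    rfl
  exact congrArg (fun f => f X Y) this

theorem ext_mul {μ ν : AlgSpace n} (h : ∀ X Y, μ.mul X Y = ν.mul X Y) : μ = ν := by
  ext ⟨i, j, k⟩
  have := congrFun (h (Pi.single i 1) (Pi.single j 1)) k
  simpa [mul_single_single] using this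

theorem act_mul (g h : Matrix (Fin n) (Fin n) ℂ) (μ : AlgSpace n) :
    act (g * h) μ = act g (act h μ) := by
  refine ext_mul fun X Y => ?_
  simp [mul_act, Matrix.mul_inv_rev, Matrix.mulVec_mulVec]

theorem Iso.symm {μ ν : AlgSpace n} (h : μ.Iso ν) : ν.Iso μ := by
  obtain ⟨φ, hφ⟩ := h
  refine ⟨φ.symm, fun X Y => ?_⟩
  rw [LinearEquiv.symm_apply_eq, hφ]
  simp

theorem Iso.trans {μ ν κ : AlgSpace n} (h : μ.Iso ν) (h' : ν.Iso κ) : μ.Iso κ := by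
  obtain ⟨φ, hφ⟩ := h
  obtain ⟨ψ, hψ⟩ := h'
  exact ⟨φ.trans ψ, fun X Y => by simp [hφ, hψ]⟩

theorem Iso.refl (μ : AlgSpace n) : μ.Iso μ := ⟨LinearEquiv.refl ℂ _, fun _ _ => rfl⟩

theorem Iso.exists_act {μ ν : AlgSpace n} (h : μ.Iso ν) :
    ∃ g : Matrix (Fin n) (Fin n) ℂ, IsUnit g ∧ ν = act g μ := by
  obtain ⟨φ, hφ⟩ := h
  have h1 : LinearMap.toMatrix' (φ : (Fin n → ℂ) →ₗ[ℂ] (Fin n → ℂ)) *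
      LinearMap.toMatrix' (φ.symm : (Fin n → ℂ) →ₗ[ℂ] (Fin n → ℂ)) = 1 := by
    rw [← LinearMap.toMatrix'_comp]
    simp
  have h2 : (LinearMap.toMatrix' (φ : (Fin n → ℂ) →ₗ[ℂ] (Fin n → ℂ)))⁻¹ =
      LinearMap.toMatrix' (φ.symm : (Fin n → ℂ) →ₗ[ℂ] (Fin n → ℂ)) := Matrix.inv_eq_right_inv h1
  refine ⟨_, IsUnit.of_mul_eq_one _ h1, ext_mul fun X Y => ?_⟩
  rw [mul_act, h2]
  simp [LinearMap.toMatrix'_mulVec, hφ]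

theorem iso_act (μ : AlgSpace n) {g : Matrix (Fin n) (Fin n) ℂ} (hg : IsUnit g) :
    μ.Iso (act g μ) := by
  have hd := (Matrix.isUnit_iff_isUnit_det g).1 hg
  refine ⟨Matrix.toLin'OfInv (Matrix.nonsing_inv_mul g hd) (Matrix.mul_nonsing_inv g hd),
    fun X Y => ?_⟩
  change Matrix.toLin' g (μ.mul X Y) = (act g μ).mul (Matrix.toLin' g X) (Matrix.toLin' g Y)
  simp [mul_act, Matrix.mulVec_mulVec, Matrix.nonsing_inv_mul g hd]

theorem zero_mul_apply (X Y : Fin n → ℂ) : (0 : AlgSpace n).mul X Y = 0 := by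
  ext k
  simp [mul]

theorem Iso.ne_zero {μ ν : AlgSpace n} (h : μ.Iso ν) (hμ : μ ≠ 0) : ν ≠ 0 := by
  rintro rfl
  refine hμ (ext_mul fun X Y => ?_)
  obtain ⟨φ, hφ⟩ := h
  apply φ.injective
  rw [hφ, zero_mul_apply, zero_mul_apply, map_zero]

theorem Iso.isAssoc {μ ν : AlgSpace n} (h : μ.Iso ν) (hμ : μ.IsAssoc) : ν.IsAssoc := by
  obtain ⟨φ, hφ⟩ := h.symm
  intro X Y Z
  apply φ.injective
  simp [hφ, hμ _ _ _]

/-! ### Unitary equivariance of the moment matrix. -/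

section Unitary

/-- Applied to matrices, this says that a sum of the form ∑ L L* over an orthonormal basis does not
depend on the basis. The next lemma is the version with the conjugated scalars on the first factor,
for ∑ L* L and ∑ R* R. -/
theorem sum_smul_mul_smul {m : Type*} [Fintype m] [DecidableEq m] {R : Type*} [Ring R] [Algebra ℂ R]
    {a : Matrix m m ℂ} (ha : a * aᴴ = 1) (X Y : m → R) :
    ∑ i, (∑ p, a p i • X p) * (∑ q, star (a q i) • Y q) = ∑ p, X p * Y p := by
  have h : ∀ p q, ∑ i, a p i * star (a q i) = if p = q then 1 else 0 := by
    intro p q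
    have := congrFun (congrFun ha p) q
    simpa [Matrix.mul_apply, Matrix.one_apply] using this
  simp only [Finset.sum_mul_sum, smul_mul_smul_comm]
  rw [Finset.sum_comm]
  refine Finset.sum_congr rfl fun p _ => ?_
  rw [Finset.sum_comm]
  simp only [← Finset.sum_smul, h]
  simp

theorem sum_star_smul_mul_smul {m : Type*} [Fintype m] [DecidableEq m] {R : Type*} [Ring R]
    [Algebra ℂ R] {a : Matrix m m ℂ} (ha : a * aᴴ = 1) (X Y : m → R) :
    ∑ i, (∑ p, star (a p i) • X p) * (∑ q, a q i • Y q) = ∑ p, X p * Y p := by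
  have h : ∀ p q, ∑ i, star (a p i) * a q i = if p = q then 1 else 0 := by
    intro p q
    have := congrFun (congrFun ha q) p
    simp only [Matrix.mul_apply, Matrix.conjTranspose_apply, Matrix.one_apply] at this
    rw [← Finset.sum_congr rfl fun i _ => mul_comm (a q i) (star (a p i)), this]
    simp [eq_comm]
  simp only [Finset.sum_mul_sum, smul_mul_smul_comm]
  rw [Finset.sum_comm]
  refine Finset.sum_congr rfl fun p _ => ?_
  rw [Finset.sum_comm]
  simp only [← Finset.sum_smul, h]
  simp

theorem leftMul_act (g : Matrix (Fin n) (Fin n) ℂ) (μ : AlgSpace n) (i : Fin n) :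
    (act g μ).leftMul i = ∑ p, g⁻¹ p i • (g * μ.leftMul p * g⁻¹) := by
  ext k j
  simp only [leftMul, Matrix.of_apply, act_apply, Matrix.sum_apply, Matrix.smul_apply, smul_eq_mul,
    Matrix.mul_apply, Finset.mul_sum, Finset.sum_mul]
  rw [Finset.sum_comm]
  refine Finset.sum_congr rfl fun p _ => ?_
  rw [Finset.sum_comm]
  exact Finset.sum_congr rfl fun q _ => Finset.sum_congr rfl fun r _ => by ring

theorem rightMul_act (g : Matrix (Fin n) (Fin n) ℂ) (μ : AlgSpace n) (i : Fin n) :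
    (act g μ).rightMul i = ∑ p, g⁻¹ p i • (g * μ.rightMul p * g⁻¹) := by
  ext k j
  simp only [rightMul, Matrix.of_apply, act_apply, Matrix.sum_apply, Matrix.smul_apply, smul_eq_mul,
    Matrix.mul_apply, Finset.mul_sum, Finset.sum_mul]
  rw [Finset.sum_comm]
  simp only [Finset.sum_comm (s := Finset.univ) (t := Finset.univ)
    (f := fun r q => g k r * (g⁻¹ _ j * g⁻¹ q i * μ (_, q, r)))]
  rw [Finset.sum_comm]
  exact Finset.sum_congr rfl fun p _ => Finset.sum_congr rfl fun q _ =>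
    Finset.sum_congr rfl fun r _ => by ring

theorem momentMatrix_act {k : Matrix (Fin n) (Fin n) ℂ} (hk : k * kᴴ = 1) (μ : AlgSpace n) :
    (act k μ).momentMatrix = k * μ.momentMatrix * kᴴ := by
  have hinv : k⁻¹ = kᴴ := Matrix.inv_eq_right_inv hk
  have hk' : kᴴ * k = 1 := mul_eq_one_comm.1 hk
  have ha : kᴴ * kᴴᴴ = 1 := by rwa [Matrix.conjTranspose_conjTranspose]
  have e1 : ∀ X : Matrix (Fin n) (Fin n) ℂ, (k * X * kᴴ) * (k * X * kᴴ)ᴴ = k * (X * Xᴴ) * kᴴ := by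
    intro X
    simp only [Matrix.conjTranspose_mul, Matrix.conjTranspose_conjTranspose]
    calc _ = k * X * (kᴴ * k) * Xᴴ * kᴴ := by noncomm_ring
      _ = _ := by rw [hk']; noncomm_ring
  have e2 : ∀ X : Matrix (Fin n) (Fin n) ℂ, (k * X * kᴴ)ᴴ * (k * X * kᴴ) = k * (Xᴴ * X) * kᴴ := by
    intro X
    simp only [Matrix.conjTranspose_mul, Matrix.conjTranspose_conjTranspose]
    calc _ = k * Xᴴ * (kᴴ * k) * X * kᴴ := by noncomm_ring
      _ = _ := by rw [hk']; noncomm_ring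
  simp only [momentMatrix, leftMul_act, rightMul_act, hinv, Matrix.conjTranspose_sum,
    Matrix.conjTranspose_smul]
  rw [sum_smul_mul_smul ha, sum_star_smul_mul_smul ha, sum_star_smul_mul_smul ha]
  simp only [e1, e2, Matrix.mul_sub, Matrix.sub_mul, Matrix.mul_smul, Matrix.smul_mul,
    Matrix.mul_sum, Matrix.sum_mul]

theorem isDer_act {k : Matrix (Fin n) (Fin n) ℂ} (hk : IsUnit k) {μ : AlgSpace n}
    {D : Matrix (Fin n) (Fin n) ℂ} (hD : μ.IsDer D) : (act k μ).IsDer (k * D * k⁻¹) := by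
  have hd := (Matrix.isUnit_iff_isUnit_det k).1 hk
  intro X Y
  have h1 := hD (k⁻¹ *ᵥ X) (k⁻¹ *ᵥ Y)
  simp only [mul_act, Matrix.mulVec_mulVec, ← Matrix.mulVec_add] at h1 ⊢
  rw [← mul_assoc k⁻¹, ← mul_assoc k⁻¹, Matrix.nonsing_inv_mul k hd, one_mul, ← h1,
    Matrix.mulVec_mulVec, mul_assoc (k * D), Matrix.nonsing_inv_mul k hd, mul_one]

theorem isCritical_act {k : Matrix (Fin n) (Fin n) ℂ} (hk : k * kᴴ = 1) {μ : AlgSpace n}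
    (h : μ.IsCritical) : (act k μ).IsCritical := by
  have hinv : k⁻¹ = kᴴ := Matrix.inv_eq_right_inv hk
  have hu : IsUnit k := IsUnit.of_mul_eq_one _ hk
  rw [isCritical_iff] at h ⊢
  obtain ⟨h0, c, hc⟩ := h
  refine ⟨(iso_act μ hu).ne_zero h0, c, ?_⟩
  have := isDer_act hu hc
  rw [hinv] at this
  rw [momentMatrix_act hk]
  convert this using 1
  rw [Matrix.mul_sub, Matrix.sub_mul]
  simp [hk]

end Unitary

/-! ### Triangular matrices and weights of a diagonal derivation. -/

section Triangular

/-- QR decomposition. -/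
theorem exists_unitary_mul_upperTriangular (g : Matrix (Fin n) (Fin n) ℂ) :
    ∃ q p : Matrix (Fin n) (Fin n) ℂ, q * qᴴ = 1 ∧ (∀ i j, j < i → p i j = 0) ∧ g = q * p := by
  let f : Fin n → EuclideanSpace ℂ (Fin n) := fun j => WithLp.toLp 2 fun i => g i j
  have hc : Module.finrank ℂ (EuclideanSpace ℂ (Fin n)) = Fintype.card (Fin n) := by simp
  let b := InnerProductSpace.gramSchmidtOrthonormalBasis hc f
  let q : Matrix (Fin n) (Fin n) ℂ := Matrix.of fun i j => b j i
  have hq : qᴴ * q = 1 := by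
    ext i j
    have := orthonormal_iff_ite.1 b.orthonormal i j
    rw [PiLp.inner_apply] at this
    simp only [Matrix.mul_apply, Matrix.conjTranspose_apply, Matrix.one_apply]
    rw [← this]
    exact Finset.sum_congr rfl fun k _ => mul_comm _ _
  have hq' := mul_eq_one_comm.1 hq
  refine ⟨q, qᴴ * g, hq', fun i j hij => ?_, ?_⟩
  · have := InnerProductSpace.gramSchmidtOrthonormalBasis_inv_triangular hc f hij
    rw [PiLp.inner_apply] at this
    simp only [Matrix.mul_apply, Matrix.conjTranspose_apply]
    rw [← this]
    exact Finset.sum_congr rfl fun k _ => mul_comm _ _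
  · rw [← mul_assoc, hq', one_mul]

/-- Diagonalization of a Hermitian matrix with decreasing eigenvalues. -/
theorem exists_antitone_diagonalization {D : Matrix (Fin n) (Fin n) ℂ} (hD : D.IsHermitian) :
    ∃ (u : Matrix (Fin n) (Fin n) ℂ) (d : Fin n → ℝ), u * uᴴ = 1 ∧ Antitone d ∧
      D = u * diagonal (fun i => (d i : ℂ)) * uᴴ := by
  let u₀ : Matrix (Fin n) (Fin n) ℂ := hD.eigenvectorUnitary
  have hu₀ : u₀ᴴ * u₀ = 1 := (Matrix.mem_unitaryGroup_iff').1 hD.eigenvectorUnitary.2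
  let σ : Equiv.Perm (Fin n) := Tuple.sort (fun i => -hD.eigenvalues i)
  let u := u₀.submatrix id σ
  have hu : uᴴ * u = 1 := by
    have : uᴴ * u = (u₀ᴴ * u₀).submatrix σ σ := by
      ext i j
      simp [u, Matrix.mul_apply]
    rw [this, hu₀, Matrix.submatrix_one_equiv]
  refine ⟨u, fun i => hD.eigenvalues (σ i), mul_eq_one_comm.1 hu, ?_, ?_⟩
  · intro i j hij
    have := Tuple.monotone_sort (fun i => -hD.eigenvalues i) hij
    simpa using this
  · have h1 : D * u = u * diagonal (fun i => ((hD.eigenvalues (σ i) : ℝ) : ℂ)) := by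
      ext i j
      rw [Matrix.mul_diagonal]
      have := congrFun (hD.mulVec_eigenvectorBasis (σ j)) i
      simp only [Matrix.mulVec, dotProduct] at this
      simpa [u, u₀, Matrix.mul_apply, mul_comm] using this
    rw [← h1, mul_assoc, mul_eq_one_comm.1 hu, mul_one]

theorem trace_momentMatrix_mul_diagonal (μ : AlgSpace n) (d : Fin n → ℝ) :
    (μ.momentMatrix * diagonal (fun i => (d i : ℂ))).trace.re =
      2 * ∑ i, ∑ j, ∑ k, (d k - d i - d j) * ‖μ (i, j, k)‖ ^ 2 := by
  have h : ∀ i j k, infAct (diagonal (fun i => (d i : ℂ))) μ (i, j, k) * star (μ (i, j, k)) =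
      (((d k - d i - d j) * ‖μ (i, j, k)‖ ^ 2 : ℝ) : ℂ) := by
    intro i j k
    have h1 : infAct (diagonal (fun i => (d i : ℂ))) μ (i, j, k) =
        ((d k - d i - d j : ℝ) : ℂ) * μ (i, j, k) := by
      simp [infAct_apply, diagonal_apply]
      ring
    rw [h1, mul_assoc]
    have : μ (i, j, k) * star (μ (i, j, k)) = ((‖μ (i, j, k)‖ ^ 2 : ℝ) : ℂ) := by
      rw [Complex.star_def, Complex.mul_conj, Complex.normSq_eq_norm_sq]
    rw [this]
    push_cast
    ring
  rw [trace_momentMatrix_mul_eq_inner, inner_eq_sum]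
  simp only [h]
  norm_cast

theorem weight_of_isDer_diagonal {μ : AlgSpace n} {d : Fin n → ℝ}
    (h : μ.IsDer (diagonal (fun i => (d i : ℂ)))) {i j k : Fin n} (hμ : μ (i, j, k) ≠ 0) :
    d k = d i + d j := by
  rw [isDer_iff] at h
  have h1 : infAct (diagonal (fun i => (d i : ℂ))) μ (i, j, k) =
        ((d k - d i - d j : ℝ) : ℂ) * μ (i, j, k) := by
    simp [infAct_apply, diagonal_apply]
    ring
  rw [h, PiLp.zero_apply] at h1
  have h2 := Complex.ofReal_eq_zero.1 ((mul_eq_zero.1 h1.symm).resolve_right hμ)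
  linarith

theorem inv_upperTriangular {p : Matrix (Fin n) (Fin n) ℂ} (hp : IsUnit p)
    (h : ∀ i j, j < i → p i j = 0) : ∀ i j, j < i → p⁻¹ i j = 0 := by
  have hb : p.BlockTriangular id := fun i j hij => h i j hij
  have := hp.invertible
  exact fun i j hij => Matrix.blockTriangular_inv_of_blockTriangular hb hij

/-- A nonzero entry (i, j, k) of p.μ comes from some nonzero entry (a, b, r) of μ with a ≤ i, b ≤ j
and k ≤ r. As d decreases, d_k ≥ d_r = d_a + d_b ≥ d_i + d_j, so every term of the weighted sum is
nonnegative. -/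
theorem trace_momentMatrix_act_nonneg {μ : AlgSpace n} {d : Fin n → ℝ} (hd : Antitone d)
    (h : μ.IsDer (diagonal (fun i => (d i : ℂ)))) {p : Matrix (Fin n) (Fin n) ℂ} (hp : IsUnit p)
    (ht : ∀ i j, j < i → p i j = 0) :
    0 ≤ ((act p μ).momentMatrix * diagonal (fun i => (d i : ℂ))).trace.re := by
  rw [trace_momentMatrix_mul_diagonal]
  refine mul_nonneg (by norm_num) (Finset.sum_nonneg fun i _ => Finset.sum_nonneg fun j _ =>
    Finset.sum_nonneg fun k _ => ?_)
  by_cases h0 : act p μ (i, j, k) = 0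
  · simp [h0]
  refine mul_nonneg ?_ (by positivity)
  rw [act_apply] at h0
  obtain ⟨r, -, hr⟩ := Finset.exists_ne_zero_of_sum_ne_zero h0
  obtain ⟨a, -, ha⟩ := Finset.exists_ne_zero_of_sum_ne_zero (right_ne_zero_of_mul hr)
  obtain ⟨b, -, hb⟩ := Finset.exists_ne_zero_of_sum_ne_zero ha
  have hi := inv_upperTriangular hp ht
  have h1 : k ≤ r := not_lt.1 fun hlt => left_ne_zero_of_mul hr (ht _ _ hlt)
  have h2 : a ≤ i := not_lt.1 fun hlt =>
    left_ne_zero_of_mul (left_ne_zero_of_mul hb) (hi _ _ hlt)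
  have h3 : b ≤ j := not_lt.1 fun hlt =>
    right_ne_zero_of_mul (left_ne_zero_of_mul hb) (hi _ _ hlt)
  have h4 := weight_of_isDer_diagonal h (right_ne_zero_of_mul hb)
  have := hd h1
  have := hd h2
  have := hd h3
  linarith

end Triangular

/-! ### Minimality of F at critical points and its consequences. -/

section Minimality

/-- With D = uΛu* and gu = qp, where q is unitary and p triangular, one has g.μ = q.(p.(u*.μ)), and
Λ is a derivation of u*.μ. The unitary k = qu* turns D into qΛq*, which reduces the trace to the
triangular case. -/
theorem exists_unitary_trace_ge {μ : AlgSpace n} {D : Matrix (Fin n) (Fin n) ℂ}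
    (hD : D.IsHermitian) (h : μ.IsDer D) {g : Matrix (Fin n) (Fin n) ℂ} (hg : IsUnit g) :
    ∃ k : Matrix (Fin n) (Fin n) ℂ, k * kᴴ = 1 ∧
      0 ≤ ((act g μ).momentMatrix * (k * D * kᴴ)).trace.re := by
  obtain ⟨u, d, hu, hd, rfl⟩ := exists_antitone_diagonalization hD
  have hu' := mul_eq_one_comm.1 hu
  have hui : u⁻¹ = uᴴ := Matrix.inv_eq_right_inv hu
  obtain ⟨q, p, hq, hp, hgu⟩ := exists_unitary_mul_upperTriangular (g * u)
  have hq' := mul_eq_one_comm.1 hq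
  have hp' : IsUnit p := by
    have h1 : IsUnit (q * p) := hgu ▸ hg.mul (IsUnit.of_mul_eq_one _ hu)
    have h2 : p = qᴴ * (q * p) := by rw [← mul_assoc, hq', one_mul]
    rw [h2]
    exact (IsUnit.of_mul_eq_one _ hq').mul h1
  have hgg : g = q * p * uᴴ := by rw [← hgu, mul_assoc, hu, mul_one]
  have h1 : (act uᴴ μ).IsDer (diagonal (fun i => (d i : ℂ))) := by
    have := isDer_act (IsUnit.of_mul_eq_one _ hu') h
    rw [Matrix.inv_eq_right_inv hu'] at this
    convert this using 1
    calc _ = (uᴴ * u) * diagonal (fun i => (d i : ℂ)) * (uᴴ * u) := by rw [hu']; simp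
      _ = _ := by noncomm_ring
  refine ⟨q * uᴴ, ?_, ?_⟩
  · rw [Matrix.conjTranspose_mul, Matrix.conjTranspose_conjTranspose]
    calc _ = q * (uᴴ * u) * qᴴ := by noncomm_ring
      _ = 1 := by rw [hu', mul_one, hq]
  · have h2 := trace_momentMatrix_act_nonneg hd h1 hp' hp
    rw [hgg, act_mul, act_mul, momentMatrix_act hq]
    convert h2 using 2
    rw [Matrix.conjTranspose_mul, Matrix.conjTranspose_conjTranspose]
    generalize (act p (act uᴴ μ)).momentMatrix = M
    generalize diagonal (fun i => (d i : ℂ)) = Λ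
    calc _ = (q * (M * (qᴴ * q) * (uᴴ * u) * Λ * (uᴴ * u)) * qᴴ).trace := by
          congr 1; noncomm_ring
      _ = _ := by
          rw [hq', hu', Matrix.trace_mul_comm, ← mul_assoc, hq']
          simp

/-- Writing M_μ = cI + D, the derivation part pairs nonnegatively with M_{g.μ}, while the scalar
part contributes c tr(M_{g.μ}) = -2c‖g.μ‖². After normalization this is F(μ), since tr(M_μ²) =
-2c‖μ‖². -/
theorem F_le_trace {μ : AlgSpace n} (hμ : μ.IsCritical) {g : Matrix (Fin n) (Fin n) ℂ}
    (hg : IsUnit g) : ∃ k : Matrix (Fin n) (Fin n) ℂ, k * kᴴ = 1 ∧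
      μ.F ≤ ((act g μ).momentMap * (k * μ.momentMap * kᴴ)).trace.re := by
  obtain ⟨h0, c, hc⟩ := (isCritical_iff μ).1 hμ
  have hD : (μ.momentMatrix - (c : ℂ) • 1).IsHermitian := by
    refine μ.momentMatrix_isHermitian.sub ?_
    simp [Matrix.IsHermitian, Matrix.conjTranspose_smul]
  obtain ⟨k, hk, hnn⟩ := exists_unitary_trace_ge hD hc hg
  refine ⟨k, hk, ?_⟩
  have hν : act g μ ≠ 0 := (iso_act μ hg).ne_zero h0
  have e : k * μ.momentMatrix * kᴴ = k * (μ.momentMatrix - (c : ℂ) • 1) * kᴴ + (c : ℂ) • 1 := by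
    rw [Matrix.mul_sub, Matrix.sub_mul]
    simp [hk]
  have h1 : -2 * c * ‖act g μ‖ ^ 2 ≤
      ((act g μ).momentMatrix * (k * μ.momentMatrix * kᴴ)).trace.re := by
    rw [e, Matrix.mul_add, Matrix.trace_add, Matrix.mul_smul, mul_one, Matrix.trace_smul,
      trace_momentMatrix, Complex.add_re, smul_eq_mul, ← Complex.ofReal_mul, Complex.ofReal_re]
    linarith
  rw [F_eq, trace_momentMatrix_sq hc, Complex.ofReal_re, momentMap, momentMap]
  simp only [Matrix.smul_mul, Matrix.mul_smul, Matrix.trace_smul, smul_eq_mul,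
    Complex.re_ofReal_mul]
  have h2 : ‖act g μ‖ ≠ 0 := by simpa using hν
  have h3 : ‖μ‖ ≠ 0 := by simpa using h0
  have h4 : 0 ≤ (‖μ‖ ^ 2)⁻¹ * (‖act g μ‖ ^ 2)⁻¹ := by positivity
  have h5 := mul_le_mul_of_nonneg_left h1 h4
  calc _ = (‖μ‖ ^ 2)⁻¹ * (‖act g μ‖ ^ 2)⁻¹ * (-2 * c * ‖act g μ‖ ^ 2) := by field_simp
    _ ≤ _ := h5
    _ = _ := by ring

theorem F_eq_trace (μ : AlgSpace n) : μ.F = (μ.momentMap * μ.momentMap).trace.re := by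
  rw [F, μ.momentMap_isHermitian.eq]

theorem trace_conj {k : Matrix (Fin n) (Fin n) ℂ} (hk : k * kᴴ = 1)
    (X : Matrix (Fin n) (Fin n) ℂ) : (k * X * kᴴ).trace = X.trace := by
  rw [Matrix.trace_mul_comm, ← mul_assoc, mul_eq_one_comm.1 hk, one_mul]

theorem conj_mul_conj {k : Matrix (Fin n) (Fin n) ℂ} (hk : k * kᴴ = 1)
    (X Y : Matrix (Fin n) (Fin n) ℂ) : (k * X * kᴴ) * (k * Y * kᴴ) = k * (X * Y) * kᴴ := by
  calc _ = k * X * (kᴴ * k) * Y * kᴴ := by noncomm_ring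
    _ = _ := by rw [mul_eq_one_comm.1 hk]; noncomm_ring

/-- Together with `F_le_trace` this bounds the squared distance by F(ν) - F(μ). Its nonnegativity
gives minimality, and equality of the values forces the two matrices to coincide. -/
theorem trace_sub_conj_sq (μ ν : AlgSpace n) {k : Matrix (Fin n) (Fin n) ℂ} (hk : k * kᴴ = 1) :
    ((ν.momentMap - k * μ.momentMap * kᴴ) * (ν.momentMap - k * μ.momentMap * kᴴ)ᴴ).trace.re =
      ν.F + μ.F - 2 * (ν.momentMap * (k * μ.momentMap * kᴴ)).trace.re := by
  have h1 : (ν.momentMap - k * μ.momentMap * kᴴ)ᴴ = ν.momentMap - k * μ.momentMap * kᴴ := by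
    simp [Matrix.conjTranspose_mul, μ.momentMap_isHermitian.eq, ν.momentMap_isHermitian.eq,
      mul_assoc]
  rw [h1, Matrix.sub_mul, Matrix.mul_sub, Matrix.mul_sub, conj_mul_conj hk]
  simp only [Matrix.trace_sub, Complex.sub_re, trace_conj hk, F_eq_trace]
  rw [Matrix.trace_mul_comm (k * μ.momentMap * kᴴ)]
  ring

open scoped ComplexOrder in
theorem trace_mul_conjTranspose_self_re_nonneg (X : Matrix (Fin n) (Fin n) ℂ) :
    0 ≤ (X * Xᴴ).trace.re :=
  (Complex.nonneg_iff.1 (Matrix.posSemidef_self_mul_conjTranspose X).trace_nonneg).1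

/-- A critical point minimizes `F` on its orbit. -/
theorem IsCritical.F_le {μ ν : AlgSpace n} (hμ : μ.IsCritical) (h : μ.Iso ν) : μ.F ≤ ν.F := by
  obtain ⟨g, hg, rfl⟩ := h.exists_act
  obtain ⟨k, hk, hle⟩ := F_le_trace hμ hg
  have h1 := trace_sub_conj_sq μ (act g μ) hk
  have h2 := trace_mul_conjTranspose_self_re_nonneg
    ((act g μ).momentMap - k * μ.momentMap * kᴴ)
  linarith

theorem IsCritical.F_eq_of_iso {μ ν : AlgSpace n} (hμ : μ.IsCritical) (hν : ν.IsCritical)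
    (h : μ.Iso ν) : μ.F = ν.F :=
  le_antisymm (hμ.F_le h) (hν.F_le h.symm)

open scoped ComplexOrder in
/-- The moment maps of two critical points in one orbit are unitarily conjugate. -/
theorem IsCritical.exists_momentMap_eq {μ ν : AlgSpace n} (hμ : μ.IsCritical) (hν : ν.IsCritical)
    (h : μ.Iso ν) : ∃ k : Matrix (Fin n) (Fin n) ℂ, k * kᴴ = 1 ∧
      ν.momentMap = k * μ.momentMap * kᴴ := by
  have hF := hμ.F_eq_of_iso hν h
  obtain ⟨g, hg, rfl⟩ := h.exists_act
  obtain ⟨k, hk, hle⟩ := F_le_trace hμ hg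
  refine ⟨k, hk, ?_⟩
  have h1 := trace_sub_conj_sq μ (act g μ) hk
  have h2 := Complex.nonneg_iff.1 (Matrix.posSemidef_self_mul_conjTranspose
    ((act g μ).momentMap - k * μ.momentMap * kᴴ)).trace_nonneg
  have h3 : (((act g μ).momentMap - k * μ.momentMap * kᴴ) *
      ((act g μ).momentMap - k * μ.momentMap * kᴴ)ᴴ).trace = 0 := by
    refine Complex.ext ?_ h2.2.symm
    have := h2.1
    simp only [Complex.zero_re]
    linarith
  exact sub_eq_zero.1 (Matrix.trace_mul_conjTranspose_self_eq_zero_iff.1 h3)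

theorem charpoly_conj {k : Matrix (Fin n) (Fin n) ℂ} (hk : k * kᴴ = 1)
    (X : Matrix (Fin n) (Fin n) ℂ) : (k * X * kᴴ).charpoly = X.charpoly := by
  rw [Matrix.charpoly_mul_comm, ← mul_assoc, mul_eq_one_comm.1 hk, one_mul]

/-- Isomorphic critical points have the same critical type. -/
theorem IsCritical.hasType_of_iso {μ ν : AlgSpace n} (hμ : μ.IsCritical) (hν : ν.IsCritical)
    (h : μ.Iso ν) {τ : List (ℤ × ℕ)} (hτ : μ.HasType τ) : ν.HasType τ := by
  obtain ⟨k, hk, hm⟩ := hμ.exists_momentMap_eq hν h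
  obtain ⟨h1, h2, h3, c, t, D, ht, hD, hM, hp⟩ := hτ
  refine ⟨h1, h2, h3, ?_⟩
  obtain ⟨hν0, c', hc'⟩ := (isCritical_iff ν).1 hν
  have nμ : 0 < ‖μ‖ := by simpa using hμ.1
  have nν : 0 < ‖ν‖ := by simpa using hν0
  set s : ℝ := ‖ν‖ ^ 2 / ‖μ‖ ^ 2 with hs
  have hs0 : 0 < s := by positivity
  have hMν : ν.momentMatrix = (s : ℂ) • (k * μ.momentMatrix * kᴴ) := by
    have e1 : ν.momentMatrix = ((‖ν‖ ^ 2 : ℝ) : ℂ) • ν.momentMap := by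
      rw [momentMap, smul_smul, ← Complex.ofReal_mul, mul_inv_cancel₀ (by positivity)]
      simp
    rw [e1, hm, momentMap, Matrix.mul_smul, Matrix.smul_mul, smul_smul, ← Complex.ofReal_mul, hs,
      div_eq_mul_inv]
  have hcD : μ.IsDer (μ.momentMatrix - (c : ℂ) • 1) := by
    rwa [hM, add_sub_cancel_left]
  -- Conjugacy relates M_μ and M_ν up to the scale s. Comparing tr(M²) = -2c‖·‖² on both sides
  -- forces the scalar parts to scale by s as well, hence so do the derivations.
  have e2 := trace_momentMatrix_sq hc'
  rw [hMν, Matrix.smul_mul, Matrix.mul_smul, smul_smul, conj_mul_conj hk, Matrix.trace_smul,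
    trace_conj hk, trace_momentMatrix_sq hcD, smul_eq_mul, ← Complex.ofReal_mul,
    ← Complex.ofReal_mul] at e2
  have e3 := Complex.ofReal_injective e2
  have e4 : c' = s * c := by
    have : ‖ν‖ ^ 2 = s * ‖μ‖ ^ 2 := by rw [hs]; field_simp
    rw [this] at e3
    clear_value s
    have h5 : s * ‖μ‖ ^ 2 ≠ 0 := by positivity
    have h6 : (s * ‖μ‖ ^ 2) * (c' - s * c) = 0 := by linear_combination (1 / 2) * e3
    linarith [(mul_eq_zero.1 h6).resolve_left h5]
  have e5 : ν.momentMatrix - (c' : ℂ) • 1 = (s : ℂ) • (k * D * kᴴ) := by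
    rw [hMν, hM, e4, Matrix.mul_add, Matrix.add_mul, Matrix.mul_smul, Matrix.smul_mul, mul_one, hk,
      smul_add, smul_smul, Complex.ofReal_mul, add_sub_cancel_left]
  refine ⟨c', t / s, (s : ℂ) • (k * D * kᴴ), by positivity, e5 ▸ hc', ?_, ?_⟩
  · rw [← e5]
    simp
  · rw [← hp, smul_smul, ← Complex.ofReal_mul, div_mul_cancel₀ _ hs0.ne',
      ← charpoly_conj hk ((t : ℂ) • D), Matrix.mul_smul, Matrix.smul_mul]

end Minimality

end AlgSpace

namespace AlgSpace

variable {n : ℕ}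

/-! ### Algebras with diagonal moment matrix. -/

section Monomial

/-- The left and right multiplications by basis vectors and the products with values in a fixed
basis direction are, up to scalars, partial permutations of the basis. -/
structure IsMonomial (μ : AlgSpace n) : Prop where
  out : ∀ i j a b, a ≠ b → μ (i, j, a) = 0 ∨ μ (i, j, b) = 0
  right : ∀ i k a b, a ≠ b → μ (i, a, k) = 0 ∨ μ (i, b, k) = 0
  left : ∀ j k a b, a ≠ b → μ (a, j, k) = 0 ∨ μ (b, j, k) = 0

/-- The diagonal entries of the moment matrix. -/
noncomputable def momentDiag (μ : AlgSpace n) (a : Fin n) : ℝ :=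
  2 * ∑ i, ∑ j, ‖μ (i, j, a)‖ ^ 2 - 2 * ∑ i, ∑ k, ‖μ (i, a, k)‖ ^ 2
    - 2 * ∑ j, ∑ k, ‖μ (a, j, k)‖ ^ 2

theorem momentMatrix_apply_self (μ : AlgSpace n) (a : Fin n) :
    μ.momentMatrix a a = (μ.momentDiag a : ℂ) := by
  have e : ∀ z : ℂ, z * star z = ((‖z‖ ^ 2 : ℝ) : ℂ) := fun z => by
    rw [Complex.star_def, Complex.mul_conj, Complex.normSq_eq_norm_sq]
  have e' : ∀ z : ℂ, star z * z = ((‖z‖ ^ 2 : ℝ) : ℂ) := fun z => by rw [mul_comm, e]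
  simp only [momentMatrix, Matrix.sub_apply, Matrix.smul_apply, Matrix.sum_apply, Matrix.mul_apply,
    Matrix.conjTranspose_apply, leftMul, rightMul, Matrix.of_apply, smul_eq_mul, momentDiag, e, e']
  rw [Finset.sum_comm (f := fun j k => ‖μ (a, j, k)‖ ^ 2)]
  rw [Finset.sum_comm (f := fun j k => ((‖μ (a, j, k)‖ ^ 2 : ℝ) : ℂ))]
  push_cast
  ring

/-- An off-diagonal entry is a sum of products of two structure constants that differ in a single
index, and each such product vanishes. -/
theorem IsMonomial.momentMatrix_eq {μ : AlgSpace n} (h : μ.IsMonomial) :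
    μ.momentMatrix = diagonal fun a => (μ.momentDiag a : ℂ) := by
  ext a b
  by_cases hab : a = b
  · rw [← hab, diagonal_apply_eq, momentMatrix_apply_self]
  · rw [diagonal_apply_ne _ hab]
    have h1 : ∀ i j, μ (i, j, a) * star (μ (i, j, b)) = 0 := fun i j => by
      rcases h.out i j a b hab with h | h <;> simp [h]
    have h2 : ∀ i k, star (μ (i, a, k)) * μ (i, b, k) = 0 := fun i k => by
      rcases h.right i k a b hab with h | h <;> simp [h]
    have h3 : ∀ i k, star (μ (a, i, k)) * μ (b, i, k) = 0 := fun i k => by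
      rcases h.left i k a b hab with h | h <;> simp [h]
    simp only [momentMatrix, Matrix.sub_apply, Matrix.smul_apply, Matrix.sum_apply,
      Matrix.mul_apply, Matrix.conjTranspose_apply, leftMul, rightMul, Matrix.of_apply, smul_eq_mul,
      h1, h2, h3]
    simp

theorem isDer_diagonal {μ : AlgSpace n} {d : Fin n → ℂ}
    (h : ∀ i j k, μ (i, j, k) ≠ 0 → d k = d i + d j) : μ.IsDer (diagonal d) := by
  rw [isDer_iff]
  ext ⟨i, j, k⟩
  have h1 : infAct (diagonal d) μ (i, j, k) = (d k - d i - d j) * μ (i, j, k) := by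
    simp [infAct_apply, diagonal_apply]
    ring
  rw [h1, PiLp.zero_apply]
  by_cases h0 : μ (i, j, k) = 0
  · simp [h0]
  · rw [h i j k h0]
    ring

theorem charpoly_diagonal_int {κ : Fin n → ℤ} {τ : List (ℤ × ℕ)}
    (h : (List.ofFn κ).Perm (τ.flatMap fun p => List.replicate p.2 p.1)) :
    (diagonal fun a => ((κ a : ℤ) : ℂ)).charpoly =
      (τ.map fun p => (X - C (p.1 : ℂ)) ^ p.2).prod := by
  rw [Matrix.charpoly_diagonal]
  have h1 := (h.map fun z : ℤ => X - C (z : ℂ)).prod_eq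
  rw [List.map_ofFn, List.prod_ofFn, List.map_flatMap] at h1
  simp only [Function.comp_def] at h1
  rw [h1]
  clear h h1
  induction τ with
  | nil => simp
  | cons p τ ih =>
    rw [List.flatMap_cons, List.prod_append, ih]
    simp

variable {μ : AlgSpace n} {κ : Fin n → ℤ} {c T : ℝ}

theorem momentMatrix_eq_add (h : μ.IsMonomial) (hd : ∀ a, μ.momentDiag a = c + T * κ a) :
    μ.momentMatrix = (c : ℂ) • (1 : Matrix (Fin n) (Fin n) ℂ) +
      diagonal fun a => ((T * κ a : ℝ) : ℂ) := by
  rw [h.momentMatrix_eq, ← diagonal_one, ← diagonal_smul, diagonal_add]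
  congr 1
  funext a
  rw [hd a]
  simp

theorem isDer_diagonal_mul (hκ : ∀ i j k, μ (i, j, k) ≠ 0 → κ k = κ i + κ j) :
    μ.IsDer (diagonal fun a => ((T * κ a : ℝ) : ℂ)) := by
  refine isDer_diagonal fun i j k h => ?_
  rw [hκ i j k h]
  push_cast
  ring

theorem IsMonomial.isCritical (h : μ.IsMonomial) (h0 : μ ≠ 0)
    (hd : ∀ a, μ.momentDiag a = c + T * κ a)
    (hκ : ∀ i j k, μ (i, j, k) ≠ 0 → κ k = κ i + κ j) : μ.IsCritical := by
  rw [isCritical_iff]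
  refine ⟨h0, c, ?_⟩
  rw [momentMatrix_eq_add h hd, add_sub_cancel_left]
  exact isDer_diagonal_mul hκ

/-- Conditions on a critical type that do not involve the algebra. Two consecutive eigenvalues
ensure that there is no common factor. -/
def TypeOK (n : ℕ) (τ : List (ℤ × ℕ)) : Prop :=
  (τ.map Prod.fst).Pairwise (· < ·) ∧ (∀ p ∈ τ, 0 < p.2) ∧
    ((∃ p ∈ τ, ∃ q ∈ τ, q.1 = p.1 + 1) ∨ τ = [(0, n)])

instance (n : ℕ) (τ : List (ℤ × ℕ)) : Decidable (TypeOK n τ) := by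
  unfold TypeOK
  infer_instance

theorem IsMonomial.hasType (h : μ.IsMonomial) (hT : 0 < T)
    (hd : ∀ a, μ.momentDiag a = c + T * κ a)
    (hκ : ∀ i j k, μ (i, j, k) ≠ 0 → κ k = κ i + κ j) {τ : List (ℤ × ℕ)} (hτ : TypeOK n τ)
    (hp : (List.ofFn κ).Perm (τ.flatMap fun p => List.replicate p.2 p.1)) : μ.HasType τ := by
  refine ⟨hτ.1, hτ.2.1, hτ.2.2.imp (fun h1 m hm => ?_) id, c, T⁻¹, _, by positivity,
    isDer_diagonal_mul hκ, momentMatrix_eq_add h hd, ?_⟩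
  · obtain ⟨p, hp, q, hq, e⟩ := h1
    have := (Int.dvd_add_right (hm p hp)).1 (e ▸ hm q hq)
    exact isUnit_of_dvd_one this
  · rw [← charpoly_diagonal_int hp, ← diagonal_smul]
    congr 2
    funext a
    have : (T : ℂ) ≠ 0 := by exact_mod_cast hT.ne'
    simp [this]

/-- Since tr(M_μ) = -2‖μ‖², the norm can be eliminated from F. The formula then contains only
diagonal entries, and no division, so it can be checked in integers. -/
theorem IsMonomial.F_eq (h : μ.IsMonomial) (h0 : μ ≠ 0) :
    μ.F * (∑ a, μ.momentDiag a) ^ 2 = 4 * ∑ a, μ.momentDiag a ^ 2 := by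
  have h1 := trace_momentMatrix μ
  rw [h.momentMatrix_eq, trace_diagonal, ← Complex.ofReal_sum] at h1
  have h2 := Complex.ofReal_injective h1
  rw [AlgSpace.F_eq, h2, h.momentMatrix_eq, diagonal_mul_diagonal, trace_diagonal]
  simp only [← Complex.ofReal_mul, ← Complex.ofReal_sum, Complex.ofReal_re]
  have h4 : ‖μ‖ ≠ 0 := by simpa using h0
  field_simp
  ring

end Monomial

/-! ### Multiplication tables with square roots of integers as entries. -/

section Weights

/-- A multiplication table given by the nonzero entries `e_i e_j = √m e_k`, listed as
`(i, j, k, m)`. -/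
abbrev WTable (n : ℕ) : Type := List (Fin n × Fin n × Fin n × ℕ)

/-- The squared structure constants of a table. -/
def wt (l : WTable n) (i j k : Fin n) : ℕ :=
  (l.map fun q => if q.1 = i ∧ q.2.1 = j ∧ q.2.2.1 = k then q.2.2.2 else 0).sum

/-- The algebra of a table. -/
noncomputable def ofTable (l : WTable n) : AlgSpace n :=
  WithLp.toLp 2 fun p => ((√(wt l p.1 p.2.1 p.2.2 : ℝ) : ℝ) : ℂ)

theorem ofTable_apply (l : WTable n) (i j k : Fin n) :
    ofTable l (i, j, k) = ((√(wt l i j k : ℝ) : ℝ) : ℂ) := rfl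

theorem ofTable_eq_zero_iff (l : WTable n) (i j k : Fin n) :
    ofTable l (i, j, k) = 0 ↔ wt l i j k = 0 := by
  rw [ofTable_apply, Complex.ofReal_eq_zero, Real.sqrt_eq_zero (by positivity)]
  simp

/-- The diagonal entries of the moment matrix of a table. -/
def wtDiag (l : WTable n) (a : Fin n) : ℤ :=
  2 * ∑ i, ∑ j, (wt l i j a : ℤ) - 2 * ∑ i, ∑ k, (wt l i a k : ℤ) - 2 * ∑ j, ∑ k, (wt l a j k : ℤ)

theorem momentDiag_ofTable (l : WTable n) (a : Fin n) :
    (ofTable l).momentDiag a = (wtDiag l a : ℝ) := by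
  have h : ∀ i j k, ‖ofTable l (i, j, k)‖ ^ 2 = (wt l i j k : ℝ) := by
    intro i j k
    rw [ofTable_apply, Complex.norm_real, Real.norm_eq_abs, sq_abs, Real.sq_sqrt (by positivity)]
  simp only [momentDiag, h, wtDiag]
  push_cast
  rfl

/-- The table is nonzero and monomial. -/
def TableOK (l : WTable n) : Prop :=
  (∀ i j a b, a ≠ b → wt l i j a = 0 ∨ wt l i j b = 0) ∧
  (∀ i k a b, a ≠ b → wt l i a k = 0 ∨ wt l i b k = 0) ∧
  (∀ j k a b, a ≠ b → wt l a j k = 0 ∨ wt l b j k = 0) ∧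
  (∃ i j k, wt l i j k ≠ 0)

instance (l : WTable n) : Decidable (TableOK l) := by
  unfold TableOK
  infer_instance

theorem TableOK.isMonomial {l : WTable n} (h : TableOK l) : (ofTable l).IsMonomial := by
  refine ⟨?_, ?_, ?_⟩ <;> simp only [ofTable_eq_zero_iff]
  exacts [h.1, h.2.1, h.2.2.1]

theorem TableOK.ne_zero {l : WTable n} (h : TableOK l) : ofTable l ≠ 0 := by
  obtain ⟨i, j, k, hw⟩ := h.2.2.2
  intro h0
  apply hw
  rw [← ofTable_eq_zero_iff, h0]
  rfl

/-- `M_μ = c I + T diag(κ)`, where `diag(κ)` is a derivation of type `τ`. -/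
def TypeData (l : WTable n) (c : ℤ) (T : ℕ) (κ : Fin n → ℤ) (τ : List (ℤ × ℕ)) : Prop :=
  0 < T ∧ (∀ a, wtDiag l a = c + T * κ a) ∧ (∀ i j k, wt l i j k ≠ 0 → κ k = κ i + κ j) ∧
    TypeOK n τ ∧ (List.ofFn κ).Perm (τ.flatMap fun p => List.replicate p.2 p.1)

instance (l : WTable n) (c : ℤ) (T : ℕ) (κ : Fin n → ℤ) (τ : List (ℤ × ℕ)) :
    Decidable (TypeData l c T κ τ) := by
  unfold TypeData
  infer_instance

theorem TableOK.isCritical {l : WTable n} (h : TableOK l) {c : ℤ} {T : ℕ} {κ : Fin n → ℤ}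
    {τ : List (ℤ × ℕ)} (hd : TypeData l c T κ τ) : (ofTable l).IsCritical := by
  refine h.isMonomial.isCritical (c := c) (T := T) (κ := κ) h.ne_zero (fun a => ?_)
    fun i j k hw => hd.2.2.1 i j k ?_
  · rw [momentDiag_ofTable, hd.2.1 a]
    push_cast
    rfl
  · rwa [Ne, ← ofTable_eq_zero_iff]

theorem TableOK.hasType {l : WTable n} (h : TableOK l) {c : ℤ} {T : ℕ} {κ : Fin n → ℤ}
    {τ : List (ℤ × ℕ)} (hd : TypeData l c T κ τ) : (ofTable l).HasType τ := by
  refine h.isMonomial.hasType (c := c) (T := T) (κ := κ) (by exact_mod_cast hd.1) (fun a => ?_)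
    (fun i j k hw => hd.2.2.1 i j k ?_) hd.2.2.2.1 hd.2.2.2.2
  · rw [momentDiag_ofTable, hd.2.1 a]
    push_cast
    rfl
  · rwa [Ne, ← ofTable_eq_zero_iff]

theorem TableOK.F_eq {l : WTable n} (h : TableOK l) {p q : ℤ} (hq : q ≠ 0)
    (hv : p * (∑ a, wtDiag l a) ^ 2 = q * (4 * ∑ a, wtDiag l a ^ 2))
    (h0 : ∑ a, wtDiag l a ≠ 0) : (ofTable l).F = p / q := by
  have h1 := h.isMonomial.F_eq h.ne_zero
  simp only [momentDiag_ofTable] at h1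
  have hv' : (p : ℝ) * ((∑ a, wtDiag l a : ℤ) : ℝ) ^ 2 =
      (q : ℝ) * ((4 * ∑ a, wtDiag l a ^ 2 : ℤ) : ℝ) := by
    exact_mod_cast hv
  have hq' : (q : ℝ) ≠ 0 := by exact_mod_cast hq
  have h2 : ((∑ a, wtDiag l a : ℤ) : ℝ) ≠ 0 := by exact_mod_cast h0
  push_cast at hv' h2
  refine mul_right_cancel₀ (pow_ne_zero 2 h2) (h1.trans ?_)
  rw [div_mul_eq_mul_div, hv', mul_div_cancel_left₀ _ hq']

end Weights

/-! ### Associativity of tables. -/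

section Associativity

theorem isAssoc_of_apply {μ : AlgSpace n}
    (h : ∀ i j l k, ∑ r, μ (i, j, r) * μ (r, l, k) = ∑ r, μ (j, l, r) * μ (i, r, k)) :
    μ.IsAssoc := by
  let f : (Fin n → ℂ) →ₗ[ℂ] (Fin n → ℂ) →ₗ[ℂ] (Fin n → ℂ) →ₗ[ℂ] (Fin n → ℂ) :=
    LinearMap.mk₂ ℂ (fun X Y => μ.mulLin X ∘ₗ μ.mulLin Y)
      (fun X X' Y => by simp [LinearMap.add_comp]) (fun c X Y => by simp [LinearMap.smul_comp])
      (fun X Y Y' => by simp [LinearMap.comp_add]) (fun c X Y => by simp [LinearMap.comp_smul])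
  have key : μ.mulLin.compr₂ μ.mulLin = f := by
    refine bilin_ext fun i j => (Pi.basisFun ℂ (Fin n)).ext fun l => ?_
    have e1 : ∀ l k (X : Fin n → ℂ), μ.mul X (Pi.single l 1) k = ∑ r, X r * μ (r, l, k) := by
      intro l k X
      simp [mul, Pi.single_apply]
    have e2 : ∀ i k (X : Fin n → ℂ), μ.mul (Pi.single i 1) X k = ∑ r, X r * μ (i, r, k) := by
      intro i k X
      simp [mul, Pi.single_apply]
    simp only [LinearMap.compr₂_apply, f, LinearMap.mk₂_apply, LinearMap.comp_apply, mulLin_apply,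
      mul_single_single, Pi.basisFun_apply]
    ext k
    rw [e1, e2]
    exact h i j l k
  intro X Y Z
  exact congrArg (fun g => g X Y Z) key

/-- At most one summand is nonzero. This reduces associativity of a monomial table to an identity
between its squared structure constants. -/
theorem sum_sqrt_eq_sqrt_sum {ι : Type*} [Fintype ι] {f : ι → ℕ}
    (h : ∀ a b, a ≠ b → f a = 0 ∨ f b = 0) : ∑ r, √(f r : ℝ) = √(∑ r, f r : ℕ) := by
  by_cases h0 : ∀ r, f r = 0
  · simp [h0]
  · push Not at h0
    obtain ⟨r, hr⟩ := h0
    have h1 : ∀ b, b ≠ r → f b = 0 := fun b hb => (h b r hb).resolve_right hr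
    rw [Finset.sum_eq_single r (fun b _ hb => by simp [h1 b hb]) (by simp),
      Finset.sum_eq_single r (fun b _ hb => h1 b hb) (by simp)]

theorem TableOK.isAssoc {l : WTable n} (h : TableOK l)
    (ha : ∀ i j a k, ∑ r, wt l i j r * wt l r a k = ∑ r, wt l j a r * wt l i r k) :
    (ofTable l).IsAssoc := by
  refine isAssoc_of_apply fun i j a k => ?_
  simp only [ofTable_apply, ← Complex.ofReal_mul, ← Complex.ofReal_sum,
    ← Real.sqrt_mul (Nat.cast_nonneg _), ← Nat.cast_mul]
  rw [sum_sqrt_eq_sqrt_sum, sum_sqrt_eq_sqrt_sum, ha]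
  · intro r s hrs
    rcases h.1 j a r s hrs with h | h <;> simp [h]
  · intro r s hrs
    rcases h.1 i j r s hrs with h | h <;> simp [h]

end Associativity

/-! ### Explicit isomorphisms between tables and sums of ψ. -/

section Isomorphisms

theorem iso_of_basis {μ ν : AlgSpace n} (P Q : Matrix (Fin n) (Fin n) ℂ) (hPQ : P * Q = 1)
    (h : ∀ i j, μ.mul (P *ᵥ Pi.single i 1) (P *ᵥ Pi.single j 1) = P *ᵥ fun k => ν (i, j, k)) :
    ν.Iso μ := by
  refine ⟨Matrix.toLin'OfInv (mul_eq_one_comm.1 hPQ) hPQ, fun X Y => ?_⟩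
  change Matrix.toLin' P (ν.mul X Y) = μ.mul (Matrix.toLin' P X) (Matrix.toLin' P Y)
  have : ν.mulLin.compr₂ P.mulVecLin = μ.mulLin.compl₁₂ P.mulVecLin P.mulVecLin := by
    refine bilin_ext fun i j => ?_
    simp only [mulLin_apply, LinearMap.compr₂_apply, LinearMap.compl₁₂_apply,
      Matrix.mulVecLin_apply, h, mul_single_single]
  exact congrArg (fun f => f X Y) this

/-- The labels of ψ start at 1 and coordinates at 0; positivity keeps the truncated subtraction
honest. -/
theorem mul_psi {k i j : ℕ} (hk : 0 < k ∧ k - 1 < n) (hi : 0 < i ∧ i - 1 < n)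
    (hj : 0 < j ∧ j - 1 < n) (X Y : Fin n → ℂ) :
    (psi (n := n) k i j).mul X Y = Pi.single ⟨k - 1, hk.2⟩ (X ⟨i - 1, hi.2⟩ * Y ⟨j - 1, hj.2⟩) := by
  have e : ∀ (a : Fin n) {m : ℕ} (hm : 0 < m ∧ m - 1 < n), (a : ℕ) + 1 = m ↔ a = ⟨m - 1, hm.2⟩ := by
    intro a m hm
    rw [Fin.ext_iff]
    have := hm.1
    constructor <;> intro h <;> simp only at * <;> omega
  have : (psi (n := n) k i j).mulLin =
      ((LinearMap.mul ℂ ℂ).compl₁₂ (LinearMap.proj ⟨i - 1, hi.2⟩)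
        (LinearMap.proj ⟨j - 1, hj.2⟩)).compr₂ (LinearMap.single ℂ (fun _ => ℂ) ⟨k - 1, hk.2⟩) := by
    refine bilin_ext fun a b => ?_
    rw [mulLin_apply, mul_single_single]
    ext c
    simp only [psi, e _ hk, e _ hi, e _ hj, LinearMap.compr₂_apply, LinearMap.compl₁₂_apply,
      LinearMap.proj_apply, LinearMap.mul_apply', LinearMap.single_apply, Pi.single_apply]
    split_ifs <;> simp_all
  exact congrArg (fun f => f X Y) this

theorem add_mul_apply (μ ν : AlgSpace n) (X Y : Fin n → ℂ) :
    (μ + ν).mul X Y = μ.mul X Y + ν.mul X Y := by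
  ext k
  simp [mul, mul_add, Finset.sum_add_distrib]

theorem smul_mul_apply (c : ℂ) (μ : AlgSpace n) (X Y : Fin n → ℂ) :
    (c • μ).mul X Y = c • μ.mul X Y := by
  ext k
  simp [mul, Finset.mul_sum, mul_left_comm]

theorem sub_mul_apply (μ ν : AlgSpace n) (X Y : Fin n → ℂ) :
    (μ - ν).mul X Y = μ.mul X Y - ν.mul X Y := by
  ext k
  simp [mul, mul_sub, Finset.sum_sub_distrib]

/-- A table all of whose entries are `1` is a sum of algebras `ψ_k^{i,j}`. -/
theorem ofTable_eq_sum (l : WTable n) (h1 : ∀ q ∈ l, q.2.2.2 = 1) (h2 : ∀ i j k, wt l i j k ≤ 1) :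
    ofTable l = (l.map fun q => psi (n := n) (q.2.2.1 + 1) (q.1 + 1) (q.2.1 + 1)).sum := by
  have key : ∀ l : WTable n, (∀ q ∈ l, q.2.2.2 = 1) → ∀ i j k,
      (l.map fun q => psi (n := n) (q.2.2.1 + 1) (q.1 + 1) (q.2.1 + 1)).sum (i, j, k) =
        (wt l i j k : ℂ) := by
    intro l
    induction l with
    | nil => simp [wt]
    | cons q l ih =>
      intro h i j k
      have h' := ih (fun q hq => h q (by simp [hq])) i j k
      have hq := h q (by simp)
      simp only [List.map_cons, List.sum_cons, PiLp.add_apply, h', wt, hq]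
      simp [psi, Fin.val_inj, eq_comm]
  ext ⟨i, j, k⟩
  rw [key l h1, ofTable_apply]
  have := h2 i j k
  interval_cases wt l i j k <;> simp

end Isomorphisms

end AlgSpace

/-! ### Certificates for the rows of the tables. -/

namespace AlgSpace

variable {n : ℕ}

/-- Data certifying a row: a table whose algebra is critical, and its type. -/
structure Cert (n : ℕ) where
  table : WTable n
  c : ℤ
  T : ℕ
  κ : Fin n → ℤ
  type : List (ℤ × ℕ)
  num : ℤ
  den : ℤ

/-- The data are consistent. -/
def Cert.OK (r : Cert n) : Prop :=
  TableOK r.table ∧ TypeData r.table r.c r.T r.κ r.type ∧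
    r.num * (∑ a, wtDiag r.table a) ^ 2 = r.den * (4 * ∑ a, wtDiag r.table a ^ 2) ∧
    r.den ≠ 0 ∧ ∑ a, wtDiag r.table a ≠ 0 ∧
    ∀ i j a k, ∑ b, wt r.table i j b * wt r.table b a k = ∑ b, wt r.table j a b * wt r.table i b k

instance (r : Cert n) : Decidable r.OK := by
  unfold Cert.OK
  infer_instance

/-- The certificates for `n = 2`. -/
def certI : Fin 6 → Cert 2 := ![
  ⟨[(0, 0, 0, 1)], -2, 2, ![0, 1], [(0, 1), (1, 1)], 4, 1⟩,
  ⟨[(0, 0, 0, 1), (0, 1, 1, 1)], -4, 4, ![0, 1], [(0, 1), (1, 1)], 4, 1⟩,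
  ⟨[(0, 0, 0, 1), (1, 0, 1, 1)], -4, 4, ![0, 1], [(0, 1), (1, 1)], 4, 1⟩,
  ⟨[(0, 0, 0, 1), (1, 1, 1, 1)], -2, 1, ![0, 0], [(0, 2)], 2, 1⟩,
  ⟨[(0, 0, 1, 1)], -10, 6, ![1, 2], [(1, 1), (2, 1)], 20, 1⟩,
  ⟨[(0, 0, 0, 1), (0, 1, 1, 1), (1, 0, 1, 1)], -6, 6, ![0, 1], [(0, 1), (1, 1)], 4, 1⟩]

/-- The certificates for `n = 3`. -/
def certII : Fin 21 → Cert 3 := ![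
  ⟨[(0, 0, 0, 1)], -2, 2, ![0, 1, 1], [(0, 1), (1, 2)], 4, 1⟩,
  -- In a direct sum the summands must have the same scalar part c. An idempotent summand with
  -- weight m contributes c = -2m, so the weight 5 matches the value -10 of the square-zero summand.
  -- The weights 2 and 3 in later rows arise in the same way.
  ⟨[(0, 0, 0, 5), (1, 1, 2, 1)], -10, 6, ![0, 1, 2], [(0, 1), (1, 1), (2, 1)], 10, 3⟩,
  ⟨[(0, 0, 0, 1), (0, 2, 2, 1)], -4, 4, ![0, 1, 1], [(0, 1), (1, 2)], 4, 1⟩,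
  ⟨[(0, 0, 0, 1), (2, 0, 2, 1)], -4, 4, ![0, 1, 1], [(0, 1), (1, 2)], 4, 1⟩,
  ⟨[(0, 0, 0, 1), (0, 2, 2, 1), (2, 0, 2, 1)], -6, 6, ![0, 1, 1], [(0, 1), (1, 2)], 4, 1⟩,
  ⟨[(0, 0, 0, 1), (2, 2, 2, 1)], -2, 2, ![0, 1, 0], [(0, 2), (1, 1)], 2, 1⟩,
  ⟨[(0, 0, 0, 1), (1, 0, 1, 1), (0, 2, 2, 1)], -6, 6, ![0, 1, 1], [(0, 1), (1, 2)], 4, 1⟩,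
  ⟨[(0, 0, 0, 1), (1, 0, 1, 1), (2, 0, 2, 1)], -6, 6, ![0, 1, 1], [(0, 1), (1, 2)], 4, 1⟩,
  ⟨[(0, 0, 0, 1), (1, 0, 1, 1), (0, 2, 2, 1), (2, 0, 2, 1)], -8, 8, ![0, 1, 1],
    [(0, 1), (1, 2)], 4, 1⟩,
  ⟨[(0, 0, 0, 1), (1, 0, 1, 1), (2, 2, 2, 2)], -4, 4, ![0, 1, 0], [(0, 2), (1, 1)], 2, 1⟩,
  ⟨[(0, 0, 0, 2), (1, 1, 1, 1), (1, 2, 2, 1)], -4, 4, ![0, 0, 1], [(0, 2), (1, 1)], 2, 1⟩,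
  ⟨[(0, 0, 0, 3), (1, 1, 1, 1), (1, 2, 2, 1), (2, 1, 2, 1)], -6, 6, ![0, 0, 1],
    [(0, 2), (1, 1)], 2, 1⟩,
  ⟨[(0, 0, 0, 1), (1, 1, 1, 1), (1, 2, 2, 1), (2, 0, 2, 1)], -4, 4, ![0, 0, 1],
    [(0, 2), (1, 1)], 2, 1⟩,
  ⟨[(0, 0, 0, 1), (1, 1, 1, 1), (2, 2, 2, 1)], -2, 1, ![0, 0, 0], [(0, 3)], 4, 3⟩,
  ⟨[(0, 0, 1, 1)], -10, 2, ![3, 6, 5], [(3, 1), (5, 1), (6, 1)], 20, 1⟩,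
  ⟨[(0, 0, 1, 1), (0, 1, 2, 1), (1, 0, 2, 1)], -14, 6, ![1, 2, 3], [(1, 1), (2, 1), (3, 1)],
    28, 3⟩,
  -- In this row and the next one, e_1 is replaced by the idempotent e_1 - e_2, which removes the
  -- term ψ_2^{1,1}.
  ⟨[(0, 0, 0, 1), (0, 1, 1, 1), (1, 0, 1, 1), (0, 2, 2, 1)], -8, 8, ![0, 1, 1],
    [(0, 1), (1, 2)], 4, 1⟩,
  ⟨[(0, 0, 0, 1), (0, 1, 1, 1), (1, 0, 1, 1), (0, 2, 2, 1), (2, 0, 2, 1)], -10, 10, ![0, 1, 1],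
    [(0, 1), (1, 2)], 4, 1⟩,
  ⟨[(2, 2, 2, 1), (0, 0, 1, 1), (0, 2, 0, 1), (2, 0, 0, 1), (1, 2, 1, 1), (2, 1, 1, 1)], -10, 6,
    ![1, 2, 0], [(0, 1), (1, 1), (2, 1)], 10, 3⟩,
  ⟨[(0, 0, 0, 1), (0, 1, 1, 1), (0, 2, 2, 1)], -6, 6, ![0, 1, 1], [(0, 1), (1, 2)], 4, 1⟩,
  -- A single member stands for the whole family d_22 when critical values are compared.
  ⟨[(0, 1, 2, 1)], -6, 4, ![1, 1, 2], [(1, 2), (2, 1)], 12, 1⟩]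

theorem certI_ok : ∀ i, (certI i).OK := by
  decide +kernel

theorem certII_ok : ∀ i, (certII i).OK := by
  decide +kernel

theorem certI_type (i : Fin 6) : (certI i).type = (tableI i).type := by
  fin_cases i <;> rfl

theorem certII_type (i : Fin 21) : (certII i).type = (tableII i).type := by
  fin_cases i <;> rfl

theorem certI_value (i : Fin 6) : ((certI i).num / (certI i).den : ℝ) = (tableI i).value := by
  fin_cases i <;> simp [certI, tableI]

theorem certII_value (i : Fin 21) : ((certII i).num / (certII i).den : ℝ) = (tableII i).value := by
  fin_cases i <;> simp [certII, tableII]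

theorem certI_iso (i : Fin 6) : ∀ ν ∈ (tableI i).algebras, (ofTable (certI i).table).Iso ν := by
  have h : ofTable (certI i).table ∈ (tableI i).algebras := by
    rw [ofTable_eq_sum _ (by revert i; decide +kernel) (by revert i; decide +kernel)]
    fin_cases i <;> simp [certI, tableI, add_assoc]
  intro ν hν
  fin_cases i <;>
    exact (Set.mem_singleton_iff.1 h).trans (Set.mem_singleton_iff.1 hν).symm ▸ Iso.refl _

theorem diagonal_mul_diagonal_inv {s : Fin 3 → ℂ} (hs : ∀ i, s i ≠ 0) :
    diagonal s * diagonal (fun i => (s i)⁻¹) = 1 := by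
  rw [diagonal_mul_diagonal, ← diagonal_one]
  congr 1
  funext i
  exact mul_inv_cancel₀ (hs i)

theorem sqrt_mul_self_complex (m : ℕ) : ((√(m : ℝ) : ℝ) : ℂ) * ((√(m : ℝ) : ℝ) : ℂ) = m := by
  rw [← Complex.ofReal_mul, Real.mul_self_sqrt (by positivity)]
  simp

/-- Rescaling an idempotent by √m gives a vector whose square is √m times itself. This accounts for
the weights different from 1 here and in the next three lemmas. -/
theorem iso_direct_sum_square_zero :
    (ofTable (n := 3) [(0, 0, 0, 5), (1, 1, 2, 1)]).Iso
    (psi 1 1 1 + psi 3 2 2) := by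
  refine iso_of_basis (diagonal ![((√(5 : ℕ) : ℝ) : ℂ), 1, 1]) _
    (diagonal_mul_diagonal_inv fun i => ?_) fun i j => ?_
  · fin_cases i <;> simp
  · have := sqrt_mul_self_complex 5
    ext k
    fin_cases i <;> fin_cases j <;> fin_cases k <;>
      simp [add_mul_apply, mul_psi, Matrix.mulVec_diagonal, ofTable_apply, wt] at this ⊢

theorem iso_direct_sum_right_unit :
    (ofTable (n := 3) [(0, 0, 0, 1), (1, 0, 1, 1), (2, 2, 2, 2)]).Iso
    (psi 1 1 1 + psi 2 2 1 + psi 3 3 3) := by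
  refine iso_of_basis (diagonal ![1, 1, ((√(2 : ℕ) : ℝ) : ℂ)]) _
    (diagonal_mul_diagonal_inv fun i => ?_) fun i j => ?_
  · fin_cases i <;> simp
  · have := sqrt_mul_self_complex 2
    ext k
    fin_cases i <;> fin_cases j <;> fin_cases k <;>
      simp [add_mul_apply, mul_psi, Matrix.mulVec_diagonal, ofTable_apply, wt] at this ⊢

theorem iso_direct_sum_left_unit :
    (ofTable (n := 3) [(0, 0, 0, 2), (1, 1, 1, 1), (1, 2, 2, 1)]).Iso
    (psi 1 1 1 + psi 2 2 2 + psi 3 2 3) := by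
  refine iso_of_basis (diagonal ![((√(2 : ℕ) : ℝ) : ℂ), 1, 1]) _
    (diagonal_mul_diagonal_inv fun i => ?_) fun i j => ?_
  · fin_cases i <;> simp
  · have := sqrt_mul_self_complex 2
    ext k
    fin_cases i <;> fin_cases j <;> fin_cases k <;>
      simp [add_mul_apply, mul_psi, Matrix.mulVec_diagonal, ofTable_apply, wt] at this ⊢

theorem iso_direct_sum_dual_numbers :
    (ofTable (n := 3) [(0, 0, 0, 3), (1, 1, 1, 1), (1, 2, 2, 1), (2, 1, 2, 1)]).Iso
    (psi 1 1 1 + psi 2 2 2 + psi 3 2 3 + psi 3 3 2) := by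
  refine iso_of_basis (diagonal ![((√(3 : ℕ) : ℝ) : ℂ), 1, 1]) _
    (diagonal_mul_diagonal_inv fun i => ?_) fun i j => ?_
  · fin_cases i <;> simp
  · have := sqrt_mul_self_complex 3
    ext k
    fin_cases i <;> fin_cases j <;> fin_cases k <;>
      simp [add_mul_apply, mul_psi, Matrix.mulVec_diagonal, ofTable_apply, wt] at this ⊢

theorem iso_unital_left : (ofTable (n := 3) [(0, 0, 0, 1), (0, 1, 1, 1), (1, 0, 1, 1), (0, 2, 2, 1)]).Iso
    (psi 1 1 1 + psi 2 1 1 + psi 2 1 2 + psi 2 2 1 + psi 3 1 3) := by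
  refine iso_of_basis !![1, 0, 0; -1, 1, 0; 0, 0, 1] !![1, 0, 0; 1, 1, 0; 0, 0, 1] ?_ fun i j => ?_
  · ext i j
    fin_cases i <;> fin_cases j <;> simp [Matrix.mul_apply, Fin.sum_univ_three]
  · ext k
    fin_cases i <;> fin_cases j <;> fin_cases k <;>
      simp [add_mul_apply, mul_psi, Matrix.mulVec, dotProduct, Fin.sum_univ_three, ofTable_apply, wt]

theorem iso_unital_two : (ofTable (n := 3) [(0, 0, 0, 1), (0, 1, 1, 1), (1, 0, 1, 1), (0, 2, 2, 1), (2, 0, 2, 1)]).Iso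
    (psi 1 1 1 + psi 2 1 1 + psi 2 1 2 + psi 2 2 1 + psi 3 1 3 + psi 3 3 1) := by
  refine iso_of_basis !![1, 0, 0; -1, 1, 0; 0, 0, 1] !![1, 0, 0; 1, 1, 0; 0, 0, 1] ?_ fun i j => ?_
  · ext i j
    fin_cases i <;> fin_cases j <;> simp [Matrix.mul_apply, Fin.sum_univ_three]
  · ext k
    fin_cases i <;> fin_cases j <;> fin_cases k <;>
      simp [add_mul_apply, mul_psi, Matrix.mulVec, dotProduct, Fin.sum_univ_three, ofTable_apply, wt]

theorem certII_iso {i : Fin 21} (hi : i ≠ 20) :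
    ∀ ν ∈ (tableII i).algebras, (ofTable (certII i).table).Iso ν := by
  -- In these rows the critical representative differs from the listed algebra; in the other rows it
  -- is the listed algebra itself.
  by_cases hi' : i ∈ ({1, 9, 10, 11, 16, 17} : Finset (Fin 21))
  · intro ν hν
    fin_cases hi' <;> obtain rfl := Set.mem_singleton_iff.1 hν
    exacts [iso_direct_sum_square_zero, iso_direct_sum_right_unit, iso_direct_sum_left_unit,
      iso_direct_sum_dual_numbers, iso_unital_left, iso_unital_two]
  · have h : ofTable (certII i).table ∈ (tableII i).algebras := by
      rw [ofTable_eq_sum _ (by revert i; decide +kernel) (by revert i; decide +kernel)]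
      fin_cases i <;> first
        | exact absurd (by decide) hi'
        | exact absurd rfl hi
        | simp [certII, tableII, add_assoc]
    intro ν hν
    fin_cases i <;> first
      | exact absurd rfl hi
      | exact absurd (by decide) hi'
      | exact (Set.mem_singleton_iff.1 h).trans (Set.mem_singleton_iff.1 hν).symm ▸ Iso.refl _

/-- The properties claimed for the algebras of a row. -/
def Row.Spec (r : Row n) : Prop :=
  ∀ ν ∈ r.algebras, ν.IsAssoc ∧ ν ≠ 0 ∧ (∃ μ : AlgSpace n, μ.Iso ν ∧ μ.IsAssoc ∧ μ.IsCritical) ∧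
    (∀ μ : AlgSpace n, μ.Iso ν → μ.IsCritical → μ.HasType r.type ∧ μ.F = r.value)

/-- One critical representative suffices, because value and type agree for all critical points in an
isomorphism class. -/
theorem row_spec_of_critical {r : Row n} (h : ∀ ν ∈ r.algebras,
    ∃ μ : AlgSpace n, μ.Iso ν ∧ μ.IsAssoc ∧ μ.IsCritical ∧ μ.HasType r.type ∧ μ.F = r.value) : r.Spec := by
  intro ν hν
  obtain ⟨μ, hiso, ha, hc, ht, hF⟩ := h ν hν
  refine ⟨hiso.isAssoc ha, hiso.ne_zero hc.1, ⟨μ, hiso, ha, hc⟩, fun μ' hiso' hc' => ?_⟩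
  have e := hiso.trans hiso'.symm
  exact ⟨hc.hasType_of_iso hc' e ht, (hc.F_eq_of_iso hc' e).symm.trans hF⟩

theorem Cert.OK.spec {r : Cert n} (h : r.OK) : (ofTable r.table).IsAssoc ∧ (ofTable r.table).IsCritical ∧
    (ofTable r.table).HasType r.type ∧ (ofTable r.table).F = r.num / r.den :=
  ⟨h.1.isAssoc h.2.2.2.2.2, h.1.isCritical h.2.1, h.1.hasType h.2.1,
    h.1.F_eq h.2.2.2.1 h.2.2.1 h.2.2.2.2.1⟩

theorem tableI_spec (i : Fin 6) : (tableI i).Spec := by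
  refine row_spec_of_critical fun ν hν => ⟨_, certI_iso i ν hν, ?_⟩
  rw [← certI_type, ← certI_value]
  exact (certI_ok i).spec

theorem smul_psi_add_smul_psi_apply (x y : ℂ) (i j k : Fin 3) :
    (x • psi 3 1 2 + y • psi 3 2 1 : AlgSpace 3) (i, j, k) =
      if k = 2 then if i = 0 ∧ j = 1 then x else if i = 1 ∧ j = 0 then y else 0 else 0 := by
  fin_cases i <;> fin_cases j <;> fin_cases k <;> simp [psi]

/-- Every member is critical as it stands: the diagonal of M_μ is proportional to s = ‖x‖² + ‖y‖²,
so the ratio of the parameters affects neither type nor value. -/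
theorem bilinear_row_spec : (tableII 20).Spec := by
  refine row_spec_of_critical fun ν hν => ?_
  obtain ⟨x, y, hxy, rfl⟩ := hν
  have hs : 0 < ‖x‖ ^ 2 + ‖y‖ ^ 2 := by
    by_contra! h
    refine hxy ?_
    have hx : ‖x‖ ^ 2 = 0 := by nlinarith [sq_nonneg ‖x‖, sq_nonneg ‖y‖]
    have hy : ‖y‖ ^ 2 = 0 := by nlinarith [sq_nonneg ‖x‖, sq_nonneg ‖y‖]
    simpa using And.intro hx hy
  have hap := smul_psi_add_smul_psi_apply x y
  set μ : AlgSpace 3 := x • psi 3 1 2 + y • psi 3 2 1 with hμ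
  have h0 : μ ≠ 0 := by
    intro h
    refine hxy (Prod.ext ?_ ?_)
    · simpa [h] using (hap 0 1 2).symm
    · simpa [h] using (hap 1 0 2).symm
  have hm : μ.IsMonomial := by
    refine ⟨?_, ?_, ?_⟩ <;> intro i j a b hab <;> rw [hap, hap] <;> grind
  have hd : ∀ a, μ.momentDiag a = -6 * (‖x‖ ^ 2 + ‖y‖ ^ 2) +
      4 * (‖x‖ ^ 2 + ‖y‖ ^ 2) * (![1, 1, 2] : Fin 3 → ℤ) a := by
    intro a
    fin_cases a <;> simp [momentDiag, hap, Fin.sum_univ_three] <;> ring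
  have hκ : ∀ i j k, μ (i, j, k) ≠ 0 → (![1, 1, 2] : Fin 3 → ℤ) k =
      (![1, 1, 2] : Fin 3 → ℤ) i + (![1, 1, 2] : Fin 3 → ℤ) j := by
    intro i j k
    rw [hap]
    fin_cases i <;> fin_cases j <;> fin_cases k <;> simp
  refine ⟨μ, Iso.refl μ, ?_, hm.isCritical h0 hd hκ,
    hm.hasType (by positivity) hd hκ (by decide) (by decide), ?_⟩
  · intro X Y Z
    ext k
    fin_cases k <;> simp [hμ, add_mul_apply, smul_mul_apply, mul_psi]
  · have h := hm.F_eq h0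
    simp only [hd, Fin.sum_univ_three] at h
    have h2 : (‖x‖ ^ 2 + ‖y‖ ^ 2) ^ 2 ≠ 0 := by positivity
    refine mul_right_cancel₀ h2 ?_
    change μ.F * _ = 12 * _
    have e0 : (((![1, 1, 2] : Fin 3 → ℤ) 0 : ℤ) : ℝ) = 1 := by simp
    have e1 : (((![1, 1, 2] : Fin 3 → ℤ) 1 : ℤ) : ℝ) = 1 := by simp
    have e2 : (((![1, 1, 2] : Fin 3 → ℤ) 2 : ℤ) : ℝ) = 2 := by simp
    rw [e0, e1, e2] at h
    linear_combination h / 4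

theorem tableII_spec (i : Fin 21) : (tableII i).Spec := by
  by_cases hi : i = 20
  · rw [hi]
    exact bilinear_row_spec
  refine row_spec_of_critical fun ν hν => ⟨_, certII_iso hi ν hν, ?_⟩
  rw [← certII_type, ← certII_value]
  exact (certII_ok i).spec

/-! ### The algebra d_21 has no critical point in its orbit. -/

theorem isAssoc_d21 : d21.IsAssoc := by
  intro X Y Z
  ext k
  fin_cases k <;> simp [d21, add_mul_apply, sub_mul_apply, mul_psi]

theorem d21_ne_zero : d21 ≠ 0 := by
  intro h
  have := congrArg (fun μ : AlgSpace 3 => μ (0, 0, 2)) h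
  simp [d21, psi] at this

/-- The algebra `d_21` with the order of the basis reversed. -/
noncomputable def d21Rev : AlgSpace 3 := psi 1 3 3 + psi 1 3 2 - psi 1 2 3

theorem d21Rev_apply (i j k : Fin 3) : d21Rev (i, j, k) = if k = 0 then if i = 2 ∧ j = 2 then 1 else
    if i = 2 ∧ j = 1 then 1 else if i = 1 ∧ j = 2 then -1 else 0 else 0 := by
  fin_cases i <;> fin_cases j <;> fin_cases k <;> simp [d21Rev, psi]

theorem d21Rev_iso : d21Rev.Iso d21 := by
  refine iso_of_basis !![0, 0, 1; 0, 1, 0; 1, 0, 0] !![0, 0, 1; 0, 1, 0; 1, 0, 0] ?_ fun i j => ?_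
  · ext i j
    fin_cases i <;> fin_cases j <;> simp [Matrix.mul_apply, Fin.sum_univ_three]
  · ext k
    fin_cases i <;> fin_cases j <;> fin_cases k <;>
      simp [d21, d21Rev_apply, add_mul_apply, sub_mul_apply, mul_psi, Matrix.mulVec, dotProduct]

/-- Let D = M_ν - cI be a derivation. The symmetric entry a gives D_00 = 2D_22, the skew entries ±b
give D_00 = D_11 + D_22, and the off-diagonal entries of D cancel by skewness. So M_ν has equal last
two diagonal entries, but these differ by 4‖a‖². -/
theorem not_isCritical_of_apply {ν : AlgSpace 3} {a b : ℂ} (ha : a ≠ 0) (hb : b ≠ 0)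
    (h : ∀ i j k, ν (i, j, k) = if k = 0 then if i = 2 ∧ j = 2 then a else
      if i = 2 ∧ j = 1 then b else if i = 1 ∧ j = 2 then -b else 0 else 0) : ¬ ν.IsCritical := by
  rw [isCritical_iff]
  rintro ⟨-, c, hc⟩
  rw [isDer_iff] at hc
  have e : ∀ i j k, infAct (ν.momentMatrix - (c : ℂ) • 1) ν (i, j, k) = 0 := fun i j k => by
    rw [hc]
    rfl
  have h22 := e 2 2 0
  have h21 := e 2 1 0
  have h12 := e 1 2 0
  simp [infAct_apply, Fin.sum_univ_three, h] at h22 h21 h12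
  have e1 : ν.momentMatrix 1 1 = ν.momentMatrix 2 2 := by
    have k1 : a * (ν.momentMatrix 0 0 - c - 2 * (ν.momentMatrix 2 2 - c)) = 0 := by
      linear_combination h22
    have k2 : b * (ν.momentMatrix 0 0 - c - (ν.momentMatrix 1 1 - c) -
        (ν.momentMatrix 2 2 - c)) = 0 := by
      linear_combination (h21 - h12) / 2
    have k1' := (mul_eq_zero.1 k1).resolve_left ha
    have k2' := (mul_eq_zero.1 k2).resolve_left hb
    linear_combination k1' - k2'
  rw [momentMatrix_apply_self, momentMatrix_apply_self, Complex.ofReal_inj] at e1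
  simp [momentDiag, Fin.sum_univ_three, h] at e1
  have : ‖a‖ ^ 2 = 0 := by linarith
  exact ha (by simpa using this)

theorem not_isCritical_of_iso_d21 {μ : AlgSpace 3} (h : μ.Iso d21) : ¬ μ.IsCritical := by
  intro hμ
  obtain ⟨g, hg, rfl⟩ := (d21Rev_iso.trans h.symm).exists_act
  obtain ⟨q, p, hq, hp, rfl⟩ := exists_unitary_mul_upperTriangular g
  have hq' := mul_eq_one_comm.1 hq
  have hp' : IsUnit p := by
    have h2 : p = qᴴ * (q * p) := by rw [← mul_assoc, hq', one_mul]
    rw [h2]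
    exact (IsUnit.of_mul_eq_one _ hq').mul hg
  have hqq : qᴴ * qᴴᴴ = 1 := by rwa [Matrix.conjTranspose_conjTranspose]
  have hc := isCritical_act hqq hμ
  rw [← act_mul, ← mul_assoc, hq', one_mul] at hc
  have hi := inv_upperTriangular hp' hp
  have hdiag : ∀ i, p i i * p⁻¹ i i = 1 := by
    intro i
    have hd := Matrix.mul_nonsing_inv p ((Matrix.isUnit_iff_isUnit_det p).1 hp')
    have := congrFun (congrFun hd i) i
    rw [Matrix.mul_apply, Finset.sum_eq_single i, Matrix.one_apply_eq] at this
    · exact this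
    · intro j _ hj
      rcases lt_or_gt_of_ne hj with h | h
      · rw [hp _ _ h, zero_mul]
      · rw [hi _ _ h, mul_zero]
    · simp
  have n1 : ∀ i, p i i ≠ 0 := fun i => left_ne_zero_of_mul_eq_one (hdiag i)
  have n2 : ∀ i, p⁻¹ i i ≠ 0 := fun i => right_ne_zero_of_mul_eq_one (hdiag i)
  -- In the reversed basis a triangular p preserves the shape of the structure constants: the mixed
  -- terms in e_3e_3 cancel by skewness, so only diagonal entries of p and p⁻¹ survive.
  refine not_isCritical_of_apply (a := p 0 0 * (p⁻¹ 2 2 * p⁻¹ 2 2))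
    (b := p 0 0 * (p⁻¹ 2 2 * p⁻¹ 1 1)) (mul_ne_zero (n1 0) (mul_ne_zero (n2 2) (n2 2)))
    (mul_ne_zero (n1 0) (mul_ne_zero (n2 2) (n2 1))) (fun i j k => ?_) hc
  have e1 := hp 1 0 (by decide)
  have e2 := hp 2 0 (by decide)
  have i1 := hi 1 0 (by decide)
  have i2 := hi 2 0 (by decide)
  have i3 := hi 2 1 (by decide)
  rw [act_apply]
  fin_cases i <;> fin_cases j <;> fin_cases k <;>
    simp [d21Rev_apply, Fin.sum_univ_three, e1, e2, i1, i2, i3, mul_comm]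

end AlgSpace

/-! ### Isomorphism invariants separating the rows. -/

namespace AlgSpace

variable {n : ℕ}

/-- The product is commutative. -/
def IsComm (μ : AlgSpace n) : Prop := ∀ X Y, μ.mul X Y = μ.mul Y X

theorem Iso.isComm {μ ν : AlgSpace n} (h : μ.Iso ν) (hμ : μ.IsComm) : ν.IsComm := by
  obtain ⟨φ, hφ⟩ := h.symm
  intro X Y
  apply φ.injective
  rw [hφ, hφ, hμ]

theorem Iso.isComm_iff {μ ν : AlgSpace n} (h : μ.Iso ν) : μ.IsComm ↔ ν.IsComm :=
  ⟨h.isComm, h.symm.isComm⟩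

theorem Iso.finrank_ker_mulLin {μ ν : AlgSpace n} (h : μ.Iso ν) :
    Module.finrank ℂ (LinearMap.ker μ.mulLin) = Module.finrank ℂ (LinearMap.ker ν.mulLin) := by
  obtain ⟨φ, hφ⟩ := h
  have : (LinearMap.ker μ.mulLin).map (φ : (Fin n → ℂ) →ₗ[ℂ] (Fin n → ℂ)) =
      LinearMap.ker ν.mulLin := by
    ext X
    rw [Submodule.mem_map_equiv, LinearMap.mem_ker, LinearMap.mem_ker]
    constructor
    · intro hX
      refine LinearMap.ext fun Y => ?_
      have := congrArg φ (LinearMap.congr_fun hX (φ.symm Y))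
      simpa [mulLin_apply, hφ] using this
    · intro hX
      refine LinearMap.ext fun Y => ?_
      apply φ.injective
      have := LinearMap.congr_fun hX (φ Y)
      simpa [mulLin_apply, hφ] using this
  rw [← this]
  exact (LinearEquiv.finrank_map_eq φ _).symm

theorem Iso.finrank_ker_mulLin_flip {μ ν : AlgSpace n} (h : μ.Iso ν) :
    Module.finrank ℂ (LinearMap.ker μ.mulLin.flip) =
      Module.finrank ℂ (LinearMap.ker ν.mulLin.flip) := by
  obtain ⟨φ, hφ⟩ := h
  have : (LinearMap.ker μ.mulLin.flip).map (φ : (Fin n → ℂ) →ₗ[ℂ] (Fin n → ℂ)) =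
      LinearMap.ker ν.mulLin.flip := by
    ext X
    rw [Submodule.mem_map_equiv, LinearMap.mem_ker, LinearMap.mem_ker]
    constructor
    · intro hX
      refine LinearMap.ext fun Y => ?_
      have := congrArg φ (LinearMap.congr_fun hX (φ.symm Y))
      simpa [mulLin_apply, hφ] using this
    · intro hX
      refine LinearMap.ext fun Y => ?_
      apply φ.injective
      have := LinearMap.congr_fun hX (φ Y)
      simpa [mulLin_apply, hφ] using this
  rw [← this]
  exact (LinearEquiv.finrank_map_eq φ _).symm

theorem finrank_vanishing (S : Finset (Fin n)) {W : Submodule ℂ (Fin n → ℂ)}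
    (h : ∀ X, X ∈ W ↔ ∀ i ∈ S, X i = 0) : Module.finrank ℂ W = n - S.card := by
  have hW : W = LinearMap.ker (LinearMap.funLeft ℂ ℂ (Subtype.val : S → Fin n)) := by
    ext X
    rw [h, LinearMap.mem_ker, funext_iff]
    simp [LinearMap.funLeft_apply]
  have h1 := LinearMap.finrank_range_add_finrank_ker
    (LinearMap.funLeft ℂ ℂ (Subtype.val : S → Fin n))
  rw [LinearMap.range_eq_top.2
    (LinearMap.funLeft_surjective_of_injective ℂ ℂ _ Subtype.val_injective), finrank_top] at h1
  simp only [Module.finrank_fintype_fun_eq_card, Fintype.card_coe, Fintype.card_fin] at h1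
  rw [hW]
  omega

/-- The basis vectors with a nonzero left multiplication. -/
def leftSupport (l : WTable n) : Finset (Fin n) :=
  Finset.univ.filter fun i => ∃ j k, wt l i j k ≠ 0

/-- The basis vectors with a nonzero right multiplication. -/
def rightSupport (l : WTable n) : Finset (Fin n) :=
  Finset.univ.filter fun i => ∃ j k, wt l j i k ≠ 0

/-- For a monomial table the annihilator is a coordinate subspace: a coefficient of X times a basis
vector involves at most one coordinate of X. -/
theorem TableOK.finrank_ker_mulLin {l : WTable n} (h : TableOK l) :
    Module.finrank ℂ (LinearMap.ker (ofTable l).mulLin) = n - (leftSupport l).card := by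
  refine finrank_vanishing _ fun X => ?_
  rw [LinearMap.mem_ker]
  simp only [leftSupport, Finset.mem_filter, Finset.mem_univ, true_and]
  constructor
  · rintro hX i ⟨j, k, hw⟩
    have h1 := congrFun (LinearMap.congr_fun hX (Pi.single j 1)) k
    simp only [mulLin_apply, mul, Pi.single_apply, mul_ite, mul_one, mul_zero, ite_mul, zero_mul,
      Finset.sum_ite_eq', Finset.mem_univ, if_true, LinearMap.zero_apply, Pi.zero_apply] at h1
    rw [Finset.sum_eq_single i] at h1
    · refine (mul_eq_zero.1 h1).resolve_right ?_
      rwa [ofTable_eq_zero_iff]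
    · intro b _ hb
      rw [(ofTable_eq_zero_iff l b j k).2 ((h.2.2.1 j k b i hb).resolve_right hw), mul_zero]
    · simp
  · intro hX
    refine LinearMap.ext fun Y => ?_
    ext k
    simp only [mulLin_apply, mul, LinearMap.zero_apply, Pi.zero_apply]
    refine Finset.sum_eq_zero fun i _ => Finset.sum_eq_zero fun j _ => ?_
    by_cases hw : wt l i j k = 0
    · rw [(ofTable_eq_zero_iff l i j k).2 hw, mul_zero]
    · rw [hX i ⟨j, k, hw⟩, zero_mul, zero_mul]

theorem TableOK.finrank_ker_mulLin_flip {l : WTable n} (h : TableOK l) :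
    Module.finrank ℂ (LinearMap.ker (ofTable l).mulLin.flip) = n - (rightSupport l).card := by
  refine finrank_vanishing _ fun X => ?_
  rw [LinearMap.mem_ker]
  simp only [rightSupport, Finset.mem_filter, Finset.mem_univ, true_and]
  constructor
  · rintro hX i ⟨j, k, hw⟩
    have h1 := congrFun (LinearMap.congr_fun hX (Pi.single j 1)) k
    simp only [LinearMap.flip_apply, mulLin_apply, mul, Pi.single_apply, ite_mul, one_mul, zero_mul,
      Finset.sum_ite_irrel, Finset.sum_const_zero, Finset.sum_ite_eq', Finset.mem_univ, if_true,
      LinearMap.zero_apply, Pi.zero_apply] at h1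
    rw [Finset.sum_eq_single i] at h1
    · refine (mul_eq_zero.1 h1).resolve_right ?_
      rwa [ofTable_eq_zero_iff]
    · intro b _ hb
      rw [(ofTable_eq_zero_iff l j b k).2 ((h.2.1 j k b i hb).resolve_right hw), mul_zero]
    · simp
  · intro hX
    refine LinearMap.ext fun Y => ?_
    ext k
    simp only [LinearMap.flip_apply, mulLin_apply, mul, LinearMap.zero_apply, Pi.zero_apply]
    refine Finset.sum_eq_zero fun i _ => Finset.sum_eq_zero fun j _ => ?_
    by_cases hw : wt l i j k = 0
    · rw [(ofTable_eq_zero_iff l i j k).2 hw, mul_zero]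
    · rw [hX j ⟨i, k, hw⟩, mul_zero, zero_mul]

theorem isComm_ofTable_iff (l : WTable n) :
    (ofTable l).IsComm ↔ ∀ i j k, wt l i j k = wt l j i k := by
  constructor
  · intro h i j k
    have := congrFun (h (Pi.single i 1) (Pi.single j 1)) k
    simp only [mul_single_single] at this
    rw [ofTable_apply, ofTable_apply, Complex.ofReal_inj,
      Real.sqrt_inj (by positivity) (by positivity)] at this
    exact_mod_cast this
  · intro h X Y
    ext k
    simp only [mul]
    rw [Finset.sum_comm]
    refine Finset.sum_congr rfl fun i _ => Finset.sum_congr rfl fun j _ => ?_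
    rw [ofTable_apply, ofTable_apply, h i j k]
    ring

/-- The isomorphism invariants that tell the rows apart: the critical value, the dimensions of the
two annihilators and commutativity. -/
def Cert.SameInvariants (r s : Cert n) : Prop :=
  r.num * s.den = s.num * r.den ∧ (leftSupport r.table).card = (leftSupport s.table).card ∧
    (rightSupport r.table).card = (rightSupport s.table).card ∧
    ((∀ i j k, wt r.table i j k = wt r.table j i k) ↔
      ∀ i j k, wt s.table i j k = wt s.table j i k)

instance (r s : Cert n) : Decidable (r.SameInvariants s) := by
  unfold Cert.SameInvariants
  infer_instance

theorem Cert.OK.sameInvariants {r s : Cert n} (hr : r.OK) (hs : s.OK)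
    (h : (ofTable r.table).Iso (ofTable s.table)) : r.SameInvariants s := by
  have card_le : ∀ S : Finset (Fin n), S.card ≤ n := fun S => by
    simpa using Finset.card_le_univ S
  refine ⟨?_, ?_, ?_, ?_⟩
  · have h1 := hr.spec.2.1.F_eq_of_iso hs.spec.2.1 h
    rw [hr.spec.2.2.2, hs.spec.2.2.2, div_eq_div_iff (by exact_mod_cast hr.2.2.2.1)
      (by exact_mod_cast hs.2.2.2.1)] at h1
    exact_mod_cast h1
  · have h1 := h.finrank_ker_mulLin
    rw [hr.1.finrank_ker_mulLin, hs.1.finrank_ker_mulLin] at h1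
    have := card_le (leftSupport r.table)
    have := card_le (leftSupport s.table)
    omega
  · have h1 := h.finrank_ker_mulLin_flip
    rw [hr.1.finrank_ker_mulLin_flip, hs.1.finrank_ker_mulLin_flip] at h1
    have := card_le (rightSupport r.table)
    have := card_le (rightSupport s.table)
    omega
  · rw [← isComm_ofTable_iff, ← isComm_ofTable_iff]
    exact h.isComm_iff

theorem certI_injective : ∀ i j, (certI i).SameInvariants (certI j) → i = j := by
  decide +kernel

theorem certII_injective : ∀ i j, (certII i).SameInvariants (certII j) → i = j := by
  decide +kernel

/-- The value 12 occurs in no other row, which separates the family d_22 without comparing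
annihilators of its members. -/
theorem certII_value_injective :
    ∀ i, (certII 20).num * (certII i).den = (certII i).num * (certII 20).den → i = 20 := by
  decide +kernel

theorem tableI_row_unique {i j : Fin 6} {μ ν : AlgSpace 2} (hμ : μ ∈ (tableI i).algebras)
    (hν : ν ∈ (tableI j).algebras) (h : μ.Iso ν) : i = j :=
  certI_injective i j ((certI_ok i).sameInvariants (certI_ok j)
    (((certI_iso i μ hμ).trans h).trans (certI_iso j ν hν).symm))

theorem tableII_value_eq {i j : Fin 21} {μ ν : AlgSpace 3} (hμ : μ ∈ (tableII i).algebras)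
    (hν : ν ∈ (tableII j).algebras) (h : μ.Iso ν) :
    (certII i).num * (certII j).den = (certII j).num * (certII i).den := by
  obtain ⟨-, -, ⟨κ, hκ, -, hc⟩, h1⟩ := tableII_spec i μ hμ
  have h2 := (h1 κ hκ hc).2
  have h3 := ((tableII_spec j ν hν).2.2.2 κ (hκ.trans h) hc).2
  rw [h2, ← certII_value, ← certII_value, div_eq_div_iff
    (by exact_mod_cast (certII_ok i).2.2.2.1) (by exact_mod_cast (certII_ok j).2.2.2.1)] at h3
  exact_mod_cast h3

theorem tableII_row_unique {i j : Fin 21} {μ ν : AlgSpace 3} (hμ : μ ∈ (tableII i).algebras)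
    (hν : ν ∈ (tableII j).algebras) (h : μ.Iso ν) : i = j := by
  by_cases hi : i = 20
  · subst hi
    exact (certII_value_injective j (tableII_value_eq hμ hν h)).symm
  by_cases hj : j = 20
  · subst hj
    exact absurd (certII_value_injective i (tableII_value_eq hν hμ h.symm)) hi
  exact certII_injective i j ((certII_ok i).sameInvariants (certII_ok j)
    (((certII_iso hi μ hμ).trans h).trans (certII_iso hj ν hν).symm))

section Models

variable {A : Type*} [NonUnitalRing A] [Module ℂ A]

theorem IsModelOf.iso {μ ν : AlgSpace n} (hμ : μ.IsModelOf A) (hν : ν.IsModelOf A) : μ.Iso ν := by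
  obtain ⟨φ, hφ⟩ := hμ
  obtain ⟨ψ, hψ⟩ := hν
  refine ⟨φ.symm.trans ψ, fun X Y => ?_⟩
  have : φ.symm (μ.mul X Y) = φ.symm X * φ.symm Y := by
    rw [LinearEquiv.symm_apply_eq, hφ]
    simp
  simp [this, hψ]

theorem IsModelOf.of_iso {μ ν : AlgSpace n} (hμ : μ.IsModelOf A) (h : μ.Iso ν) : ν.IsModelOf A := by
  obtain ⟨φ, hφ⟩ := hμ
  obtain ⟨ψ, hψ⟩ := h
  exact ⟨φ.trans ψ, fun X Y => by simp [hφ, hψ]⟩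

end Models

end AlgSpace

/-! ### Nilpotent endomorphisms. -/

namespace AlgSpace

section LinearAlgebra

variable {V : Type*} [AddCommGroup V] [Module ℂ V]

theorem linearIndependent_pow_apply {T : Module.End ℂ V} (hT : IsNilpotent T) :
    ∀ (k : ℕ) (v : V), (T ^ k) v ≠ 0 → LinearIndependent ℂ fun i : Fin (k + 1) => (T ^ (i : ℕ)) v
  | 0, v, hv => by
    have : (fun i : Fin 1 => (T ^ (i : ℕ)) v) = fun _ => v := by
      funext i
      simp [Subsingleton.elim i 0]
    rw [this]
    exact LinearIndependent.of_subsingleton (ι := Fin 1) 0 (by simpa using hv)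
  | k + 1, v, hv => by
    have hv' : (T ^ k) (T v) ≠ 0 := by rwa [pow_succ] at hv
    rw [linearIndependent_finSucc]
    have e : Fin.tail (fun i : Fin (k + 1 + 1) => (T ^ (i : ℕ)) v) =
        fun i : Fin (k + 1) => (T ^ (i : ℕ)) (T v) := by
      funext i
      simp [Fin.tail, pow_succ]
    rw [e]
    refine ⟨linearIndependent_pow_apply hT k (T v) hv', fun hmem => ?_⟩
    obtain ⟨c, hc⟩ := (Submodule.mem_span_range_iff_exists_fun ℂ).1 hmem
    -- A dependence of v on its images Tv, T²v, … reads v = STv with S a polynomial in T. Then ST is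
    -- nilpotent and fixes v, so v = 0.
    set S : Module.End ℂ V := ∑ i, c i • T ^ (i : ℕ) with hS
    have hcomm : Commute S T :=
      Commute.sum_left _ _ _ fun i _ => ((Commute.refl T).pow_left _).smul_left _
    have hnil : IsNilpotent (S * T) := hcomm.isNilpotent_mul_left hT
    have hfix : (S * T) v = v := by
      simpa [hS, LinearMap.sum_apply] using hc
    obtain ⟨m, hm⟩ := hnil
    have hpow : ∀ m : ℕ, ((S * T) ^ m) v = v := by
      intro m
      induction m with
      | zero => simp
      | succ m ih => rw [pow_succ, Module.End.mul_apply, hfix, ih]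
    have hv0 : v = 0 := by
      rw [← hpow m, hm]
      rfl
    rw [hv0, map_zero] at hv
    exact hv rfl

theorem eq_zero_of_isNilpotent_of_apply_eq_smul {T : Module.End ℂ V} (hT : IsNilpotent T) {v : V}
    {c : ℂ} (h : T v = c • v) (hv : v ≠ 0) : c = 0 := by
  obtain ⟨m, hm⟩ := hT
  have hpow : ∀ m : ℕ, (T ^ m) v = c ^ m • v := by
    intro m
    induction m with
    | zero => simp
    | succ m ih => rw [pow_succ, Module.End.mul_apply, h, map_smul, ih, smul_smul, pow_succ']
  have := hpow m
  rw [hm, LinearMap.zero_apply, eq_comm, smul_eq_zero] at this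
  exact eq_zero_of_pow_eq_zero (this.resolve_right hv)

theorem pow_finrank_apply_eq_zero [FiniteDimensional ℂ V] {T : Module.End ℂ V} (hT : IsNilpotent T)
    {n : ℕ} (hn : Module.finrank ℂ V = n) (v : V) : (T ^ n) v = 0 := by
  by_contra h
  have := (linearIndependent_pow_apply hT n v h).fintype_card_le_finrank
  simp [hn] at this

/-- A family of nilpotent endomorphisms that is closed under composition kills a nonzero vector of
every nonzero stable subspace. -/
theorem exists_common_kernel [FiniteDimensional ℂ V] {A : Type*} [AddCommGroup A] [Module ℂ A]
    (T : A →ₗ[ℂ] Module.End ℂ V) (hmul : ∀ a b, ∃ c, T a * T b = T c)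
    (hnil : ∀ a, IsNilpotent (T a)) {W : Submodule ℂ V} (hW : W ≠ ⊥)
    (hst : ∀ a, ∀ z ∈ W, T a z ∈ W) : ∃ z ∈ W, z ≠ 0 ∧ ∀ a, T a z = 0 := by
  -- In a minimal nonzero stable subspace I, the images of some z ≠ 0 form a stable subspace, which
  -- is 0 or I. If it is I, some operator fixes z, contradicting nilpotency.
  obtain ⟨I, ⟨hI0, hIW, hIst⟩, hmin⟩ := (wellFounded_lt (α := Submodule ℂ V)).has_min
    {I | I ≠ ⊥ ∧ I ≤ W ∧ ∀ a, ∀ z ∈ I, T a z ∈ I} ⟨W, hW, le_rfl, hst⟩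
  obtain ⟨z, hzI, hz0⟩ := (Submodule.ne_bot_iff I).1 hI0
  refine ⟨z, hIW hzI, hz0, ?_⟩
  by_contra! hne
  let J : Submodule ℂ V := LinearMap.range (T.flip z)
  have hJ : ∀ x, x ∈ J ↔ ∃ a, T a z = x := fun x => Iff.rfl
  have hJI : J ≤ I := by
    intro x hx
    obtain ⟨a, rfl⟩ := (hJ x).1 hx
    exact hIst a z hzI
  have hJ0 : J ≠ ⊥ := by
    obtain ⟨a, ha⟩ := hne
    exact (Submodule.ne_bot_iff J).2 ⟨_, (hJ _).2 ⟨a, rfl⟩, ha⟩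
  have hJst : ∀ a, ∀ x ∈ J, T a x ∈ J := by
    intro a x hx
    obtain ⟨b, rfl⟩ := (hJ x).1 hx
    obtain ⟨c, hc⟩ := hmul a b
    exact (hJ _).2 ⟨c, by rw [← hc]; rfl⟩
  have hJeq : J = I := by
    by_contra h
    exact hmin J ⟨hJ0, hJI.trans hIW, hJst⟩ (lt_of_le_of_ne hJI h)
  obtain ⟨a, ha⟩ := (hJ z).1 (hJeq ▸ hzI)
  have := eq_zero_of_isNilpotent_of_apply_eq_smul (hnil a) (c := 1) (by rw [ha, one_smul]) hz0
  exact one_ne_zero this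

theorem linearIndependent_three {x y z : V} : LinearIndependent ℂ ![x, y, z] ↔
    ∀ a b c : ℂ, a • x + b • y + c • z = 0 → a = 0 ∧ b = 0 ∧ c = 0 := by
  rw [Fintype.linearIndependent_iff]
  constructor
  · intro h a b c habc
    have := h ![a, b, c] (by simpa [Fin.sum_univ_three] using habc)
    exact ⟨this 0, this 1, this 2⟩
  · intro h g hg
    obtain ⟨h0, h1, h2⟩ := h (g 0) (g 1) (g 2) (by simpa [Fin.sum_univ_three] using hg)
    intro i
    fin_cases i <;> assumption

theorem exists_eq_three (hV : Module.finrank ℂ V = 3) {x y z : V}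
    (h : LinearIndependent ℂ ![x, y, z]) (v : V) : ∃ a b c : ℂ, v = a • x + b • y + c • z := by
  have : FiniteDimensional ℂ V := FiniteDimensional.of_finrank_pos (by omega)
  have hspan := h.span_eq_top_of_card_eq_finrank (by simp [hV])
  have hv : v ∈ Submodule.span ℂ (Set.range ![x, y, z]) := hspan ▸ Submodule.mem_top
  obtain ⟨c, hc⟩ := (Submodule.mem_span_range_iff_exists_fun ℂ).1 hv
  exact ⟨c 0, c 1, c 2, by simpa [Fin.sum_univ_three] using hc.symm⟩

theorem exists_eq_two (hV : Module.finrank ℂ V = 2) {x y : V}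
    (h : LinearIndependent ℂ ![x, y]) (v : V) : ∃ a b : ℂ, v = a • x + b • y := by
  have : FiniteDimensional ℂ V := FiniteDimensional.of_finrank_pos (by omega)
  have hspan := h.span_eq_top_of_card_eq_finrank (by simp [hV])
  have hv : v ∈ Submodule.span ℂ (Set.range ![x, y]) := hspan ▸ Submodule.mem_top
  obtain ⟨c, hc⟩ := (Submodule.mem_span_range_iff_exists_fun ℂ).1 hv
  exact ⟨c 0, c 1, by simpa [Fin.sum_univ_two] using hc.symm⟩

end LinearAlgebra

/-! ### Idempotents, Peirce decompositions and annihilators. -/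

section Algebras

variable {A : Type*} [NonUnitalRing A] [Module ℂ A] [IsScalarTower ℂ A A] [SMulCommClass ℂ A A]

theorem isModelOf_of_table {n : ℕ} [NeZero n] (hn : Module.finrank ℂ A = n) {v : Fin n → A}
    (hv : LinearIndependent ℂ v) {μ : AlgSpace n}
    (h : ∀ i j, v i * v j = ∑ k, μ (i, j, k) • v k) : μ.IsModelOf A := by
  let b := basisOfLinearIndependentOfCardEqFinrank hv (by simp [hn])
  have hb : ∀ X, b.equivFun.symm X = ∑ i, X i • v i := fun X => by
    simp [b, Module.Basis.equivFun_symm_apply]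
  have key : (LinearMap.mul ℂ A).compl₁₂ (b.equivFun.symm : (Fin n → ℂ) →ₗ[ℂ] A)
      (b.equivFun.symm : (Fin n → ℂ) →ₗ[ℂ] A) =
      μ.mulLin.compr₂ (b.equivFun.symm : (Fin n → ℂ) →ₗ[ℂ] A) := by
    refine bilin_ext fun i j => ?_
    simp [LinearMap.compl₁₂_apply, LinearMap.compr₂_apply, hb, mulLin_apply, mul_single_single, h,
      Pi.single_apply]
  refine ⟨b.equivFun, fun x y => ?_⟩
  have := LinearMap.congr_fun (LinearMap.congr_fun key (b.equivFun x)) (b.equivFun y)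
  simp only [LinearMap.compl₁₂_apply, LinearMap.compr₂_apply, LinearEquiv.coe_coe,
    LinearEquiv.symm_apply_apply, LinearMap.mul_apply', mulLin_apply] at this
  rw [this, LinearEquiv.apply_symm_apply]

/-- A non-nilpotent element of a finite-dimensional algebra yields a nonzero idempotent. -/
theorem exists_idempotent_of_not_isNilpotent [FiniteDimensional ℂ A] {x : A}
    (hx : ¬ IsNilpotent (LinearMap.mulLeft ℂ x)) :
    ∃ f : A, f ≠ 0 ∧ f * f = f ∧ ∃ S : Module.End ℂ A, S x = f ∧ (∀ z, f * z = S (x * z)) ∧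
      ∀ z, f * z = x * S z := by
  set T : Module.End ℂ A := LinearMap.mulLeft ℂ x with hT
  have hp0 : minpoly ℂ T ≠ 0 := minpoly.ne_zero (Algebra.IsIntegral.isIntegral T)
  obtain ⟨r, hr, hXr⟩ := Polynomial.exists_eq_pow_rootMultiplicity_mul_and_not_dvd
    (minpoly ℂ T) hp0 0
  set m := (minpoly ℂ T).rootMultiplicity 0 with hm
  rw [C_0, sub_zero] at hr hXr
  -- Fitting decomposition through the minimal polynomial X^m r. The exponent m + 1 leaves one
  -- factor X to be played by x itself, as the algebra need not have a unit: the idempotent is s(T)x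
  -- with s = aX^m, and its left multiplication is (Xs)(T).
  have hcop : IsCoprime (X ^ (m + 1)) r :=
    (((Polynomial.irreducible_X (R := ℂ)).coprime_iff_not_dvd).2 hXr).pow_left
  obtain ⟨a, b, hab⟩ := hcop
  have hzero : aeval T (X ^ m * r) = 0 := by
    rw [← hr]
    exact minpoly.aeval ℂ T
  obtain ⟨s, hs⟩ : ∃ s : ℂ[X], s = a * X ^ m := ⟨_, rfl⟩
  set f : A := aeval T s x with hf
  have hL : ∀ q : ℂ[X], ∀ z, aeval T q x * z = aeval T q (x * z) := by
    intro q z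
    induction q using Polynomial.induction_on' with
    | add p q hp hq => simp only [map_add, LinearMap.add_apply, add_mul, hp, hq]
    | monomial k c =>
      have : ∀ k : ℕ, (T ^ k) x * z = (T ^ k) (x * z) := by
        intro k
        induction k with
        | zero => simp
        | succ k ih =>
          rw [pow_succ', Module.End.mul_apply, Module.End.mul_apply, ← ih, hT,
            LinearMap.mulLeft_apply, LinearMap.mulLeft_apply, mul_assoc]
      simp only [aeval_monomial, Module.algebraMap_end_eq_smul_id, Module.End.mul_apply,
        LinearMap.smul_apply, LinearMap.id_apply]
      rw [smul_mul_assoc, this]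
  have hxs : ∀ q : ℂ[X], ∀ z, aeval T q (x * z) = x * aeval T q z := by
    intro q z
    have h1 : aeval T (q * X) z = aeval T q (x * z) := by simp [hT]
    have h2 : aeval T (X * q) z = x * aeval T q z := by simp [hT]
    rw [← h1, mul_comm, h2]
  have hXs : X * s = 1 - b * r := by
    rw [hs]
    linear_combination hab
  refine ⟨f, ?_, ?_, aeval T s, rfl, hL s, fun z => by rw [hf, hL, hxs]⟩
  · intro h0
    apply hx
    refine ⟨m, ?_⟩
    have h1 : aeval T (X * s) = 0 := by
      ext z
      have := hL s z
      rw [← hf, h0, zero_mul, hxs] at this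
      simpa [hT] using this.symm
    -- Both terms vanish at T, the first because f = 0 and the second by the minimal polynomial, so
    -- T would be nilpotent.
    have h2 : (X : ℂ[X]) ^ m = X ^ m * (X * s) + b * (X ^ m * r) := by
      rw [hXs]
      ring
    have h3 := congrArg (aeval T) h2
    rw [map_add, map_mul, h1, map_mul, hzero, mul_zero, mul_zero, add_zero, map_pow, aeval_X] at h3
    exact h3
  · have h1 : f * f = aeval T (X * s * s) x := by
      have : aeval T (X * s * s) x = x * aeval T s (aeval T s x) := by
        rw [mul_assoc, map_mul, map_mul, aeval_X]
        rfl
      rw [this, hf, hL, hxs]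
    have h2 : X * s * s = s - a * b * (X ^ m * r) := by
      rw [hXs, hs]
      ring
    rw [h1, h2, map_sub, map_mul _ (a * b), hzero, mul_zero, sub_zero]

/-- A primitive idempotent. -/
structure IsPrimitive (e : A) : Prop where
  ne_zero : e ≠ 0
  idem : e * e = e
  eq_of_le : ∀ f, f * f = f → e * f = f → f * e = f → f = 0 ∨ f = e

theorem exists_isPrimitive [FiniteDimensional ℂ A] {e : A} (he0 : e ≠ 0) (he : e * e = e) :
    ∃ f : A, IsPrimitive f := by
  let R : A → Submodule ℂ A := fun f =>
    LinearMap.range (LinearMap.mulLeft ℂ f ∘ₗ LinearMap.mulRight ℂ f)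
  have hR : ∀ f x, x ∈ R f ↔ ∃ y, f * (y * f) = x := fun f x => Iff.rfl
  -- A nonzero idempotent f with fAf minimal is primitive: a nonzero idempotent g below f has gAg ⊆
  -- fAf, and equality puts f in gAg, whence f = g.
  obtain ⟨_, ⟨f, ⟨hf0, hf⟩, rfl⟩, hmin⟩ := (wellFounded_lt (α := Submodule ℂ A)).has_min
    (R '' {f | f ≠ 0 ∧ f * f = f}) ⟨_, e, ⟨he0, he⟩, rfl⟩
  refine ⟨f, hf0, hf, fun g hg hfg hgf => ?_⟩
  by_contra! hne
  refine hmin (R g) ⟨g, ⟨hne.1, hg⟩, rfl⟩ (lt_of_le_of_ne ?_ fun hEq => hne.2 ?_)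
  · rintro x hx
    obtain ⟨y, rfl⟩ := (hR g x).1 hx
    refine (hR f _).2 ⟨g * (y * g), ?_⟩
    rw [mul_assoc g, mul_assoc y, hgf, ← mul_assoc f, hfg]
  · have hmem : f ∈ R g := by
      rw [hEq]
      exact (hR f f).2 ⟨f, by rw [hf, hf]⟩
    obtain ⟨y, hy⟩ := (hR g f).1 hmem
    have : f * g = f := by
      rw [← hy, mul_assoc, mul_assoc, hg]
    rw [← hfg, this]

/-- The corner eAe is local. Take for c an eigenvalue of x on eA, with eigenvector z. If x - ce were
not nilpotent, the idempotent it generates would lie in eAe, hence be e, although it kills z = ez.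
-/
theorem IsPrimitive.exists_isNilpotent_sub [FiniteDimensional ℂ A] {e : A} (he : IsPrimitive e)
    {x : A} (hex : e * x = x) (hxe : x * e = x) :
    ∃ c : ℂ, IsNilpotent (LinearMap.mulLeft ℂ (x - c • e)) := by
  let W : Submodule ℂ A := LinearMap.range (LinearMap.mulLeft ℂ e)
  have hW : ∀ z, z ∈ W ↔ e * z = z := by
    intro z
    constructor
    · rintro ⟨y, rfl⟩
      rw [LinearMap.mulLeft_apply, ← mul_assoc, he.idem]
    · exact fun h => ⟨z, h⟩
  have hst : ∀ z ∈ W, LinearMap.mulLeft ℂ x z ∈ W := by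
    intro z _
    rw [hW, LinearMap.mulLeft_apply, ← mul_assoc, hex]
  have : Nontrivial W :=
    ⟨⟨⟨e, (hW e).2 he.idem⟩, 0, fun h => he.ne_zero (congrArg Subtype.val h)⟩⟩
  obtain ⟨c, hc⟩ := Module.End.exists_eigenvalue ((LinearMap.mulLeft ℂ x).restrict hst)
  obtain ⟨⟨z, hzW⟩, hz⟩ := hc.exists_hasEigenvector
  have hz0 : z ≠ 0 := fun h => hz.2 (Subtype.ext h)
  have hxz : x * z = c • z := congrArg Subtype.val hz.apply_eq_smul
  have hez := (hW z).1 hzW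
  refine ⟨c, ?_⟩
  by_contra hnil
  obtain ⟨f, hf0, hff, S, hSf, hfS, hfS'⟩ := exists_idempotent_of_not_isNilpotent hnil
  set y := x - c • e with hy
  have hey : e * y = y := by rw [hy, mul_sub, hex, mul_smul_comm, he.idem]
  have hye : y * e = y := by rw [hy, sub_mul, hxe, smul_mul_assoc, he.idem]
  have hef : e * f = f := by
    rw [← hff, hfS', ← mul_assoc, hey]
  have hfe : f * e = f := by rw [hfS, hye, hSf]
  have hfz : f * z = 0 := by
    rw [hfS, hy, sub_mul, hxz, smul_mul_assoc, hez, sub_self, map_zero]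
  rcases he.eq_of_le f hff hef hfe with h | h
  · exact hf0 h
  · rw [h, hez] at hfz
    exact hz0 hfz

/-- A basis that starts with a given idempotent and consists of vectors that are homogeneous for its
Peirce decomposition. -/
theorem exists_peirce_basis {n : ℕ} (hn : Module.finrank ℂ A = n + 1) {e : A} (he0 : e ≠ 0)
    (he : e * e = e) : ∃ v : Fin (n + 1) → A, LinearIndependent ℂ v ∧ v 0 = e ∧
      ∀ i, (e * v i = v i ∨ e * v i = 0) ∧ (v i * e = v i ∨ v i * e = 0) := by
  have : FiniteDimensional ℂ A := FiniteDimensional.of_finrank_pos (by omega)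
  let H : Set A := {x | (e * x = x ∨ e * x = 0) ∧ (x * e = x ∨ x * e = 0)}
  have hee : ∀ x, e * (e * x) = e * x := fun x => by rw [← mul_assoc, he]
  have hee' : ∀ x, x * e * e = x * e := fun x => by rw [mul_assoc, he]
  have hspan : ⊤ ≤ Submodule.span ℂ H := by
    intro x _
    -- The four Peirce components of x.
    have e1 : x = e * x * e + (e * x - e * x * e) + (x * e - e * x * e)
        + (x - e * x - x * e + e * x * e) := by abel
    rw [e1]
    refine add_mem (add_mem (add_mem ?_ ?_) ?_) ?_ <;> refine Submodule.subset_span ⟨?_, ?_⟩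
    · left; simp only [← mul_assoc, he]
    · left; simp only [hee']
    · left; simp only [mul_sub, ← mul_assoc, he]
    · right; simp only [sub_mul, hee', sub_self]
    · right; simp only [mul_sub, ← mul_assoc, he, sub_self]
    · left; simp only [sub_mul, hee']
    · right; simp only [mul_sub, mul_add, ← mul_assoc, he]; abel
    · right; simp only [sub_mul, add_mul, hee']; abel
  have hs : LinearIndepOn ℂ id ({e} : Set A) := LinearIndepOn.singleton he0
  have hsH : ({e} : Set A) ⊆ H := by
    rintro _ rfl
    exact ⟨Or.inl he, Or.inl he⟩
  let b := Module.Basis.extendLe hs hsH hspan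
  have hcard : Nat.card (hs.extend hsH) = n + 1 := by
    rw [← hn, Module.finrank_eq_nat_card_basis b]
  have hfin : Finite (hs.extend hsH) := Nat.finite_of_card_ne_zero (by omega)
  let σ : hs.extend hsH ≃ Fin (n + 1) := Finite.equivFinOfCardEq hcard
  let e' : hs.extend hsH := ⟨e, hs.subset_extend hsH rfl⟩
  let τ := σ.trans (Equiv.swap (σ e') 0)
  refine ⟨fun i => b (τ.symm i), b.linearIndependent.comp _ τ.symm.injective, ?_, fun i => ?_⟩
  · have : τ.symm 0 = e' := by
      rw [Equiv.symm_apply_eq]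
      simp [τ]
    change b (τ.symm 0) = e
    rw [this]
    exact Module.Basis.extendLe_apply_self hs hsH hspan e'
  · have : b (τ.symm i) = (τ.symm i : A) := Module.Basis.extendLe_apply_self hs hsH hspan _
    change b (τ.symm i) ∈ H
    rw [this]
    exact hs.extend_subset hsH (τ.symm i).2

theorem pow_mulRight_apply (a y : A) (k : ℕ) :
    (LinearMap.mulRight ℂ a ^ (k + 1)) y = y * (LinearMap.mulLeft ℂ a ^ k) a := by
  induction k generalizing y with
  | zero => simp
  | succ k ih =>
    rw [pow_succ, Module.End.mul_apply, ih, LinearMap.mulRight_apply, mul_assoc, pow_succ',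
      Module.End.mul_apply, LinearMap.mulLeft_apply]

/-- A nonzero finite-dimensional nil algebra has a nonzero two-sided annihilator. -/
theorem exists_annihilator [FiniteDimensional ℂ A] [Nontrivial A]
    (hnil : ∀ x : A, IsNilpotent (LinearMap.mulLeft ℂ x)) :
    ∃ z : A, z ≠ 0 ∧ (∀ a, a * z = 0) ∧ ∀ a, z * a = 0 := by
  have hnil' : ∀ x : A, IsNilpotent (LinearMap.mulRight ℂ x) := by
    intro x
    obtain ⟨k, hk⟩ := hnil x
    refine ⟨k + 1, ?_⟩
    ext y
    rw [pow_mulRight_apply, hk]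
    simp
  let L : A →ₗ[ℂ] Module.End ℂ A := LinearMap.mul ℂ A
  let R : A →ₗ[ℂ] Module.End ℂ A := (LinearMap.mul ℂ A).flip
  obtain ⟨z₀, -, hz₀, hz₀'⟩ := exists_common_kernel L
    (fun a b => ⟨a * b, by ext y; simp [L, mul_assoc]⟩) hnil (W := ⊤) top_ne_bot
    (fun _ _ _ => Submodule.mem_top)
  -- The vectors killed by all left multiplications form a nonzero subspace stable under right
  -- multiplications, inside which the same argument is run again.
  let W : Submodule ℂ A := LinearMap.ker (LinearMap.mul ℂ A).flip
  have hW : ∀ z, z ∈ W ↔ ∀ a, a * z = 0 := by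
    intro z
    rw [LinearMap.mem_ker, LinearMap.ext_iff]
    rfl
  have hW0 : W ≠ ⊥ := (Submodule.ne_bot_iff W).2 ⟨z₀, (hW z₀).2 hz₀', hz₀⟩
  obtain ⟨z, hzW, hz0, hz⟩ := exists_common_kernel R
    (fun a b => ⟨b * a, by ext y; simp [R, mul_assoc]⟩) hnil' hW0
    (fun a z hz => (hW _).2 fun b => by
      change b * (z * a) = 0
      rw [← mul_assoc, (hW z).1 hz b, zero_mul])
  exact ⟨z, hz0, (hW z).1 hzW, hz⟩

end Algebras

end AlgSpace

/-! ### Elementary changes of a basis of three vectors. -/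

namespace AlgSpace

section LinearAlgebra

variable {V : Type*} [AddCommGroup V] [Module ℂ V] {x y z : V}

theorem li_rotate (h : LinearIndependent ℂ ![x, y, z]) : LinearIndependent ℂ ![y, z, x] := by
  rw [linearIndependent_three] at h ⊢
  intro a b c habc
  obtain ⟨h1, h2, h3⟩ := h c a b (by rw [← habc]; abel)
  exact ⟨h2, h3, h1⟩

theorem li_swap (h : LinearIndependent ℂ ![x, y, z]) : LinearIndependent ℂ ![y, x, z] := by
  rw [linearIndependent_three] at h ⊢
  intro a b c habc
  obtain ⟨h1, h2, h3⟩ := h b a c (by rw [← habc]; abel)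
  exact ⟨h2, h1, h3⟩

theorem li_swap' (h : LinearIndependent ℂ ![x, y, z]) : LinearIndependent ℂ ![x, z, y] :=
  li_swap (li_rotate (li_rotate h))

theorem li_smul (h : LinearIndependent ℂ ![x, y, z]) {c : ℂ} (hc : c ≠ 0) :
    LinearIndependent ℂ ![c • x, y, z] := by
  rw [linearIndependent_three] at h ⊢
  intro a b d habc
  obtain ⟨h1, h2, h3⟩ := h (a * c) b d (by rw [← habc, smul_smul])
  exact ⟨(mul_eq_zero.1 h1).resolve_right hc, h2, h3⟩

theorem li_add (h : LinearIndependent ℂ ![x, y, z]) (t : ℂ) :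
    LinearIndependent ℂ ![x + t • y, y, z] := by
  rw [linearIndependent_three] at h ⊢
  intro a b c habc
  obtain ⟨h1, h2, h3⟩ := h a (a * t + b) c (by rw [← habc]; module)
  refine ⟨h1, ?_, h3⟩
  simpa [h1] using h2

end LinearAlgebra

/-- The algebra occurs among the rows for `n = 3` or is isomorphic to `d_21`. -/
def Classified (A : Type*) [NonUnitalRing A] [Module ℂ A] : Prop :=
  d21.IsModelOf A ∨ ∃ i, ∃ ν ∈ (tableII i).algebras, ν.IsModelOf A

variable {A : Type*} [NonUnitalRing A] [Module ℂ A] [IsScalarTower ℂ A A] [SMulCommClass ℂ A A]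

theorem isModelOf_three (hA : Module.finrank ℂ A = 3) {x y z : A}
    (h : LinearIndependent ℂ ![x, y, z]) {μ : AlgSpace 3}
    (hmul : ∀ i j, ![x, y, z] i * ![x, y, z] j =
      μ (i, j, 0) • x + μ (i, j, 1) • y + μ (i, j, 2) • z) : μ.IsModelOf A :=
  isModelOf_of_table hA h fun i j => by simpa [Fin.sum_univ_three] using hmul i j

theorem isModelOf_two (hA : Module.finrank ℂ A = 2) {x y : A}
    (h : LinearIndependent ℂ ![x, y]) {μ : AlgSpace 2}
    (hmul : ∀ i j, ![x, y] i * ![x, y] j = μ (i, j, 0) • x + μ (i, j, 1) • y) :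
    μ.IsModelOf A :=
  isModelOf_of_table hA h fun i j => by simpa [Fin.sum_univ_two] using hmul i j

/-! ### Nil algebras of dimension three. -/

section Nilpotent

/-- Algebras given by a bilinear form with an isotropic second basis vector. -/
theorem classified_of_isotropic (hA : Module.finrank ℂ A = 3) {x y z : A}
    (h : LinearIndependent ℂ ![x, y, z]) (hz : ∀ a, a * z = 0) (hz' : ∀ a, z * a = 0) {α β γ : ℂ}
    (hxx : x * x = α • z) (hxy : x * y = β • z) (hyx : y * x = γ • z) (hyy : y * y = 0)
    (hne : α ≠ 0 ∨ β ≠ 0 ∨ γ ≠ 0) : Classified A := by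
  -- When the symmetric part couples x and y, the vector x can be made isotropic too, giving d_22.
  -- When it does not, the parameters lead to d_15, a skew member of d_22, or d_21.
  by_cases hs : β + γ = 0
  · have hγ : γ = -β := by linear_combination hs
    subst hγ
    by_cases hβ : β = 0
    · subst hβ
      have hα : α ≠ 0 := by simpa using hne
      refine Or.inr ⟨14, _, rfl, isModelOf_three hA
        (x := x) (y := α • z) (z := y) ?_ fun i j => ?_⟩
      · exact li_swap (li_smul (li_rotate (li_rotate h)) hα)
      · fin_cases i <;> fin_cases j <;>
          simp [psi, hz, hz', hxx, hxy, hyx, hyy, mul_smul_comm, smul_mul_assoc]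
    · by_cases hα : α = 0
      · subst hα
        refine Or.inr ⟨20, _, ⟨β, -β, by simpa using hβ, rfl⟩, isModelOf_three hA h fun i j => ?_⟩
        fin_cases i <;> fin_cases j <;> simp [psi, hz, hz', hxx, hxy, hyx, hyy]
      -- Rescaling y and z brings both α and β to 1.
      · refine Or.inl (isModelOf_three hA (x := x) (y := (α / β) • y) (z := α • z) ?_
          fun i j => ?_)
        · exact li_rotate (li_smul (li_rotate (li_rotate (li_rotate
            (li_rotate (li_smul (li_rotate h) (div_ne_zero hα hβ)))))) hα)
        · fin_cases i <;> fin_cases j <;>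
            simp [d21, psi, hz, hz', hxx, hxy, hyx, hyy, mul_smul_comm, smul_mul_assoc, smul_smul,
              div_mul_cancel₀ _ hβ]
  · refine Or.inr ⟨20, _, ⟨β, γ, ?_, rfl⟩, isModelOf_three hA
      (li_add h (-(α / (β + γ)))) fun i j => ?_⟩
    · intro h0
      obtain ⟨rfl, rfl⟩ := Prod.mk.inj h0
      simp at hs
    · have hxx' : (x + -(α / (β + γ)) • y) * (x + -(α / (β + γ)) • y) = 0 := by
        simp only [add_mul, mul_add, smul_mul_assoc, mul_smul_comm, hxx, hxy, hyx, hyy, smul_zero,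
          smul_smul, add_zero, ← add_smul]
        rw [show α + -(α / (β + γ)) * γ + -(α / (β + γ)) * β = 0 by field_simp; ring, zero_smul]
      have hxy' : (x + -(α / (β + γ)) • y) * y = β • z := by
        simp [add_mul, smul_mul_assoc, hxy, hyy]
      have hyx' : y * (x + -(α / (β + γ)) • y) = γ • z := by
        simp [mul_add, mul_smul_comm, hyx, hyy]
      generalize x + -(α / (β + γ)) • y = x' at hxx' hxy' hyx' ⊢
      fin_cases i <;> fin_cases j <;> simp [psi, hz, hz', hxx', hxy', hyx', hyy]

/-- A quadratic form on a plane over ℂ has an isotropic vector. If y is not one, x + ty is, for t a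
root of δt² + (β + γ)t + α, and it takes the second place in the basis. -/
theorem classified_of_form (hA : Module.finrank ℂ A = 3) {x y z : A}
    (h : LinearIndependent ℂ ![x, y, z]) (hz : ∀ a, a * z = 0) (hz' : ∀ a, z * a = 0)
    {α β γ δ : ℂ} (hxx : x * x = α • z) (hxy : x * y = β • z) (hyx : y * x = γ • z)
    (hyy : y * y = δ • z) (hne : ∃ a b : A, a * b ≠ 0) : Classified A := by
  by_cases hδ : δ = 0
  · refine classified_of_isotropic hA h hz hz' hxx hxy hyx (by rw [hyy, hδ, zero_smul]) ?_
    by_contra! h0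
    obtain ⟨a, b, hab⟩ := hne
    obtain ⟨a1, a2, a3, rfl⟩ := exists_eq_three hA h a
    obtain ⟨b1, b2, b3, rfl⟩ := exists_eq_three hA h b
    apply hab
    simp [add_mul, mul_add, smul_mul_assoc, mul_smul_comm, hz, hz', hxx, hxy, hyx, hyy, h0, hδ]
  · obtain ⟨t, ht⟩ := exists_quadratic_eq_zero (a := δ) (b := β + γ) (c := α) hδ
      (IsAlgClosed.exists_pow_nat_eq (discrim δ (β + γ) α) zero_lt_two |>.imp
        fun s hs => by rw [← hs, sq])
    refine classified_of_isotropic hA (x := y) (y := x + t • y) (α := δ) (β := γ + t * δ)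
      (γ := β + t * δ) (li_swap (li_add h t)) hz hz' hyy ?_ ?_ ?_ (Or.inl hδ)
    · simp [mul_add, mul_smul_comm, hyx, hyy, add_smul, smul_smul]
    · simp [add_mul, smul_mul_assoc, hxy, hyy, add_smul, smul_smul]
    · simp only [add_mul, mul_add, smul_mul_assoc, mul_smul_comm, hxx, hxy, hyx, hyy,
        smul_smul, ← add_smul]
      rw [show α + t * γ + (t * β + t * (t * δ)) = 0 by linear_combination ht, zero_smul]

theorem exists_complement (hA : Module.finrank ℂ A = 3) {z : A} (hz : z ≠ 0) :
    ∃ x y : A, LinearIndependent ℂ ![x, y, z] := by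
  have : FiniteDimensional ℂ A := FiniteDimensional.of_finrank_pos (by omega)
  have hs : LinearIndepOn ℂ id ({z} : Set A) := LinearIndepOn.singleton hz
  obtain ⟨x, hx⟩ : ∃ x, x ∉ Submodule.span ℂ {z} := by
    by_contra! h
    have h1 : Submodule.span ℂ {z} = ⊤ := Submodule.eq_top_iff'.2 h
    have h2 := finrank_span_singleton (K := ℂ) hz
    rw [h1, finrank_top, hA] at h2
    omega
  have h2 : LinearIndependent ℂ ![x, z] := by
    rw [LinearIndependent.pair_symm_iff, LinearIndependent.pair_iff' hz]
    exact fun a ha => hx (Submodule.mem_span_singleton.2 ⟨a, ha⟩)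
  obtain ⟨y, hy⟩ : ∃ y, y ∉ Submodule.span ℂ (Set.range ![x, z]) := by
    by_contra! h
    have h1 : Submodule.span ℂ (Set.range ![x, z]) = ⊤ := Submodule.eq_top_iff'.2 h
    have h3 := finrank_span_eq_card h2
    rw [h1, finrank_top, hA] at h3
    simp at h3
  exact ⟨y, x, linearIndependent_finCons.2 ⟨h2, hy⟩⟩

/-- A nonzero cube gives the basis x, x², x³ of d_16. Otherwise, with z in the annihilator, a square
outside ℂz gives the basis x, x², z of d_15. If all squares lie in ℂz, then all products do, and a
bilinear form remains. -/
theorem classified_of_nil (hA : Module.finrank ℂ A = 3) (hne : ∃ a b : A, a * b ≠ 0)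
    (hnil : ∀ x : A, IsNilpotent (LinearMap.mulLeft ℂ x)) : Classified A := by
  have : FiniteDimensional ℂ A := FiniteDimensional.of_finrank_pos (by omega)
  have : Nontrivial A := Module.nontrivial_of_finrank_pos (R := ℂ) (by omega)
  by_cases hcube : ∃ x : A, x * (x * x) ≠ 0
  · obtain ⟨x, hx⟩ := hcube
    have h4 : x * (x * (x * x)) = 0 := by
      simpa [pow_succ] using pow_finrank_apply_eq_zero (hnil x) hA x
    have hli := linearIndependent_pow_apply (hnil x) 2 x (by simpa [pow_succ] using hx)
    have hli' : LinearIndependent ℂ ![x, x * x, x * (x * x)] := by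
      have e : ![x, x * x, x * (x * x)] =
          fun i : Fin 3 => (LinearMap.mulLeft ℂ x ^ (i : ℕ)) x := by
        funext i
        fin_cases i <;> simp [pow_succ]
      rw [e]
      exact hli
    refine Or.inr ⟨15, _, rfl, isModelOf_three hA hli' fun i j => ?_⟩
    fin_cases i <;> fin_cases j <;> simp [psi, mul_assoc, h4]
  push Not at hcube
  obtain ⟨z, hz0, hz, hz'⟩ := exists_annihilator hnil
  by_cases hsq : ∃ x : A, x * x ∉ Submodule.span ℂ {z}
  · obtain ⟨x, hx⟩ := hsq
    have hli : LinearIndependent ℂ ![x, x * x, z] := by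
      rw [linearIndependent_three]
      intro a b c habc
      have h1 := congrArg (x * ·) habc
      simp only [mul_add, mul_smul_comm, hcube, hz, smul_zero, add_zero, mul_zero] at h1
      have hxx : x * x ≠ 0 := fun h0 => hx (h0 ▸ Submodule.zero_mem _)
      have ha : a = 0 := (smul_eq_zero.1 h1).resolve_right hxx
      rw [ha, zero_smul, zero_add] at habc
      have hb : b = 0 := by
        by_contra hb
        refine hx (Submodule.mem_span_singleton.2 ⟨-(b⁻¹ * c), ?_⟩)
        have : b • (x * x) = -(c • z) := eq_neg_of_add_eq_zero_left habc
        rw [neg_smul, mul_smul, ← smul_neg, ← this, smul_smul, inv_mul_cancel₀ hb, one_smul]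
      rw [hb, zero_smul, zero_add] at habc
      exact ⟨ha, hb, (smul_eq_zero.1 habc).resolve_right hz0⟩
    refine Or.inr ⟨14, _, rfl, isModelOf_three hA hli fun i j => ?_⟩
    fin_cases i <;> fin_cases j <;> simp [psi, mul_assoc, hcube, hz, hz']
  push Not at hsq
  have hsq' : ∀ x : A, ∃ c : ℂ, x * x = c • z := fun x =>
    (Submodule.mem_span_singleton.1 (hsq x)).imp fun c hc => hc.symm
  obtain ⟨x, y, hli⟩ := exists_complement hA hz0
  obtain ⟨α, hxx⟩ := hsq' x
  obtain ⟨δ, hyy⟩ := hsq' y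
  obtain ⟨σ, hσ⟩ := hsq' (x + y)
  have hxy : ∃ β : ℂ, x * y = β • z := by
    obtain ⟨a, b, c, habc⟩ := exists_eq_three hA hli (x * y)
    -- Multiplying xy = ax + by + cz by x on the left and by y on the right kills the left side, as
    -- x² and y² lie in ℂz. Either relation puts xy into ℂz unless its leading coefficient vanishes.
    have h1 : a • (x * x) + b • (x * y) = 0 := by
      have : x * (x * y) = 0 := by rw [← mul_assoc, hxx, smul_mul_assoc, hz', smul_zero]
      rw [← this]
      conv_rhs => rw [habc]
      simp only [mul_add, mul_smul_comm, hz, smul_zero, add_zero]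
    have h2 : a • (x * y) + b • (y * y) = 0 := by
      have : (x * y) * y = 0 := by rw [mul_assoc, hyy, mul_smul_comm, hz, smul_zero]
      rw [← this]
      conv_rhs => rw [habc]
      simp only [add_mul, smul_mul_assoc, hz', smul_zero, add_zero]
    rw [hxx] at h1
    rw [hyy] at h2
    by_cases hb : b = 0
    · by_cases ha : a = 0
      · exact ⟨c, by rw [habc, ha, hb]; simp⟩
      · refine ⟨-(a⁻¹ * (b * δ)), ?_⟩
        have : a • (x * y) = -((b * δ) • z) := by
          rw [mul_smul]
          exact eq_neg_of_add_eq_zero_left h2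
        rw [neg_smul, mul_smul, ← smul_neg, ← this, smul_smul, inv_mul_cancel₀ ha, one_smul]
    · refine ⟨-(b⁻¹ * (a * α)), ?_⟩
      have : b • (x * y) = -((a * α) • z) := by
        rw [mul_smul]
        exact eq_neg_of_add_eq_zero_right h1
      rw [neg_smul, mul_smul, ← smul_neg, ← this, smul_smul, inv_mul_cancel₀ hb, one_smul]
  obtain ⟨β, hβ⟩ := hxy
  refine classified_of_form hA hli hz hz' (γ := σ - α - β - δ) hxx hβ ?_ hyy hne
  rw [add_mul, mul_add, mul_add, hxx, hyy, hβ] at hσ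
  rw [sub_smul, sub_smul, sub_smul, ← hσ]
  abel

end Nilpotent

end AlgSpace

namespace AlgSpace

variable {A : Type*} [NonUnitalRing A] [Module ℂ A]

/-! ### Algebras of dimension three with a primitive idempotent. -/

section Peirce

theorem mul_eq_zero_of_left {e x y : A} (hx : x * e = x) (hy : e * y = 0) : x * y = 0 := by
  rw [← hx, mul_assoc, hy, mul_zero]

theorem mul_eq_zero_of_right {e x y : A} (hx : x * e = 0) (hy : e * y = y) : x * y = 0 := by
  rw [← hy, ← mul_assoc, hx, zero_mul]

theorem eq_zero_of_smul_smul_eq_zero {b : ℂ} {u : A} (hu : u ≠ 0) (h : b • b • u = 0) : b = 0 := by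
  simpa [hu] using h

variable [IsScalarTower ℂ A A] [SMulCommClass ℂ A A]

/-- Coordinates of a vector that is homogeneous for the Peirce decomposition, in a homogeneous
basis. -/
theorem exists_peirce_coords (hA : Module.finrank ℂ A = 3) {e u w : A}
    (hli : LinearIndependent ℂ ![e, u, w]) (he : e * e = e) {l₁ r₁ l₂ r₂ l r : ℂ}
    (hu : e * u = l₁ • u) (hu' : u * e = r₁ • u) (hw : e * w = l₂ • w) (hw' : w * e = r₂ • w)
    {x : A} (hx : e * x = l • x) (hx' : x * e = r • x) :
    ∃ a b c : ℂ, x = a • e + b • u + c • w ∧ ((a = 0 ∨ 1 = l) ∧ (a = 0 ∨ 1 = r)) ∧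
      ((b = 0 ∨ l₁ = l) ∧ (b = 0 ∨ r₁ = r)) ∧ (c = 0 ∨ l₂ = l) ∧ (c = 0 ∨ r₂ = r) := by
  obtain ⟨a, b, c, rfl⟩ := exists_eq_three hA hli x
  rw [linearIndependent_three] at hli
  have aux : ∀ s t t' : ℂ, s * (t - t') = 0 → s = 0 ∨ t = t' := fun s t t' h =>
    (mul_eq_zero.1 h).imp_right sub_eq_zero.1
  simp only [mul_add, add_mul, mul_smul_comm, smul_mul_assoc, he, hu, hu', hw, hw'] at hx hx'
  obtain ⟨h1, h2, h3⟩ := hli (a * (1 - l)) (b * (l₁ - l)) (c * (l₂ - l)) (by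
    rw [← sub_eq_zero] at hx
    rw [← hx]
    module)
  obtain ⟨h1', h2', h3'⟩ := hli (a * (1 - r)) (b * (r₁ - r)) (c * (r₂ - r)) (by
    rw [← sub_eq_zero] at hx'
    rw [← hx']
    module)
  exact ⟨a, b, c, rfl, ⟨aux _ _ _ h1, aux _ _ _ h1'⟩, ⟨aux _ _ _ h2, aux _ _ _ h2'⟩,
    aux _ _ _ h3, aux _ _ _ h3'⟩

theorem linearIndependent_one_self_sq {e x : A} (hxe : x * e = x)
    (hx : IsNilpotent (LinearMap.mulLeft ℂ x)) (hxx : x * x ≠ 0) :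
    LinearIndependent ℂ ![e, x, x * x] := by
  have h := linearIndependent_pow_apply hx 2 e (by simpa [pow_succ, hxe] using hxx)
  have e1 : ![e, x, x * x] = fun i : Fin 3 => (LinearMap.mulLeft ℂ x ^ (i : ℕ)) e := by
    funext i
    fin_cases i <;> simp [pow_succ, hxe]
  rw [e1]
  exact h

/-- Because eAe is local, a vector of the unital corner becomes nilpotent after subtracting a
multiple of e. -/
theorem IsPrimitive.exists_shift [FiniteDimensional ℂ A] {e u w : A} (he : IsPrimitive e)
    (hli : LinearIndependent ℂ ![e, u, w]) (heu : e * u = u) (hue : u * e = u) :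
    ∃ x, LinearIndependent ℂ ![e, x, w] ∧ e * x = x ∧ x * e = x ∧
      IsNilpotent (LinearMap.mulLeft ℂ x) := by
  obtain ⟨c, hc⟩ := he.exists_isNilpotent_sub heu hue
  refine ⟨u - c • e, ?_, ?_, ?_, hc⟩
  · have := li_swap (li_add (li_swap hli) (-c))
    rwa [neg_smul, ← sub_eq_add_neg] at this
  · rw [mul_sub, mul_smul_comm, heu, he.idem]
  · rw [sub_mul, smul_mul_assoc, hue, he.idem]

/-- If x² ≠ 0, then e, x, x² span A and e is a two-sided unit, which w contradicts. -/
theorem sq_eq_zero_of_isNilpotent (hA : Module.finrank ℂ A = 3) {e x w : A} (he : e * e = e)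
    (hex : e * x = x) (hxe : x * e = x) (hx : IsNilpotent (LinearMap.mulLeft ℂ x)) (hw : w ≠ 0)
    (hew : e * w = 0 ∨ w * e = 0) : x * x = 0 := by
  by_contra hxx
  obtain ⟨a, b, c, rfl⟩ := exists_eq_three hA (linearIndependent_one_self_sq hxe hx hxx) w
  have h1 : e * (x * x) = x * x := by rw [← mul_assoc, hex]
  have h2 : (x * x) * e = x * x := by rw [mul_assoc, hxe]
  rcases hew with h | h
  · apply hw
    simpa only [mul_add, mul_smul_comm, he, hex, h1] using h
  · apply hw
    simpa only [add_mul, smul_mul_assoc, he, hxe, h2] using h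

/-- Normalization of a basis vector that spans a Peirce component. -/
theorem exists_normalized {e u w : A} (hli : LinearIndependent ℂ ![e, u, w]) (hew : e * w = 0)
    (hwe : w * e = 0) (hww : ∃ c : ℂ, w * w = c • w) :
    ∃ x, LinearIndependent ℂ ![e, u, x] ∧ e * x = 0 ∧ x * e = 0 ∧ (x * x = 0 ∨ x * x = x) := by
  obtain ⟨c, hc⟩ := hww
  by_cases h0 : c = 0
  · exact ⟨w, hli, hew, hwe, Or.inl (by rw [hc, h0, zero_smul])⟩
  · refine ⟨c⁻¹ • w, li_rotate (li_smul (li_rotate (li_rotate hli)) (inv_ne_zero h0)), ?_, ?_,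
      Or.inr ?_⟩
    · rw [mul_smul_comm, hew, smul_zero]
    · rw [smul_mul_assoc, hwe, smul_zero]
    · rw [mul_smul_comm, smul_mul_assoc, hc, smul_smul c⁻¹ c, inv_mul_cancel₀ h0, one_smul]

variable {e u w : A}

/-- The digits in these names are the eigenvalues of left and right multiplication by e, first on u
and then on w. Here xw lies in ℂw by Peirce type, and x² = 0 makes it vanish. -/
theorem classified_11_10 (hA : Module.finrank ℂ A = 3) (he : IsPrimitive e)
    (hli : LinearIndependent ℂ ![e, u, w]) (heu : e * u = u) (hue : u * e = u) (hew : e * w = w)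
    (hwe : w * e = 0) : Classified A := by
  have : FiniteDimensional ℂ A := FiniteDimensional.of_finrank_pos (by omega)
  obtain ⟨x, hli, hex, hxe, hx⟩ := he.exists_shift hli heu hue
  have hw : w ≠ 0 := hli.ne_zero 2
  have hxx := sq_eq_zero_of_isNilpotent hA he.idem hex hxe hx hw (Or.inr hwe)
  have hwx : w * x = 0 := mul_eq_zero_of_right hwe hex
  have hww : w * w = 0 := mul_eq_zero_of_right hwe hew
  obtain ⟨a, b, c, hxw, h1, h2, h3⟩ := exists_peirce_coords hA hli he.idem (l₁ := 1) (r₁ := 1)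
    (l₂ := 1) (r₂ := 0) (l := 1) (r := 0) (x := x * w) (by simp [hex]) (by simp [hxe])
    (by simp [hew]) (by simp [hwe]) (by simp [← mul_assoc, hex]) (by simp [mul_assoc, hwe])
  obtain rfl : a = 0 := by simpa using h1
  obtain rfl : b = 0 := by simpa using h2
  rw [zero_smul, zero_smul, zero_add, zero_add] at hxw
  obtain rfl : c = 0 := eq_zero_of_smul_smul_eq_zero hw (by
    rw [← hxw, ← mul_smul_comm, ← hxw, ← mul_assoc, hxx, zero_mul])
  -- The square of e + x is (e + x) + x, which accounts for the term ψ_2^{1,1}.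
  refine Or.inr ⟨16, _, rfl, isModelOf_three hA (x := e + x) (y := x) (z := w)
    (by simpa using li_add hli 1) fun i j => ?_⟩
  fin_cases i <;> fin_cases j <;>
    simp [psi, add_mul, mul_add, he.idem, hex, hxe, hew, hwe, hwx, hww, hxx, hxw]

theorem classified_11_01 (hA : Module.finrank ℂ A = 3) (he : IsPrimitive e)
    (hli : LinearIndependent ℂ ![e, u, w]) (heu : e * u = u) (hue : u * e = u) (hew : e * w = 0)
    (hwe : w * e = w) : Classified A := by
  have : FiniteDimensional ℂ A := FiniteDimensional.of_finrank_pos (by omega)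
  obtain ⟨x, hli, hex, hxe, hx⟩ := he.exists_shift hli heu hue
  have hw : w ≠ 0 := hli.ne_zero 2
  have hxx := sq_eq_zero_of_isNilpotent hA he.idem hex hxe hx hw (Or.inl hew)
  have hxw : x * w = 0 := mul_eq_zero_of_left hxe hew
  have hww : w * w = 0 := mul_eq_zero_of_left hwe hew
  obtain ⟨a, b, c, hwx, h1, h2, h3⟩ := exists_peirce_coords hA hli he.idem (l₁ := 1) (r₁ := 1)
    (l₂ := 0) (r₂ := 1) (l := 0) (r := 1) (x := w * x) (by simp [hex]) (by simp [hxe])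
    (by simp [hew]) (by simp [hwe]) (by simp [← mul_assoc, hew]) (by simp [mul_assoc, hxe])
  obtain rfl : a = 0 := by simpa using h1
  obtain rfl : b = 0 := by simpa using h2
  rw [zero_smul, zero_smul, zero_add, zero_add] at hwx
  obtain rfl : c = 0 := eq_zero_of_smul_smul_eq_zero hw (by
    rw [← hwx, ← smul_mul_assoc, ← hwx, mul_assoc, hxx, mul_zero])
  refine Or.inr ⟨8, _, rfl, isModelOf_three hA (li_swap' hli) fun i j => ?_⟩
  fin_cases i <;> fin_cases j <;>
    simp [psi, he.idem, hex, hxe, hew, hwe, hwx, hww, hxx, hxw]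

theorem classified_11_00 (hA : Module.finrank ℂ A = 3) (he : IsPrimitive e)
    (hli : LinearIndependent ℂ ![e, u, w]) (heu : e * u = u) (hue : u * e = u) (hew : e * w = 0)
    (hwe : w * e = 0) : Classified A := by
  have : FiniteDimensional ℂ A := FiniteDimensional.of_finrank_pos (by omega)
  obtain ⟨x, hli, hex, hxe, hx⟩ := he.exists_shift hli heu hue
  have hxx := sq_eq_zero_of_isNilpotent hA he.idem hex hxe hx (hli.ne_zero 2) (Or.inl hew)
  obtain ⟨a, b, c, hww, h1, h2, h3⟩ := exists_peirce_coords hA hli he.idem (l₁ := 1) (r₁ := 1)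
    (l₂ := 0) (r₂ := 0) (l := 0) (r := 0) (x := w * w) (by simp [hex]) (by simp [hxe])
    (by simp [hew]) (by simp [hwe]) (by simp [← mul_assoc, hew]) (by simp [mul_assoc, hwe])
  obtain rfl : a = 0 := by simpa using h1
  obtain rfl : b = 0 := by simpa using h2
  rw [zero_smul, zero_smul, zero_add, zero_add] at hww
  obtain ⟨y, hli, hey, hye, hyy⟩ := exists_normalized hli hew hwe ⟨c, hww⟩
  have hxy : x * y = 0 := mul_eq_zero_of_left hxe hey
  have hyx : y * x = 0 := mul_eq_zero_of_right hye hex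
  rcases hyy with hyy | hyy
  · refine Or.inr ⟨4, _, rfl, isModelOf_three hA (li_swap' hli) fun i j => ?_⟩
    fin_cases i <;> fin_cases j <;> simp [psi, he.idem, hex, hxe, hey, hye, hyy, hxx, hxy, hyx]
  · refine Or.inr ⟨11, _, rfl, isModelOf_three hA (li_rotate (li_rotate hli)) fun i j => ?_⟩
    fin_cases i <;> fin_cases j <;> simp [psi, he.idem, hex, hxe, hey, hye, hyy, hxx, hxy, hyx]

theorem classified_10_10 (hA : Module.finrank ℂ A = 3) (he : IsPrimitive e)
    (hli : LinearIndependent ℂ ![e, u, w]) (heu : e * u = u) (hue : u * e = 0) (hew : e * w = w)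
    (hwe : w * e = 0) : Classified A := by
  refine Or.inr ⟨19, _, rfl, isModelOf_three hA hli fun i j => ?_⟩
  fin_cases i <;> fin_cases j <;> simp [psi, he.idem, heu, hue, hew, hwe,
    mul_eq_zero_of_right hue heu, mul_eq_zero_of_right hue hew, mul_eq_zero_of_right hwe heu,
    mul_eq_zero_of_right hwe hew]

theorem classified_01_01 (hA : Module.finrank ℂ A = 3) (he : IsPrimitive e)
    (hli : LinearIndependent ℂ ![e, u, w]) (heu : e * u = 0) (hue : u * e = u) (hew : e * w = 0)
    (hwe : w * e = w) : Classified A := by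
  refine Or.inr ⟨7, _, rfl, isModelOf_three hA hli fun i j => ?_⟩
  fin_cases i <;> fin_cases j <;> simp [psi, he.idem, heu, hue, hew, hwe,
    mul_eq_zero_of_left hue heu, mul_eq_zero_of_left hue hew, mul_eq_zero_of_left hwe heu,
    mul_eq_zero_of_left hwe hew]

theorem classified_10_01 (hA : Module.finrank ℂ A = 3) (he : IsPrimitive e)
    (hli : LinearIndependent ℂ ![e, u, w]) (heu : e * u = u) (hue : u * e = 0) (hew : e * w = 0)
    (hwe : w * e = w) : Classified A := by
  have huu : u * u = 0 := mul_eq_zero_of_right hue heu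
  have hww : w * w = 0 := mul_eq_zero_of_left hwe hew
  obtain ⟨a, b, c, hwu, h1, h2, h3⟩ := exists_peirce_coords hA hli he.idem (l₁ := 1) (r₁ := 0)
    (l₂ := 0) (r₂ := 1) (l := 0) (r := 0) (x := w * u) (by simp [heu]) (by simp [hue])
    (by simp [hew]) (by simp [hwe]) (by simp [← mul_assoc, hew]) (by simp [mul_assoc, hue])
  obtain rfl : a = 0 := by simpa using h1
  obtain rfl : b = 0 := by simpa using h2
  obtain rfl : c = 0 := by simpa using h3
  simp only [zero_smul, add_zero] at hwu
  obtain ⟨a, b, c, huw, h1, h2, h3⟩ := exists_peirce_coords hA hli he.idem (l₁ := 1) (r₁ := 0)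
    (l₂ := 0) (r₂ := 1) (l := 1) (r := 1) (x := u * w) (by simp [heu]) (by simp [hue])
    (by simp [hew]) (by simp [hwe]) (by simp [← mul_assoc, heu]) (by simp [mul_assoc, hwe])
  obtain rfl : b = 0 := by simpa using h2
  obtain rfl : c = 0 := by simpa using h3
  simp only [zero_smul, add_zero] at huw
  -- The Peirce types allow uw = ae and force wu = 0. Then au = (uw)u = u(wu) = 0.
  obtain rfl : a = 0 := by
    have h : a • u = 0 := by
      rw [← heu, ← smul_mul_assoc, ← huw, mul_assoc, hwu, mul_zero]
    exact (smul_eq_zero.1 h).resolve_right (hli.ne_zero 1)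
  refine Or.inr ⟨6, _, rfl, isModelOf_three hA (li_swap' hli) fun i j => ?_⟩
  fin_cases i <;> fin_cases j <;> simp [psi, he.idem, heu, hue, hew, hwe, huu, hww, hwu, huw]

theorem classified_10_00 (hA : Module.finrank ℂ A = 3) (he : IsPrimitive e)
    (hli : LinearIndependent ℂ ![e, u, w]) (heu : e * u = u) (hue : u * e = 0) (hew : e * w = 0)
    (hwe : w * e = 0) : Classified A := by
  have huu : u * u = 0 := mul_eq_zero_of_right hue heu
  have hu : u ≠ 0 := hli.ne_zero 1
  obtain ⟨a, b, c, hww, h1, h2, h3⟩ := exists_peirce_coords hA hli he.idem (l₁ := 1) (r₁ := 0)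
    (l₂ := 0) (r₂ := 0) (l := 0) (r := 0) (x := w * w) (by simp [heu]) (by simp [hue])
    (by simp [hew]) (by simp [hwe]) (by simp [← mul_assoc, hew]) (by simp [mul_assoc, hwe])
  obtain rfl : a = 0 := by simpa using h1
  obtain rfl : b = 0 := by simpa using h2
  rw [zero_smul, zero_smul, zero_add, zero_add] at hww
  obtain ⟨y, hli, hey, hye, hyy⟩ := exists_normalized hli hew hwe ⟨c, hww⟩
  have hyu : y * u = 0 := mul_eq_zero_of_right hye heu
  obtain ⟨a, b, c, huy, h1, h2, h3⟩ := exists_peirce_coords hA hli he.idem (l₁ := 1) (r₁ := 0)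
    (l₂ := 0) (r₂ := 0) (l := 1) (r := 0) (x := u * y) (by simp [heu]) (by simp [hue])
    (by simp [hey]) (by simp [hye]) (by simp [← mul_assoc, heu]) (by simp [mul_assoc, hye])
  obtain rfl : a = 0 := by simpa using h1
  obtain rfl : c = 0 := by simpa using h3
  rw [zero_smul, zero_smul, zero_add, add_zero] at huy
  -- Right multiplication by y acts on ℂu by the scalar b. So y² = 0 forces b = 0, while y² = y
  -- leaves b = 0 or b = 1, two different rows.
  have hb : b • b • u = u * (y * y) := by
    rw [← huy, ← smul_mul_assoc, ← huy, mul_assoc]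
  rcases hyy with hyy | hyy
  · obtain rfl : b = 0 := eq_zero_of_smul_smul_eq_zero hu (by rw [hb, hyy, mul_zero])
    refine Or.inr ⟨2, _, rfl, isModelOf_three hA (li_swap' hli) fun i j => ?_⟩
    fin_cases i <;> fin_cases j <;> simp [psi, he.idem, heu, hue, hey, hye, huu, huy, hyu, hyy]
  · rw [hyy, huy, smul_smul, ← sub_eq_zero, ← sub_smul] at hb
    have hb' : b * (b - 1) = 0 := by
      linear_combination (smul_eq_zero.1 hb).resolve_right hu
    rcases mul_eq_zero.1 hb' with h | h
    · subst h
      refine Or.inr ⟨10, _, rfl, isModelOf_three hA (li_rotate (li_rotate hli)) fun i j => ?_⟩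
      fin_cases i <;> fin_cases j <;> simp [psi, he.idem, heu, hue, hey, hye, huu, huy, hyu, hyy]
    · obtain rfl : b = 1 := sub_eq_zero.1 h
      refine Or.inr ⟨12, _, rfl, isModelOf_three hA (li_rotate (li_rotate hli)) fun i j => ?_⟩
      fin_cases i <;> fin_cases j <;> simp [psi, he.idem, heu, hue, hey, hye, huu, huy, hyu, hyy]

theorem classified_01_00 (hA : Module.finrank ℂ A = 3) (he : IsPrimitive e)
    (hli : LinearIndependent ℂ ![e, u, w]) (heu : e * u = 0) (hue : u * e = u) (hew : e * w = 0)
    (hwe : w * e = 0) : Classified A := by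
  have huu : u * u = 0 := mul_eq_zero_of_left hue heu
  have hu : u ≠ 0 := hli.ne_zero 1
  obtain ⟨a, b, c, hww, h1, h2, h3⟩ := exists_peirce_coords hA hli he.idem (l₁ := 0) (r₁ := 1)
    (l₂ := 0) (r₂ := 0) (l := 0) (r := 0) (x := w * w) (by simp [heu]) (by simp [hue])
    (by simp [hew]) (by simp [hwe]) (by simp [← mul_assoc, hew]) (by simp [mul_assoc, hwe])
  obtain rfl : a = 0 := by simpa using h1
  obtain rfl : b = 0 := by simpa using h2
  rw [zero_smul, zero_smul, zero_add, zero_add] at hww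
  obtain ⟨y, hli, hey, hye, hyy⟩ := exists_normalized hli hew hwe ⟨c, hww⟩
  have huy : u * y = 0 := mul_eq_zero_of_left hue hey
  obtain ⟨a, b, c, hyu, h1, h2, h3⟩ := exists_peirce_coords hA hli he.idem (l₁ := 0) (r₁ := 1)
    (l₂ := 0) (r₂ := 0) (l := 0) (r := 1) (x := y * u) (by simp [heu]) (by simp [hue])
    (by simp [hey]) (by simp [hye]) (by simp [← mul_assoc, hey]) (by simp [mul_assoc, hue])
  obtain rfl : a = 0 := by simpa using h1
  obtain rfl : c = 0 := by simpa using h3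
  rw [zero_smul, zero_smul, zero_add, add_zero] at hyu
  have hb : b • b • u = (y * y) * u := by
    rw [← hyu, ← mul_smul_comm, ← hyu, ← mul_assoc]
  rcases hyy with hyy | hyy
  · obtain rfl : b = 0 := eq_zero_of_smul_smul_eq_zero hu (by rw [hb, hyy, zero_mul])
    refine Or.inr ⟨3, _, rfl, isModelOf_three hA (li_swap' hli) fun i j => ?_⟩
    fin_cases i <;> fin_cases j <;> simp [psi, he.idem, heu, hue, hey, hye, huu, huy, hyu, hyy]
  · rw [hyy, hyu, smul_smul, ← sub_eq_zero, ← sub_smul] at hb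
    have hb' : b * (b - 1) = 0 := by
      linear_combination (smul_eq_zero.1 hb).resolve_right hu
    rcases mul_eq_zero.1 hb' with h | h
    · subst h
      refine Or.inr ⟨9, _, rfl, isModelOf_three hA hli fun i j => ?_⟩
      fin_cases i <;> fin_cases j <;> simp [psi, he.idem, heu, hue, hey, hye, huu, huy, hyu, hyy]
    · obtain rfl : b = 1 := sub_eq_zero.1 h
      refine Or.inr ⟨12, _, rfl, isModelOf_three hA (li_swap' hli) fun i j => ?_⟩
      fin_cases i <;> fin_cases j <;> simp [psi, he.idem, heu, hue, hey, hye, huu, huy, hyu, hyy]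

/-- Expand uw in the basis. Multiplying by u on the left removes the coefficients of w and e, in
that order; multiplying by w on the right removes that of u. -/
theorem mul_eq_zero_of_sq_eq_zero (hA : Module.finrank ℂ A = 3)
    (hli : LinearIndependent ℂ ![e, u, w]) (hue : u * e = u) (hew : e * w = w) (huu : u * u = 0)
    (hww : w * w = 0) : u * w = 0 := by
  obtain ⟨a, b, c, huw⟩ := exists_eq_three hA hli (u * w)
  have hli' := linearIndependent_three.1 hli
  have h1 : u * (u * w) = 0 := by rw [← mul_assoc, huu, zero_mul]
  have h2 : (u * w) * w = 0 := by rw [mul_assoc, hww, mul_zero]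
  rw [huw] at h1 h2
  simp only [mul_add, add_mul, mul_smul_comm, smul_mul_assoc, hue, hew, huu, hww, huw,
    smul_zero, add_zero] at h1 h2
  obtain ⟨-, h3, h4⟩ := hli' (c * a) (a + c * b) (c * c) (by rw [← h1]; module)
  obtain rfl : c = 0 := mul_self_eq_zero.1 h4
  obtain rfl : a = 0 := by simpa using h3
  obtain ⟨-, h5, -⟩ := hli' 0 (b * b) 0 (by rw [← h2]; module)
  obtain rfl : b = 0 := mul_self_eq_zero.1 h5
  simpa using huw

/-- Here e is a unit and A is local. A nilpotent z with z² ≠ 0 gives d_19; otherwise the nilpotents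
x and y have zero products and give d_18. -/
theorem classified_11_11 (hA : Module.finrank ℂ A = 3) (he : IsPrimitive e)
    (hli : LinearIndependent ℂ ![e, u, w]) (heu : e * u = u) (hue : u * e = u) (hew : e * w = w)
    (hwe : w * e = w) : Classified A := by
  have : FiniteDimensional ℂ A := FiniteDimensional.of_finrank_pos (by omega)
  obtain ⟨x, hli, hex, hxe, hx⟩ := he.exists_shift hli heu hue
  obtain ⟨y, hli, hey, hye, hy⟩ := he.exists_shift (li_swap' hli) hew hwe
  by_cases h : ∃ z, e * z = z ∧ z * e = z ∧ IsNilpotent (LinearMap.mulLeft ℂ z) ∧ z * z ≠ 0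
  · obtain ⟨z, hez, hze, hz, hzz⟩ := h
    have h3 : z * (z * z) = 0 := by
      simpa [pow_succ, hze] using pow_finrank_apply_eq_zero hz hA e
    refine Or.inr ⟨18, _, rfl, isModelOf_three hA
      (li_rotate (linearIndependent_one_self_sq hze hz hzz)) fun i j => ?_⟩
    have h4 : e * (z * z) = z * z := by rw [← mul_assoc, hez]
    fin_cases i <;> fin_cases j <;> simp [psi, he.idem, hez, hze, mul_assoc, h3, h4]
  · push Not at h
    have hxx := h x hex hxe hx
    have hyy := h y hey hye hy
    have hxy := mul_eq_zero_of_sq_eq_zero hA (li_swap' hli) hxe hey hxx hyy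
    have hyx := mul_eq_zero_of_sq_eq_zero hA hli hye hex hyy hxx
    refine Or.inr ⟨17, _, rfl, isModelOf_three hA (x := e + x) (y := x) (z := y)
      (by simpa using li_add (li_swap' hli) 1) fun i j => ?_⟩
    fin_cases i <;> fin_cases j <;>
      simp [psi, add_mul, mul_add, he.idem, hex, hxe, hey, hye, hxx, hyy, hxy, hyx]

end Peirce

end AlgSpace

/-! ### Dimension two, and direct sums with a two-dimensional corner. -/

namespace AlgSpace

section Corner

variable {B : Type*} [NonUnitalRing B] [Module ℂ B]

theorem IsModelOf.exists_table {n : ℕ} {μ : AlgSpace n} (h : μ.IsModelOf B) :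
    ∃ v : Fin n → B, LinearIndependent ℂ v ∧ ∀ i j, v i * v j = ∑ k, μ (i, j, k) • v k := by
  obtain ⟨φ, hφ⟩ := h
  refine ⟨fun i => φ.symm (Pi.single i 1), ?_, fun i j => φ.injective ?_⟩
  · have := (Pi.basisFun ℂ (Fin n)).linearIndependent.map' φ.symm.toLinearMap φ.symm.ker
    have e1 : (fun i => φ.symm (Pi.single i 1)) = φ.symm.toLinearMap ∘ Pi.basisFun ℂ (Fin n) := by
      funext i
      simp
    rw [e1]
    exact this
  · rw [hφ]
    simp only [LinearEquiv.apply_symm_apply, mul_single_single, map_sum, map_smul]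
    funext k
    simp [Pi.single_apply]

variable [IsScalarTower ℂ B B] [SMulCommClass ℂ B B]

/-- A nil algebra has basis x, x². Otherwise a primitive idempotent e is completed by one Peirce
vector, whose type determines the row, except that in type (0, 0) its square may or may not vanish.
-/
theorem exists_row_two (hB : Module.finrank ℂ B = 2) (hne : ∃ a b : B, a * b ≠ 0) :
    ∃ i, ∃ ν ∈ (tableI i).algebras, ν.IsModelOf B := by
  have : FiniteDimensional ℂ B := FiniteDimensional.of_finrank_pos (by omega)
  have : Nontrivial B := Module.nontrivial_of_finrank_pos (R := ℂ) (by omega)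
  by_cases hnil : ∀ x : B, IsNilpotent (LinearMap.mulLeft ℂ x)
  · have hcube : ∀ x : B, x * (x * x) = 0 := fun x => by
      simpa [pow_succ] using pow_finrank_apply_eq_zero (hnil x) hB x
    by_cases hsq : ∃ x : B, x * x ≠ 0
    · obtain ⟨x, hx⟩ := hsq
      have h := linearIndependent_pow_apply (hnil x) 1 x (by simpa using hx)
      have e1 : ![x, x * x] = fun i : Fin 2 => (LinearMap.mulLeft ℂ x ^ (i : ℕ)) x := by
        funext i
        fin_cases i <;> simp
      rw [← e1] at h
      refine ⟨4, _, rfl, isModelOf_two hB h fun i j => ?_⟩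
      fin_cases i <;> fin_cases j <;> simp [psi, mul_assoc, hcube]
    · push Not at hsq
      exfalso
      obtain ⟨z, hz0, hz, hz'⟩ := exists_annihilator hnil
      obtain ⟨x, hx⟩ : ∃ x, x ∉ Submodule.span ℂ {z} := by
        by_contra! h
        have h1 : Submodule.span ℂ {z} = ⊤ := Submodule.eq_top_iff'.2 h
        have h2 := finrank_span_singleton (K := ℂ) hz0
        rw [h1, finrank_top, hB] at h2
        omega
      have hli : LinearIndependent ℂ ![x, z] := by
        rw [LinearIndependent.pair_symm_iff, LinearIndependent.pair_iff' hz0]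
        exact fun a ha => hx (Submodule.mem_span_singleton.2 ⟨a, ha⟩)
      obtain ⟨a, b, hab⟩ := hne
      obtain ⟨a1, a2, rfl⟩ := exists_eq_two hB hli a
      obtain ⟨b1, b2, rfl⟩ := exists_eq_two hB hli b
      apply hab
      simp [add_mul, mul_add, smul_mul_assoc, mul_smul_comm, hz, hz', hsq]
  · push Not at hnil
    obtain ⟨x, hx⟩ := hnil
    obtain ⟨f, hf0, hff, -⟩ := exists_idempotent_of_not_isNilpotent hx
    obtain ⟨e, he⟩ := exists_isPrimitive hf0 hff
    obtain ⟨v, hv, hv0, hvt⟩ := exists_peirce_basis hB he.ne_zero he.idem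
    obtain ⟨u, hu⟩ : ∃ u, u = v 1 := ⟨_, rfl⟩
    have hli : LinearIndependent ℂ ![e, u] := by
      have e1 : v = ![e, u] := by
        funext i
        fin_cases i
        · exact hv0
        · exact hu.symm
      rwa [e1] at hv
    obtain ⟨heu, hue⟩ := hvt 1
    rw [← hu] at heu hue
    have hu0 : u ≠ 0 := hli.ne_zero 1
    rcases heu with heu | heu <;> rcases hue with hue | hue
    · obtain ⟨c, hc⟩ := he.exists_isNilpotent_sub heu hue
      have h1 := pow_finrank_apply_eq_zero hc hB e
      set y := u - c • e with hy
      have hey : e * y = y := by rw [hy, mul_sub, mul_smul_comm, heu, he.idem]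
      have hye : y * e = y := by rw [hy, sub_mul, smul_mul_assoc, hue, he.idem]
      have hyy : y * y = 0 := by simpa [pow_succ, hye] using h1
      have hli' : LinearIndependent ℂ ![e, y] := by
        rw [LinearIndependent.pair_iff] at hli ⊢
        intro s t hst
        obtain ⟨h2, rfl⟩ := hli (s - t * c) t (by rw [← hst, hy]; module)
        exact ⟨by simpa using h2, rfl⟩
      refine ⟨5, _, rfl, isModelOf_two hB hli' fun i j => ?_⟩
      fin_cases i <;> fin_cases j <;> simp [psi, he.idem, hey, hye, hyy]
    · have huu : u * u = 0 := mul_eq_zero_of_right hue heu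
      refine ⟨1, _, rfl, isModelOf_two hB hli fun i j => ?_⟩
      fin_cases i <;> fin_cases j <;> simp [psi, he.idem, heu, hue, huu]
    · have huu : u * u = 0 := mul_eq_zero_of_left hue heu
      refine ⟨2, _, rfl, isModelOf_two hB hli fun i j => ?_⟩
      fin_cases i <;> fin_cases j <;> simp [psi, he.idem, heu, hue, huu]
    · obtain ⟨a, c, hac⟩ := exists_eq_two hB hli (u * u)
      have ha : a = 0 := by
        have h1 : e * (u * u) = 0 := by rw [← mul_assoc, heu, zero_mul]
        rw [hac, mul_add, mul_smul_comm, mul_smul_comm, he.idem, heu, smul_zero, add_zero] at h1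
        exact (smul_eq_zero.1 h1).resolve_right he.ne_zero
      subst ha
      rw [zero_smul, zero_add] at hac
      by_cases hc : c = 0
      · subst hc
        refine ⟨0, _, rfl, isModelOf_two hB hli fun i j => ?_⟩
        fin_cases i <;> fin_cases j <;> simp [psi, he.idem, heu, hue, hac]
      · have hli' : LinearIndependent ℂ ![e, c⁻¹ • u] := by
          rw [LinearIndependent.pair_iff] at hli ⊢
          intro s t hst
          obtain ⟨h1, h2⟩ := hli s (t * c⁻¹) (by rw [← hst, smul_smul])
          exact ⟨h1, by simpa [hc] using h2⟩
        have h1 : e * c⁻¹ • u = 0 := by rw [mul_smul_comm, heu, smul_zero]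
        have h2 : c⁻¹ • u * e = 0 := by rw [smul_mul_assoc, hue, smul_zero]
        have h3 : c⁻¹ • u * c⁻¹ • u = c⁻¹ • u := by
          rw [mul_smul_comm, smul_mul_assoc, hac, smul_smul c⁻¹ c, inv_mul_cancel₀ hc, one_smul]
        generalize c⁻¹ • u = y at *
        refine ⟨3, _, rfl, isModelOf_two hB hli' fun i j => ?_⟩
        fin_cases i <;> fin_cases j <;> simp [psi, he.idem, h1, h2, h3]

end Corner

variable {A : Type*} [NonUnitalRing A] [Module ℂ A] [IsScalarTower ℂ A A] [SMulCommClass ℂ A A]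

/-- The elements annihilated by `e` from both sides. -/
def corner (e : A) : NonUnitalSubalgebra ℂ A where
  carrier := {x | e * x = 0 ∧ x * e = 0}
  add_mem' := fun {a b} ha hb =>
    ⟨by rw [mul_add, ha.1, hb.1, add_zero], by rw [add_mul, ha.2, hb.2, add_zero]⟩
  zero_mem' := ⟨mul_zero e, zero_mul e⟩
  mul_mem' := fun {a b} ha hb =>
    ⟨by rw [← mul_assoc, ha.1, zero_mul], by rw [mul_assoc, hb.2, mul_zero]⟩
  smul_mem' := fun c x hx =>
    ⟨by rw [mul_smul_comm, hx.1, smul_zero], by rw [smul_mul_assoc, hx.2, smul_zero]⟩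

theorem finrank_corner (hA : Module.finrank ℂ A = 3) {e u w : A} (he : e * e = e)
    (hli : LinearIndependent ℂ ![e, u, w]) (hu : u ∈ corner e) (hw : w ∈ corner e) :
    Module.finrank ℂ (corner e) = 2 := by
  have : FiniteDimensional ℂ A := FiniteDimensional.of_finrank_pos (by omega)
  have he0 : e ≠ 0 := hli.ne_zero 0
  have hlt : Module.finrank ℂ (corner e).toSubmodule < 3 := by
    rw [← hA]
    refine Submodule.finrank_lt fun h => he0 ?_
    have : e ∈ (corner e).toSubmodule := h ▸ Submodule.mem_top
    rw [← he]
    exact this.1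
  have hle : 2 ≤ Module.finrank ℂ (corner e).toSubmodule := by
    have h2 : LinearIndependent ℂ ![(⟨u, hu⟩ : (corner e).toSubmodule), ⟨w, hw⟩] := by
      rw [LinearIndependent.pair_iff]
      intro s t hst
      have h3 : s • u + t • w = 0 := congrArg Subtype.val hst
      exact (linearIndependent_three.1 hli 0 s t (by rw [zero_smul, zero_add, h3])).2
    simpa using h2.fintype_card_le_finrank
  change Module.finrank ℂ (corner e).toSubmodule = 2
  omega

theorem classified_00_00 (hA : Module.finrank ℂ A = 3) {e u w : A} (he : IsPrimitive e)
    (hli : LinearIndependent ℂ ![e, u, w]) (hu : u ∈ corner e) (hw : w ∈ corner e) :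
    Classified A := by
  by_cases hne : ∃ a b : corner e, a * b ≠ 0
  · obtain ⟨i, ν, hν, hmodel⟩ := exists_row_two (finrank_corner hA he.idem hli hu hw) hne
    obtain ⟨v, hv, hmul⟩ := hmodel.exists_table
    obtain ⟨⟨p, hep, hpe⟩, hp⟩ : ∃ p, p = v 0 := ⟨_, rfl⟩
    obtain ⟨⟨q, heq, hqe⟩, hq⟩ : ∃ q, q = v 1 := ⟨_, rfl⟩
    have hpq : LinearIndependent ℂ ![e, p, q] := by
      rw [linearIndependent_three]
      intro a b c habc
      have ha : a = 0 := by
        have h := congrArg (e * ·) habc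
        simp only [mul_add, mul_smul_comm, hep, heq, he.idem, smul_zero, add_zero, mul_zero] at h
        exact (smul_eq_zero.1 h).resolve_right he.ne_zero
      rw [ha, zero_smul, zero_add] at habc
      have h := Fintype.linearIndependent_iff.1 hv ![b, c] (by
        rw [Fin.sum_univ_two, ← hp, ← hq]
        exact Subtype.ext habc)
      exact ⟨ha, h 0, h 1⟩
    have hm : ∀ i j, ((v i : A) * (v j : A)) = ν (i, j, 0) • p + ν (i, j, 1) • q := by
      intro i j
      have := congrArg Subtype.val (hmul i j)
      rw [Fin.sum_univ_two, ← hp, ← hq] at this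
      exact this
    have hpp := hm 0 0
    have hpq' := hm 0 1
    have hqp := hm 1 0
    have hqq := hm 1 1
    simp only [← hp, ← hq] at hpp hpq' hqp hqq
    -- A is the direct sum of ℂe and its corner; adjoining ℂe turns the rows d_1, …, d_6 of
    -- dimension two into d_6, d_11, d_10, d_14, d_2, d_12.
    fin_cases i <;> obtain rfl := hν <;> simp [psi] at hpp hpq' hqp hqq
    · refine Or.inr ⟨5, _, rfl, isModelOf_three hA (li_swap' hpq) fun i j => ?_⟩
      fin_cases i <;> fin_cases j <;> simp [psi, he.idem, hep, hpe, heq, hqe, hpp, hpq', hqp, hqq]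
    · refine Or.inr ⟨10, _, rfl, isModelOf_three hA hpq fun i j => ?_⟩
      fin_cases i <;> fin_cases j <;> simp [psi, he.idem, hep, hpe, heq, hqe, hpp, hpq', hqp, hqq]
    · refine Or.inr ⟨9, _, rfl, isModelOf_three hA (li_rotate hpq) fun i j => ?_⟩
      fin_cases i <;> fin_cases j <;> simp [psi, he.idem, hep, hpe, heq, hqe, hpp, hpq', hqp, hqq]
    · refine Or.inr ⟨13, _, rfl, isModelOf_three hA hpq fun i j => ?_⟩
      fin_cases i <;> fin_cases j <;> simp [psi, he.idem, hep, hpe, heq, hqe, hpp, hpq', hqp, hqq]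
    · refine Or.inr ⟨1, _, rfl, isModelOf_three hA hpq fun i j => ?_⟩
      fin_cases i <;> fin_cases j <;> simp [psi, he.idem, hep, hpe, heq, hqe, hpp, hpq', hqp, hqq]
    · refine Or.inr ⟨11, _, rfl, isModelOf_three hA hpq fun i j => ?_⟩
      fin_cases i <;> fin_cases j <;> simp [psi, he.idem, hep, hpe, heq, hqe, hpp, hpq', hqp, hqq]
  · push Not at hne
    have h0 : ∀ a ∈ corner e, ∀ b ∈ corner e, a * b = 0 := fun a ha b hb =>
      congrArg Subtype.val (hne ⟨a, ha⟩ ⟨b, hb⟩)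
    refine Or.inr ⟨0, _, rfl, isModelOf_three hA hli fun i j => ?_⟩
    fin_cases i <;> fin_cases j <;> simp [psi, he.idem, hu.1, hu.2, hw.1, hw.2, h0 u hu u hu,
      h0 u hu w hw, h0 w hw u hu, h0 w hw w hw]

theorem classified_of_finrank_eq_three (hA : Module.finrank ℂ A = 3)
    (hne : ∃ a b : A, a * b ≠ 0) : Classified A := by
  have : FiniteDimensional ℂ A := FiniteDimensional.of_finrank_pos (by omega)
  by_cases hnil : ∀ x : A, IsNilpotent (LinearMap.mulLeft ℂ x)
  · exact classified_of_nil hA hne hnil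
  push Not at hnil
  obtain ⟨x, hx⟩ := hnil
  obtain ⟨f, hf0, hff, -⟩ := exists_idempotent_of_not_isNilpotent hx
  obtain ⟨e, he⟩ := exists_isPrimitive hf0 hff
  obtain ⟨v, hv, hv0, hvt⟩ := exists_peirce_basis hA he.ne_zero he.idem
  obtain ⟨u, hu⟩ : ∃ u, u = v 1 := ⟨_, rfl⟩
  obtain ⟨w, hw⟩ : ∃ w, w = v 2 := ⟨_, rfl⟩
  have hli : LinearIndependent ℂ ![e, u, w] := by
    have e1 : v = ![e, u, w] := by
      funext i
      fin_cases i
      · exact hv0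
      · exact hu.symm
      · exact hw.symm
    rwa [e1] at hv
  have hli' := li_swap' hli
  obtain ⟨heu, hue⟩ := hvt 1
  obtain ⟨hew, hwe⟩ := hvt 2
  rw [← hu] at heu hue
  rw [← hw] at hew hwe
  -- Up to exchanging u and w, the sixteen combinations of Peirce types reduce to ten.
  rcases heu with heu | heu <;> rcases hue with hue | hue <;> rcases hew with hew | hew <;>
    rcases hwe with hwe | hwe
  · exact classified_11_11 hA he hli heu hue hew hwe
  · exact classified_11_10 hA he hli heu hue hew hwe
  · exact classified_11_01 hA he hli heu hue hew hwe
  · exact classified_11_00 hA he hli heu hue hew hwe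
  · exact classified_11_10 hA he hli' hew hwe heu hue
  · exact classified_10_10 hA he hli heu hue hew hwe
  · exact classified_10_01 hA he hli heu hue hew hwe
  · exact classified_10_00 hA he hli heu hue hew hwe
  · exact classified_11_01 hA he hli' hew hwe heu hue
  · exact classified_10_01 hA he hli' hew hwe heu hue
  · exact classified_01_01 hA he hli heu hue hew hwe
  · exact classified_01_00 hA he hli heu hue hew hwe
  · exact classified_11_00 hA he hli' hew hwe heu hue
  · exact classified_10_00 hA he hli' hew hwe heu hue
  · exact classified_01_00 hA he hli' hew hwe heu hue
  · exact classified_00_00 hA he hli ⟨heu, hue⟩ ⟨hew, hwe⟩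

theorem exists_critical_model {B : Type*} [NonUnitalRing B] [Module ℂ B] {n : ℕ}
    {ν : AlgSpace n} (hν : ν.IsModelOf B)
    (h : ∃ μ : AlgSpace n, μ.Iso ν ∧ μ.IsAssoc ∧ μ.IsCritical) :
    ∃ μ : AlgSpace n, μ.IsAssoc ∧ μ.IsCritical ∧ μ.IsModelOf B := by
  obtain ⟨μ, hiso, ha, hc⟩ := h
  exact ⟨μ, ha, hc, hν.of_iso hiso.symm⟩

end AlgSpace

/-! ### The classification of critical points. -/

theorem mainTheorem10 :
    -- dimension two
    ((∀ (A : Type*) [NonUnitalRing A] [Module ℂ A] [IsScalarTower ℂ A A] [SMulCommClass ℂ A A],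
        Module.finrank ℂ A = 2 → (∃ x y : A, x * y ≠ 0) →
          (∃ μ : AlgSpace 2, μ.IsAssoc ∧ μ.IsCritical ∧ μ.IsModelOf A) ∧
          (∃! i, ∃ ν ∈ (AlgSpace.tableI i).algebras, ν.IsModelOf A)) ∧
      (∀ i, ∀ ν ∈ (AlgSpace.tableI i).algebras, ν.IsAssoc ∧ ν ≠ 0 ∧
        (∃ μ : AlgSpace 2, μ.Iso ν ∧ μ.IsAssoc ∧ μ.IsCritical) ∧
        (∀ μ : AlgSpace 2, μ.Iso ν → μ.IsCritical →
          μ.HasType (AlgSpace.tableI i).type ∧ μ.F = (AlgSpace.tableI i).value))) ∧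
    -- dimension three
    ((∀ (A : Type*) [NonUnitalRing A] [Module ℂ A] [IsScalarTower ℂ A A] [SMulCommClass ℂ A A],
        Module.finrank ℂ A = 3 → (∃ x y : A, x * y ≠ 0) →
          ((∃ μ : AlgSpace 3, μ.IsAssoc ∧ μ.IsCritical ∧ μ.IsModelOf A) ↔
            ¬ AlgSpace.d21.IsModelOf A) ∧
          (¬ AlgSpace.d21.IsModelOf A →
            ∃! i, ∃ ν ∈ (AlgSpace.tableII i).algebras, ν.IsModelOf A)) ∧
      (AlgSpace.d21.IsAssoc ∧ AlgSpace.d21 ≠ 0 ∧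
        ∀ μ : AlgSpace 3, μ.Iso AlgSpace.d21 → ¬ μ.IsCritical) ∧
      (∀ i, ∀ ν ∈ (AlgSpace.tableII i).algebras, ν.IsAssoc ∧ ν ≠ 0 ∧
        (∃ μ : AlgSpace 3, μ.Iso ν ∧ μ.IsAssoc ∧ μ.IsCritical) ∧
        (∀ μ : AlgSpace 3, μ.Iso ν → μ.IsCritical →
          μ.HasType (AlgSpace.tableII i).type ∧ μ.F = (AlgSpace.tableII i).value))) := by
  refine ⟨⟨fun A _ _ _ _ hA hne => ?_, fun i => AlgSpace.tableI_spec i⟩,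
    fun A _ _ _ _ hA hne => ?_,
    ⟨AlgSpace.isAssoc_d21, AlgSpace.d21_ne_zero, fun μ => AlgSpace.not_isCritical_of_iso_d21⟩,
    fun i => AlgSpace.tableII_spec i⟩
  · obtain ⟨i, ν, hν, hA'⟩ := AlgSpace.exists_row_two hA hne
    refine ⟨AlgSpace.exists_critical_model hA' (AlgSpace.tableI_spec i ν hν).2.2.1,
      i, ⟨ν, hν, hA'⟩, ?_⟩
    rintro j ⟨ν', hν', hA''⟩
    exact AlgSpace.tableI_row_unique hν' hν (hA''.iso hA')
  · have hex : ¬ AlgSpace.d21.IsModelOf A →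
        ∃ i, ∃ ν ∈ (AlgSpace.tableII i).algebras, ν.IsModelOf A :=
      (AlgSpace.classified_of_finrank_eq_three hA hne).resolve_left
    refine ⟨⟨?_, fun h => ?_⟩, fun h => ?_⟩
    · rintro ⟨μ, -, hc, hμ⟩ h
      exact AlgSpace.not_isCritical_of_iso_d21 (hμ.iso h) hc
    · obtain ⟨i, ν, hν, hA'⟩ := hex h
      exact AlgSpace.exists_critical_model hA' (AlgSpace.tableII_spec i ν hν).2.2.1
    · obtain ⟨i, ν, hν, hA'⟩ := hex h
      refine ⟨i, ⟨ν, hν, hA'⟩, ?_⟩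
      rintro j ⟨ν', hν', hA''⟩
      exact AlgSpace.tableII_row_unique hν' hν (hA''.iso hA')
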